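/- Let $a>0$ and $p>\frac32$, let $\mathbb Z_*=\mathbb Z\setminus\{0\}$, and let $\ell^{a,p}$ be the space of complex sequences $q=(q_n)_{n\in\mathbb Z_*}$ with $\|q\|_{a,p}^2=\sum_n|q_n|^2|n|^{2p}e^{2a|n|}<\infty$, regarded as a real normed space with the symplectic form $-\mathrm i\sum_j dq_j\wedge d\bar q_j$. The Hamiltonian vector field of a real function $H$ is $X_H=(-\mathrm i\,\partial H/\partial\bar q_j)_j$. Put $u=\sum_j q_j\phi_j$ with $\phi_j(x)=(2\pi)^{-1/2}e^{\mathrm ijx}$, and $$\Lambda=\sum_{j\in\mathbb Z_*}j^2|q_j|^2,\qquad G=-\frac{\mathrm i}{2}\int_0^{2\pi}|u|^2\,\bar u\,u_x\,dx .$$ Let $n_1,n_2\in\mathbb Z_*$ with $n_1$ odd and $|n_2-n_1|=4$. Then there are a real Hamiltonian $F=\frac12\sum_{i+j=k+l}F_{ijkl}\,q_iq_j\bar q_k\bar q_l$ on $\ell^{a,p}$, homogeneous of degree four, with $F$ and $X_F:\ell^{a,p}\to\ell^{a,p}$ real analytic, and a real-analytic symplectic change of coordinates $\Gamma$ from a neighbourhood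 $U$ of the origin in $\ell^{a,p}$ onto another one, with $\Gamma(0)=0$ and real-analytic inverse, which is on $U$ the time-1 map of the flow of $X_F$, such that on $U$ $$(\Lambda+G)\circ\Gamma=\Lambda+\bar G+\hat G+K,$$ where $$\bar G=\frac1{4\pi}\sum_{i,j\in\mathbb Z_*}j|q_i|^2|q_j|^2,\qquad \hat G=\frac1{4\pi}\sum_{i\ne j}j|q_i|^2|q_j|^2+\frac1{4\pi}\sum{}'\,j\,q_iq_j\bar q_k\bar q_l ,$$ and $\sum'$ runs over all $(i,j,k,l)\in\mathbb Z_*^4$ with $i+j=k+l$ and $\{i,j\}\ne\{k,l\}$ that have at least three components outside $\{n_1,n_2\}$ (so the normal form contains no non-resonant quartic term with two or more components in $\{n_1,n_2\}$). The functions $\bar G,\hat G,K$ are real valued and real analytic on $U$, their vector fields $X_{\bar G},X_{\hat G},X_K$ are real analytic from $U\subset\ell^{a,p}$ to $\ell^{a,p-1}$, and as $q\to0$ $$|\hat G|=O(\|q\|_{a,p}^4),\quad \|X_{\hat G}\|_{a,p-1}=O(\|q\|_{a,p}^3),\quad |K|=O(\|q\|_{a,p}^6),\quad \|X_K\|_{a,p-1}=O(\|q\|_{a,p}^5).$$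 Moreover $K\in\mathcal A_{n_1,n_2}$: on $U$ there is an unconditionally convergent expansion $K=\sum_{\alpha,\beta}K_{\alpha\beta}q^\alpha\bar q^\beta$ (over finitely supported $\alpha,\beta\in\mathbb N^{\mathbb Z_*}$) in which $K_{\alpha\beta}=0$ whenever $\sum_n(\alpha_n-\beta_n)n\ne0$ (compact form) and $K_{\alpha\beta}=0$ whenever $\sum_n(\alpha_n-\beta_n)\ne0$ (gauge invariance). -/

import Mathlib

open scoped Topology Asymptotics

noncomputable section

namespace DNLS

/-- The index set of nonzero integers. -/
abbrev ZStar : Type := {n : ℤ // n ≠ 0}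

/-- The weight `|n|^p e^{a|n|}`. -/
def weight (a p : ℝ) (n : ZStar) : ℝ := |(n.1 : ℝ)| ^ p * Real.exp (a * |(n.1 : ℝ)|)

lemma weight_pos (a p : ℝ) (n : ZStar) : 0 < weight a p n := by
  have h : (n.1 : ℝ) ≠ 0 := by exact_mod_cast n.2
  unfold weight
  positivity

lemma weight_sq (a p : ℝ) (n : ZStar) :
    weight a p n ^ 2 = |(n.1 : ℝ)| ^ (2 * p) * Real.exp (2 * a * |(n.1 : ℝ)|) := by
  unfold weight
  rw [mul_pow, ← Real.exp_nat_mul, ← Real.rpow_natCast, ← Real.rpow_mul (abs_nonneg _)]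
  push_cast
  ring_nf

lemma summable_iff_memℓp (a p : ℝ) (q : ZStar → ℂ) :
    Summable (fun n : ZStar =>
      ‖q n‖ ^ 2 * |(n.1 : ℝ)| ^ (2 * p) * Real.exp (2 * a * |(n.1 : ℝ)|)) ↔
    Memℓp (E := fun _ : ZStar => ℂ) (fun n => (weight a p n : ℝ) • q n) 2 := by
  rw [memℓp_gen_iff (by norm_num)]
  refine summable_congr fun n => ?_
  rw [norm_smul, Real.norm_of_nonneg (weight_pos a p n).le, mul_assoc, ← weight_sq]
  norm_num [mul_pow, mul_comm]

/-- The linear space of sequences `q = (q_n)_{n ≠ 0}` of complex numbers such that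
`∑ |q_n|² |n|^{2p} e^{2a|n|} < ∞`. -/
def ellSubmodule (a p : ℝ) : Submodule ℝ (ZStar → ℂ) where
  carrier := {q | Summable (fun n : ZStar =>
    ‖q n‖ ^ 2 * |(n.1 : ℝ)| ^ (2 * p) * Real.exp (2 * a * |(n.1 : ℝ)|))}
  add_mem' {x y} hx hy := by
    rw [Set.mem_ofPred_eq, summable_iff_memℓp] at *
    convert hx.add hy using 1
    funext n
    simp
  zero_mem' := by
    rw [Set.mem_ofPred_eq, summable_iff_memℓp]
    convert (zero_memℓp : Memℓp (0 : ∀ _ : ZStar, ℂ) 2) using 1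
    funext n
    simp
  smul_mem' c x hx := by
    rw [Set.mem_ofPred_eq, summable_iff_memℓp] at *
    convert hx.const_smul c using 1
    funext n
    simp only [Pi.smul_apply]
    rw [smul_comm]

/-- The phase space `ℓ^{a,p}`, as a real vector space. -/
def Ell (a p : ℝ) : Type := ↥(ellSubmodule a p)

variable {a p : ℝ}

instance : AddCommGroup (Ell a p) := inferInstanceAs (AddCommGroup ↥(ellSubmodule a p))
instance : Module ℝ (Ell a p) := inferInstanceAs (Module ℝ ↥(ellSubmodule a p))

/-- `q n` is the `n`-th entry of the sequence `q`. -/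
instance : CoeFun (Ell a p) (fun _ => ZStar → ℂ) := ⟨fun q => q.1⟩

/-- The embedding `q ↦ (|n|^p e^{a|n|} q_n)_n` of `ℓ^{a,p}` into the unweighted space `ℓ²`. -/
def toEllTwo (a p : ℝ) : Ell a p →ₗ[ℝ] lp (fun _ : ZStar => ℂ) 2 where
  toFun q := ⟨fun n => weight a p n • q n, (summable_iff_memℓp a p q.1).1 q.2⟩
  map_add' x y := by
    ext n
    exact smul_add (weight a p n) (x n) (y n)
  map_smul' c x := by
    ext n
    exact smul_comm (weight a p n) c (x n)

lemma toEllTwo_injective (a p : ℝ) : Function.Injective (toEllTwo a p) := by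
  intro x y h
  apply Subtype.ext
  funext n
  have h1 : weight a p n • x n = weight a p n • y n := congrArg (fun f => f.1 n) h
  exact smul_right_injective ℂ (weight_pos a p n).ne' h1

instance : NormedAddCommGroup (Ell a p) :=
  NormedAddCommGroup.induced _ _ (toEllTwo a p) (toEllTwo_injective a p)

instance : NormedSpace ℝ (Ell a p) := NormedSpace.induced ℝ _ _ (toEllTwo a p)

/-- The norm of `ℓ^{a,p}` is the one given by `‖q‖² = ∑ |q_n|² |n|^{2p} e^{2a|n|}`. -/
lemma norm_sq_eq (q : Ell a p) :
    ‖q‖ ^ 2 = ∑' n : ZStar,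
      ‖q n‖ ^ 2 * |(n.1 : ℝ)| ^ (2 * p) * Real.exp (2 * a * |(n.1 : ℝ)|) := by
  have h : ‖q‖ = ‖toEllTwo a p q‖ := rfl
  have h2 := lp.norm_rpow_eq_tsum (p := 2) (by norm_num) (toEllTwo a p q)
  rw [h]
  norm_num at h2
  rw [h2]
  refine tsum_congr fun n => ?_
  change ‖weight a p n • q n‖ ^ 2 = _
  rw [norm_smul, Real.norm_of_nonneg (weight_pos a p n).le, mul_assoc, ← weight_sq]
  ring

/-- The sequence with entry `z` at the index `j` and zero elsewhere. -/
def single (j : ZStar) (z : ℂ) : Ell a p :=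
  ⟨Pi.single j z, summable_of_ne_finset_zero (s := {j}) fun n hn => by
    rw [Pi.single_eq_of_ne (by simpa using hn)]
    simp⟩

/-! ### The Hamiltonian -/

/-- The function `u = ∑ q_j φ_j` with `φ_j(x) = (2π)^{-1/2} e^{ijx}`. -/
def fourierSum (q : Ell a p) (x : ℝ) : ℂ :=
  ∑' j : ZStar, q j * ((Real.sqrt (1 / (2 * Real.pi)) : ℝ) * Complex.exp (Complex.I * j.1 * x))

/-- `Λ = ∑ j² |q_j|²`. -/
def Lam (q : Ell a p) : ℝ := ∑' j : ZStar, (j.1 : ℝ) ^ 2 * ‖q j‖ ^ 2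

/-- `G = -(i/2) ∫_0^{2π} |u|² ū u_x dx`. -/
def G (q : Ell a p) : ℂ :=
  -(Complex.I / 2) * ∫ x in (0 : ℝ)..(2 * Real.pi),
    (‖fourierSum q x‖ ^ 2 : ℂ) * (starRingEnd ℂ) (fourierSum q x) * deriv (fourierSum q) x

/-- `Ḡ = (1/4π) ∑_{i,j} j |q_i|² |q_j|²`. -/
def Gbar (q : Ell a p) : ℝ :=
  1 / (4 * Real.pi) * ∑' x : ZStar × ZStar, (x.2.1 : ℝ) * ‖q x.1‖ ^ 2 * ‖q x.2‖ ^ 2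

/-- `(1/4π) ∑_{i ≠ j} j |q_i|² |q_j|²`. -/
def offDiag (q : Ell a p) : ℝ :=
  1 / (4 * Real.pi) * ∑' x : ZStar × ZStar,
    if x.1 ≠ x.2 then (x.2.1 : ℝ) * ‖q x.1‖ ^ 2 * ‖q x.2‖ ^ 2 else 0

/-! ### Quartic monomials -/

/-- Quadruples `(i, j, k, l)` of nonzero integers. -/
structure Quad where
  (i j k l : ZStar)

/-- `i + j = k + l`. -/
def Quad.Momentum (x : Quad) : Prop := x.i.1 + x.j.1 = x.k.1 + x.l.1

/-- `{i, j} = {k, l}`. -/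
def Quad.Resonant (x : Quad) : Prop := ({x.i, x.j} : Set ZStar) = {x.k, x.l}

/-- The number of components of `(i, j, k, l)` that are not in `{n₁, n₂}`. -/
def Quad.normalCount (n₁ n₂ : ℤ) (x : Quad) : ℕ :=
  [x.i.1, x.j.1, x.k.1, x.l.1].countP (fun m => m ≠ n₁ ∧ m ≠ n₂)

/-- The monomial `q_i q_j q̄_k q̄_l`. -/
def Quad.mono (x : Quad) (q : Ell a p) : ℂ :=
  q x.i * q x.j * (starRingEnd ℂ) (q x.k) * (starRingEnd ℂ) (q x.l)

open Classical in
/-- The terms of the sum of `(1/4π) j q_i q_j q̄_k q̄_l` over all non-resonant `(i, j, k, l)` with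
`i + j = k + l` and at least three components outside `{n₁, n₂}`. -/
def deltaThreeTerm (n₁ n₂ : ℤ) (q : Ell a p) (x : Quad) : ℂ :=
  if x.Momentum ∧ ¬ x.Resonant ∧ 3 ≤ x.normalCount n₁ n₂ then
    (1 / (4 * Real.pi) : ℝ) * (x.j.1 : ℂ) * x.mono q
  else 0

/-- `F = ½ ∑_{i+j=k+l} F_{ijkl} q_i q_j q̄_k q̄_l` for some coefficients `F_{ijkl}`, with an
unconditionally convergent sum on the whole of `ℓ^{a,p}`. -/
def IsQuartic (F : Ell a p → ℝ) : Prop :=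
  ∃ c : Quad → ℂ, (∀ x, ¬ x.Momentum → c x = 0) ∧
    ∀ q : Ell a p, HasSum (fun x : Quad => 1 / 2 * (c x * x.mono q)) (F q : ℂ)

/-! ### Hamiltonian vector fields and symplectic maps -/

/-- The Wirtinger derivative `∂H/∂q̄_j = ½ (∂H/∂x_j + i ∂H/∂y_j)`, where `q_j = x_j + i y_j`. -/
def dbar (H : Ell a p → ℝ) (q : Ell a p) (j : ZStar) : ℂ :=
  1 / 2 * ((fderiv ℝ H q (single j 1) : ℝ) +
    Complex.I * (fderiv ℝ H q (single j Complex.I) : ℝ))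

/-- On `U`, the function `H` is real analytic, and its Hamiltonian vector field
`X_H = (-i ∂H/∂q̄_j)_j` is a real analytic map `X` from `U ⊆ ℓ^{a,p}` to `ℓ^{a,p'}`. -/
structure HasAnalyticVF {p' : ℝ} (H : Ell a p → ℝ) (X : Ell a p → Ell a p')
    (U : Set (Ell a p)) : Prop where
  analytic : AnalyticOnNhd ℝ H U
  analytic_vf : AnalyticOnNhd ℝ X U
  vf_eq : ∀ q ∈ U, ∀ j, X q j = -Complex.I * dbar H q j

/-- The symplectic form `-i ∑ dq_j ∧ dq̄_j`. -/
def symp (v w : Ell a p) : ℂ :=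
  -Complex.I * ∑' j : ZStar, (v j * (starRingEnd ℂ) (w j) - w j * (starRingEnd ℂ) (v j))

/-- `Γ` is a real analytic symplectic change of coordinates of a neighbourhood of the origin onto
another one, fixing the origin. -/
structure IsSymplecticChange (Γ : OpenPartialHomeomorph (Ell a p) (Ell a p)) : Prop where
  zero_mem : (0 : Ell a p) ∈ Γ.source
  map_zero : Γ 0 = 0
  analytic : AnalyticOnNhd ℝ Γ Γ.source
  analytic_symm : AnalyticOnNhd ℝ Γ.symm Γ.target
  symplectic : ∀ q ∈ Γ.source, ∀ v w,
    symp (fderiv ℝ Γ q v) (fderiv ℝ Γ q w) = symp v w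

/-- On `U`, the map `Γ` is the time-1 map of the flow of `q' = X q`. -/
def IsTimeOneMap (X Γ : Ell a p → Ell a p) (U : Set (Ell a p)) : Prop :=
  ∀ q ∈ U, ∃ γ : ℝ → Ell a p, γ 0 = q ∧ γ 1 = Γ q ∧
    ∀ t ∈ Set.Icc (0 : ℝ) 1, HasDerivWithinAt γ (X (γ t)) (Set.Icc 0 1) t

/-! ### Compact form and gauge invariance -/

/-- The expansion `P = ∑_{α,β} P_{αβ} q^α q̄^β` on `U`, with unconditional convergence. The
exponents `α`, `β` are finitely supported families of natural numbers. -/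
def HasExpansion (P : Ell a p → ℝ) (c : (ZStar →₀ ℕ) × (ZStar →₀ ℕ) → ℂ)
    (U : Set (Ell a p)) : Prop :=
  ∀ q ∈ U, HasSum (fun x : (ZStar →₀ ℕ) × (ZStar →₀ ℕ) =>
    c x * (x.1.prod fun n m => q n ^ m) *
      (x.2.prod fun n m => (starRingEnd ℂ) (q n) ^ m)) (P q : ℂ)

/-- Compact form: `P_{αβ} = 0` whenever `∑ (α_n - β_n) n ≠ 0`. -/
def CompactForm (c : (ZStar →₀ ℕ) × (ZStar →₀ ℕ) → ℂ) : Prop :=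
  ∀ x, (x.1.sum fun n m => (m : ℤ) * n.1) - (x.2.sum fun n m => (m : ℤ) * n.1) ≠ 0 → c x = 0

/-- Gauge invariance: `P_{αβ} = 0` whenever `∑ (α_n - β_n) ≠ 0`. -/
def GaugeInvariant (c : (ZStar →₀ ℕ) × (ZStar →₀ ℕ) → ℂ) : Prop :=
  ∀ x, (x.1.sum fun _ m => (m : ℤ)) - (x.2.sum fun _ m => (m : ℤ)) ≠ 0 → c x = 0

/-- The class `A_{n₁,n₂}` for functions of `(q, q̄)`. There are no angle variables, so that the
conditions on the exponents do not involve `n₁`, `n₂`. -/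
def InClassA (P : Ell a p → ℝ) (U : Set (Ell a p)) : Prop :=
  ∃ c, HasExpansion P c U ∧ CompactForm c ∧ GaugeInvariant c

/-- `{n₁, n₂} ∈ J`. -/
def Admissible (n₁ n₂ : ℤ) : Prop := n₁ ≠ 0 ∧ n₂ ≠ 0 ∧ Odd n₁ ∧ |n₂ - n₁| = 4

end DNLS

end

noncomputable section

set_option maxSynthPendingDepth 3
set_option linter.unusedSectionVars false

namespace DNLS

/-! The method is one step of Birkhoff normal form by a Lie transform. In Fourier coefficients `G`
is the quartic form with kernel `j / 4π` on `i + j = k + l`; symmetrised, its kernel is `(i + j) /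
4π` in the normalisation `½ ∑`. Let `N` be the part of `G` on the non-resonant quadruples with two
or more components in `{n₁, n₂}`. On `i + j = k + l` the divisor `i² + j² - k² - l²` equals `-2 (k -
i)(k - j)`, so off resonance it is nonzero, and `F` is obtained from `N` by multiplying its kernel
by `i / divisor`. This solves the homological equation `dΛ(X_F) = -N` (`pair_vf_kerF`).

The decisive estimate is `Quad.Removable.abs_add_le`: when two components are confined to `{n₁,
n₂}`, `|i + j|` is at most a constant times `|k - i| |k - j|`. The division therefore absorbs the
derivative in `G`: the kernel of `F` is bounded, and `X_F` is a bounded cubic convolution on every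
`ℓ^{a,s}` with `s > 1/2`, by Young's inequality (`ennormSq_convSeq_le`). In contrast `X_G` and `X_N`
lose one power of the weight and take values in `ℓ^{a,p-1}`.

The integral equation of a cubic field is inverted near zero in the Banach space of curves on `[0,
1]`. This gives analytic flow lines `Φ q` (`exists_flow`), and `Γ` is their value at time 1.
Integrating `dΛ(X_F) = -N` along a flow line gives `Λ(Γ q) = Λ(q) - ∫₀¹ N(Φ_t q) dt`. With `G = Ḡ +
Ĝ + N` the remainder is exactly `K = [G(Φ_1) - G] - ∫₀¹ [N(Φ_t) - N] dt`, so neither a Taylor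
expansion nor a double Poisson bracket is needed.

The vector field of `H ∘ Φ_t` is `(DΦ_t)⁻¹ X_H(Φ_t)`. Since `X_H` lies only in `ℓ^{a,p-1}`, the
linearised equation is solved and inverted in that larger space; this uses that `X_F` is bounded
there too, as `p - 1 > 1/2`. Its propagator preserves the symplectic form because the linearised
Hamiltonian field is skew (`propagator_preserves`, `om_cubicDeriv_vf_skew`). This gives both
symplecticity of `Γ` and the formula for `X_K` (`fderiv_endMinusMean`). The orders 6 and 5 follow
from `Φ_t q - q = O(‖q‖³)` and `(DΦ_t)⁻¹ - 1 = O(‖q‖²)`.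

For the monomial expansion of `K`, Picard iteration is resolved into a sum over ternary trees
(`eventually_hasSum_flow`). A convolution majorant of that sum stays in `ℓ^{a,p}`, so the `j`-th
entry of `Γ` is an absolutely convergent series of monomials of momentum `j` and charge 1.
Substitution into `Λ` and `G`, and subtraction of `Λ`, `Ḡ` and `Ĝ`, leaves only monomials of
momentum and charge zero. -/

/-! ### Curves in a Banach space -/

section Curves

variable {E F W : Type*} [NormedAddCommGroup E] [NormedSpace ℝ E]
  [NormedAddCommGroup F] [NormedSpace ℝ F] [NormedAddCommGroup W] [NormedSpace ℝ W]

/-- The space of continuous curves `[0, 1] → E`. -/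
abbrev Curve (E : Type*) [TopologicalSpace E] : Type _ := C(unitInterval, E)

/-- The continuous extension of a curve to the real line that is constant outside `[0, 1]`. -/
def Curve.extend (f : Curve E) : C(ℝ, E) := f.IccExtend zero_le_one

lemma Curve.extend_of_mem (f : Curve E) {t : ℝ} (ht : t ∈ Set.Icc (0 : ℝ) 1) :
    f.extend t = f ⟨t, ht⟩ := by
  simp only [Curve.extend, ContinuousMap.coe_IccExtend]
  exact Set.IccExtend_of_mem zero_le_one f ht

lemma Curve.extend_coe (f : Curve E) (t : unitInterval) : f.extend t = f t :=
  f.extend_of_mem t.2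

lemma Curve.norm_extend_le (f : Curve E) (t : ℝ) : ‖f.extend t‖ ≤ ‖f‖ := by
  simp only [Curve.extend, ContinuousMap.coe_IccExtend, Set.IccExtend, Function.comp]
  exact f.norm_coe_le_norm _

lemma Curve.intervalIntegrable (f : Curve E) (s t : ℝ) :
    IntervalIntegrable f.extend MeasureTheory.volume s t :=
  f.extend.continuous.intervalIntegrable s t

/-- The primitive `t ↦ ∫_0^t f` of a curve. -/
def primitive (E : Type*) [NormedAddCommGroup E] [NormedSpace ℝ E] : Curve E →L[ℝ] Curve E :=
  LinearMap.mkContinuous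
    { toFun := fun f => ⟨fun t => ∫ s in (0 : ℝ)..t, f.extend s,
        (intervalIntegral.continuous_primitive (fun s t => f.intervalIntegrable s t) 0).comp
          continuous_subtype_val⟩
      map_add' := fun f g => by
        ext t
        exact intervalIntegral.integral_add (f.intervalIntegrable 0 t) (g.intervalIntegrable 0 t)
      map_smul' := fun c f => by
        ext t
        exact intervalIntegral.integral_smul c f.extend } 1 fun f => by
    rw [ContinuousMap.norm_le _ (by positivity)]
    intro t
    have h := intervalIntegral.norm_integral_le_of_norm_le_const (a := 0) (b := (t : ℝ))
      (f := f.extend) (C := ‖f‖) fun x _ => f.norm_extend_le x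
    have ht := t.2
    rw [sub_zero, abs_of_nonneg ht.1] at h
    refine h.trans ?_
    rw [mul_comm]
    exact mul_le_mul_of_nonneg_right ht.2 (norm_nonneg f)

lemma primitive_apply (f : Curve E) (t : unitInterval) :
    primitive E f t = ∫ s in (0 : ℝ)..t, f.extend s := rfl

lemma norm_primitive_le (f : Curve E) : ‖primitive E f‖ ≤ ‖f‖ := by
  simpa using (primitive E).le_of_opNorm_le (LinearMap.mkContinuous_norm_le _ zero_le_one _) f

/-- Pointwise application of a curve of operators to a curve of vectors. -/
def curveApp : Curve (E →L[ℝ] F) →L[ℝ] Curve E →L[ℝ] Curve F :=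
  LinearMap.mkContinuous₂
    (LinearMap.mk₂ ℝ (fun (A : Curve (E →L[ℝ] F)) (f : Curve E) =>
      (⟨fun t => A t (f t), A.continuous.clm_apply f.continuous⟩ : Curve F))
      (fun _ _ _ => rfl) (fun _ _ _ => rfl) (fun A f g => by ext t; exact map_add (A t) _ _)
      (fun c A f => by ext t; exact map_smul (A t) c _)) 1 fun A f => by
    rw [ContinuousMap.norm_le _ (by positivity)]
    intro t
    rw [one_mul]
    refine ((A t).le_opNorm (f t)).trans ?_
    gcongr
    · exact A.norm_coe_le_norm t
    · exact f.norm_coe_le_norm t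

@[simp] lemma curveApp_apply (A : Curve (E →L[ℝ] F)) (f : Curve E) (t : unitInterval) :
    curveApp A f t = A t (f t) := rfl

lemma norm_curveApp_le (A : Curve (E →L[ℝ] F)) (f : Curve E) : ‖curveApp A f‖ ≤ ‖A‖ * ‖f‖ := by
  rw [ContinuousMap.norm_le _ (by positivity)]
  intro t
  refine ((A t).le_opNorm (f t)).trans ?_
  gcongr
  · exact A.norm_coe_le_norm t
  · exact f.norm_coe_le_norm t

/-- Composition of a curve with a continuous linear map. -/
def curveMap (L : E →L[ℝ] F) : Curve E →L[ℝ] Curve F :=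
  L.compLeftContinuous ℝ unitInterval

@[simp] lemma curveMap_apply (L : E →L[ℝ] F) (f : Curve E) (t : unitInterval) :
    curveMap L f t = L (f t) := rfl

/-- Constant curves. -/
def curveConst (E : Type*) [NormedAddCommGroup E] [NormedSpace ℝ E] : E →L[ℝ] Curve E :=
  LinearMap.mkContinuous
    { toFun := fun x => ContinuousMap.const unitInterval x
      map_add' := fun _ _ => rfl
      map_smul' := fun _ _ => rfl } 1 fun x => by
    rw [ContinuousMap.norm_le _ (by positivity)]
    intro t
    rw [one_mul]
    exact le_rfl

@[simp] lemma curveConst_apply (x : E) (t : unitInterval) : curveConst E x t = x := rfl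

/-- Evaluation of a curve. -/
abbrev curveEval (t : unitInterval) : Curve E →L[ℝ] E := ContinuousMap.evalCLM ℝ t

/-- This turns the integral equation into the differential equation. The derivative is taken within
`[0, 1]` because the constant extension may have corners at the end points. -/
lemma hasDerivWithinAt_extend [CompleteSpace E] {γ f : Curve E} {q : E}
    (h : γ = curveConst E q + primitive E f) {t : ℝ} (ht : t ∈ Set.Icc (0 : ℝ) 1) :
    HasDerivWithinAt γ.extend (f.extend t) (Set.Icc 0 1) t := by
  have h1 : HasDerivAt (fun t => q + ∫ s in (0 : ℝ)..t, f.extend s) (f.extend t) t :=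
    (intervalIntegral.integral_hasDerivAt_right (f.intervalIntegrable 0 t)
      (f.extend.continuous.stronglyMeasurableAtFilter _ _) f.extend.continuous.continuousAt).const_add q
  have h2 : ∀ s ∈ Set.Icc (0 : ℝ) 1, γ.extend s = q + ∫ s in (0 : ℝ)..s, f.extend s := by
    intro s hs
    rw [γ.extend_of_mem hs, h]
    rfl
  exact h1.hasDerivWithinAt.congr h2 (h2 t ht)

lemma primitive_one_eq_sub [CompleteSpace F] {h : ℝ → F} {f : Curve F}
    (hd : ∀ t ∈ Set.Icc (0 : ℝ) 1, HasDerivWithinAt h (f.extend t) (Set.Icc 0 1) t) :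
    primitive F f 1 = h 1 - h 0 := by
  rw [primitive_apply]
  refine intervalIntegral.integral_eq_sub_of_hasDeriv_right_of_le zero_le_one
    (fun t ht => (hd t ht).continuousWithinAt) (fun t ht => ?_) (f.intervalIntegrable 0 1)
  exact ((hd t (Set.Ioo_subset_Icc_self ht)).hasDerivAt (Icc_mem_nhds ht.1 ht.2)).hasDerivWithinAt

/-- The cubic map `q ↦ T(q, q, q)`. -/
def cubic (T : E →L[ℝ] E →L[ℝ] E →L[ℝ] F) (q : E) : F := T q q q

/-- The cubic map on curves. -/
def curveCubic (T : E →L[ℝ] E →L[ℝ] E →L[ℝ] F) (γ : Curve E) : Curve F :=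
  curveApp (curveApp (curveMap T γ) γ) γ

@[simp] lemma curveCubic_apply (T : E →L[ℝ] E →L[ℝ] E →L[ℝ] F) (γ : Curve E) (t : unitInterval) :
    curveCubic T γ t = cubic T (γ t) := rfl

lemma analyticAt_clm_apply {f : E → F →L[ℝ] W} {g : E → F} {x : E} (hf : AnalyticAt ℝ f x)
    (hg : AnalyticAt ℝ g x) : AnalyticAt ℝ (fun y => f y (g y)) x :=
  ((ContinuousLinearMap.id ℝ (F →L[ℝ] W)).analyticAt_bilinear (f x, g x)).comp₂ hf hg

lemma analyticAt_clm_comp (L : F →L[ℝ] W) {f : E → F} {x : E} (hf : AnalyticAt ℝ f x) :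
    AnalyticAt ℝ (fun y => L (f y)) x :=
  (L.analyticAt _).comp hf

lemma analyticAt_cubic (T : E →L[ℝ] E →L[ℝ] E →L[ℝ] F) (x : E) : AnalyticAt ℝ (cubic T) x :=
  analyticAt_clm_apply (f := fun q => T q q)
    (analyticAt_clm_apply (f := fun q => T q) (T.analyticAt x) analyticAt_id) analyticAt_id

lemma analyticAt_curveCubic (T : E →L[ℝ] E →L[ℝ] E →L[ℝ] F) (γ : Curve E) :
    AnalyticAt ℝ (curveCubic T) γ :=
  analyticAt_clm_apply (f := fun γ => curveApp (curveApp (curveMap T γ) γ))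
    (analyticAt_clm_comp curveApp (analyticAt_clm_apply (f := fun γ => curveApp (curveMap T γ))
      (analyticAt_clm_comp curveApp ((curveMap T).analyticAt γ)) analyticAt_id)) analyticAt_id

/-- The derivative of `T`, as the trilinear map `(u, v, w) ↦ T(u, v, w) + T(u, w, v) + T(w, u, v)`. -/
def triDeriv (T : E →L[ℝ] E →L[ℝ] E →L[ℝ] F) : E →L[ℝ] E →L[ℝ] E →L[ℝ] F :=
  T + ((ContinuousLinearMap.flipₗᵢ ℝ E E F).toContinuousLinearEquiv :
      (E →L[ℝ] E →L[ℝ] F) →L[ℝ] (E →L[ℝ] E →L[ℝ] F)) ∘L T +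
    ((ContinuousLinearMap.flipₗᵢ ℝ E E F).toContinuousLinearEquiv :
      (E →L[ℝ] E →L[ℝ] F) →L[ℝ] (E →L[ℝ] E →L[ℝ] F)) ∘L T.flip

/-- The derivative of the cubic map. -/
def cubicDeriv (T : E →L[ℝ] E →L[ℝ] E →L[ℝ] F) (q : E) : E →L[ℝ] F := triDeriv T q q

lemma cubicDeriv_apply (T : E →L[ℝ] E →L[ℝ] E →L[ℝ] F) (q v : E) :
    cubicDeriv T q v = T q q v + T q v q + T v q q := rfl

lemma hasFDerivAt_cubic (T : E →L[ℝ] E →L[ℝ] E →L[ℝ] F) (q : E) :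
    HasFDerivAt (cubic T) (cubicDeriv T q) q := by
  have h1 := (T.hasFDerivAt (x := q)).clm_apply (hasFDerivAt_id q)
  have h2 := h1.clm_apply (hasFDerivAt_id q)
  refine h2.congr_fderiv ?_
  ext v
  simp [cubicDeriv_apply, add_assoc]

/-- The curve of operators `t ↦ D(cubic T)(γ(t))`. -/
def curveCubicDeriv (T : E →L[ℝ] E →L[ℝ] E →L[ℝ] F) (γ : Curve E) : Curve (E →L[ℝ] F) :=
  curveApp (curveMap (triDeriv T) γ) γ

@[simp] lemma curveCubicDeriv_apply (T : E →L[ℝ] E →L[ℝ] E →L[ℝ] F) (γ : Curve E)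
    (t : unitInterval) : curveCubicDeriv T γ t = cubicDeriv T (γ t) := rfl

lemma analyticAt_curveCubicDeriv (T : E →L[ℝ] E →L[ℝ] E →L[ℝ] F) (γ : Curve E) :
    AnalyticAt ℝ (curveCubicDeriv T) γ :=
  analyticAt_clm_apply (f := fun γ => curveApp (curveMap (triDeriv T) γ))
    (analyticAt_clm_comp curveApp ((curveMap (triDeriv T)).analyticAt γ)) analyticAt_id

/-- Differentiability is supplied by analyticity, so only the value of the derivative is left;
evaluation at each time reduces it to the pointwise derivative of `cubic T`. -/
lemma hasFDerivAt_curveCubic (T : E →L[ℝ] E →L[ℝ] E →L[ℝ] F) (γ : Curve E) :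
    HasFDerivAt (curveCubic T) (curveApp (curveCubicDeriv T γ)) γ := by
  have h0 := (analyticAt_curveCubic T γ).differentiableAt.hasFDerivAt
  refine h0.congr_fderiv ?_
  ext v t
  have h1 := (curveEval (E := F) t).hasFDerivAt.comp γ h0
  have h2 := (hasFDerivAt_cubic T (γ t)).comp γ (curveEval (E := E) t).hasFDerivAt
  exact congrArg (fun L => L v) (h1.unique h2)

end Curves

/-! ### Flows of cubic vector fields -/

section Flow

variable {E F : Type*} [NormedAddCommGroup E] [NormedSpace ℝ E] [CompleteSpace E]
  [NormedAddCommGroup F] [NormedSpace ℝ F] [CompleteSpace F]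

/-- `γ` is the integral curve of the cubic vector field `T(q, q, q)` starting at `q`. -/
def IsIntegralCurve (T : E →L[ℝ] E →L[ℝ] E →L[ℝ] E) (q : E) (γ : Curve E) : Prop :=
  γ = curveConst E q + primitive E (curveCubic T γ)

lemma IsIntegralCurve.apply_zero {T : E →L[ℝ] E →L[ℝ] E →L[ℝ] E} {q : E} {γ : Curve E}
    (h : IsIntegralCurve T q γ) : γ 0 = q := by
  rw [h]
  simp [primitive_apply]

lemma IsIntegralCurve.hasDerivWithinAt {T : E →L[ℝ] E →L[ℝ] E →L[ℝ] E} {q : E} {γ : Curve E}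
    (h : IsIntegralCurve T q γ) {t : ℝ} (ht : t ∈ Set.Icc (0 : ℝ) 1) :
    HasDerivWithinAt γ.extend (cubic T (γ.extend t)) (Set.Icc 0 1) t := by
  have := hasDerivWithinAt_extend h ht
  rwa [Curve.extend_of_mem _ ht, curveCubic_apply, ← Curve.extend_of_mem _ ht] at this

lemma cubicDeriv_zero (T : E →L[ℝ] E →L[ℝ] E →L[ℝ] F) : cubicDeriv T 0 = 0 := by
  ext v
  simp [cubicDeriv_apply]

lemma curveCubicDeriv_zero (T : E →L[ℝ] E →L[ℝ] E →L[ℝ] F) : curveCubicDeriv T 0 = 0 := by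
  ext t v
  simp [cubicDeriv_zero]

/-- Integral curves of a cubic vector field with small initial value exist, are unique among small
curves, and depend analytically on the initial value. -/
theorem exists_flow (T : E →L[ℝ] E →L[ℝ] E →L[ℝ] E) :
    ∃ Φ : E → Curve E, AnalyticAt ℝ Φ 0 ∧ Φ 0 = 0 ∧ (∀ᶠ q in 𝓝 0, IsIntegralCurve T q (Φ q)) ∧
      ∀ᶠ γ in 𝓝 (0 : Curve E), ∀ q, IsIntegralCurve T q γ → γ = Φ q := by
  let Ψ : Curve E → Curve E := fun γ => γ - primitive E (curveCubic T γ)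
  have hΨ : AnalyticAt ℝ Ψ 0 :=
    analyticAt_id.sub (analyticAt_clm_comp _ (analyticAt_curveCubic T 0))
  -- The nonlinear term is cubic and has zero derivative at the origin, so `Ψ` is tangent to the
  -- identity there and the analytic inverse function theorem applies.
  have hd : HasFDerivAt Ψ ((ContinuousLinearEquiv.refl ℝ (Curve E) : Curve E ≃L[ℝ] Curve E) :
      Curve E →L[ℝ] Curve E) 0 := by
    have h1 := (hasFDerivAt_id (𝕜 := ℝ) (0 : Curve E)).sub
      ((primitive E).hasFDerivAt.comp (0 : Curve E) (hasFDerivAt_curveCubic T 0))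
    refine h1.congr_fderiv ?_
    rw [curveCubicDeriv_zero]
    ext v
    simp
  have hs : HasStrictFDerivAt Ψ ((ContinuousLinearEquiv.refl ℝ (Curve E) : Curve E ≃L[ℝ] Curve E) :
      Curve E →L[ℝ] Curve E) 0 := by
    rw [← hd.fderiv]
    exact hΨ.hasStrictFDerivAt
  have h0 : Ψ 0 = 0 := by
    have : curveCubic T 0 = 0 := by
      ext t
      simp [cubic]
    simp [Ψ, this]
  have hinv : AnalyticAt ℝ (hs.localInverse Ψ _ 0) (Ψ 0) :=
    (hs.toOpenPartialHomeomorph Ψ).analyticAt_symm' hs.mem_toOpenPartialHomeomorph_source hΨ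
      hd.fderiv
  have hc0 : curveConst E 0 = Ψ 0 := by rw [map_zero, h0]
  refine ⟨fun q => hs.localInverse Ψ _ 0 (curveConst E q), ?_, ?_, ?_, ?_⟩
  · exact AnalyticAt.comp (g := hs.localInverse Ψ _ 0) (by rw [hc0]; exact hinv)
      ((curveConst E).analyticAt 0)
  · change hs.localInverse Ψ _ 0 (curveConst E 0) = 0
    rw [hc0]
    exact hs.localInverse_apply_image
  · have hr := hs.eventually_right_inverse
    rw [← hc0] at hr
    filter_upwards [(curveConst E).continuous.continuousAt.eventually hr] with q hq
    exact sub_eq_iff_eq_add.1 hq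
  -- A small integral curve satisfies `Ψ γ = curveConst E q`, so the local left inverse recovers it
  -- from its initial value.
  · filter_upwards [hs.eventually_left_inverse] with γ hγ q hq
    have : curveConst E q = Ψ γ := (sub_eq_iff_eq_add.2 hq).symm
    rw [this, hγ]

/-- The linearisation of the flow solves the linearised equation. -/
lemma fderiv_flow {T : E →L[ℝ] E →L[ℝ] E →L[ℝ] E} {Φ : E → Curve E} {q : E}
    (h : DifferentiableAt ℝ Φ q) (he : ∀ᶠ r in 𝓝 q, IsIntegralCurve T r (Φ r)) (v : E) :
    fderiv ℝ Φ q v = curveConst E v +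
      primitive E (curveApp (curveCubicDeriv T (Φ q)) (fderiv ℝ Φ q v)) := by
  have h1 : HasFDerivAt (fun r => curveConst E r + primitive E (curveCubic T (Φ r)))
      (curveConst E + primitive E ∘L (curveApp (curveCubicDeriv T (Φ q)) ∘L fderiv ℝ Φ q)) q :=
    (curveConst E).hasFDerivAt.add ((primitive E).hasFDerivAt.comp q
      ((hasFDerivAt_curveCubic T (Φ q)).comp q h.hasFDerivAt))
  have h2 := h1.congr_of_eventuallyEq he
  have := h2.fderiv
  conv_lhs => rw [this]
  rfl

/-! ### Linear equations along a curve and their propagators. -/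

lemma linear_curve_unique {A : Curve (E →L[ℝ] E)} (hA : ‖A‖ < 1) {v : E} {η ζ : Curve E}
    (hη : η = curveConst E v + primitive E (curveApp A η))
    (hζ : ζ = curveConst E v + primitive E (curveApp A ζ)) : η = ζ := by
  have h1 : η - ζ = primitive E (curveApp A (η - ζ)) := by
    rw [map_sub, map_sub]
    nth_rewrite 1 [hη, hζ]
    abel
  have h2 : ‖η - ζ‖ ≤ ‖A‖ * ‖η - ζ‖ := by
    nth_rewrite 1 [h1]
    exact (norm_primitive_le _).trans (norm_curveApp_le _ _)
  have h3 : ‖η - ζ‖ = 0 := by nlinarith [norm_nonneg (η - ζ)]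
  exact sub_eq_zero.1 (norm_eq_zero.1 h3)

/-- The operator `S ↦ (t ↦ ∫_0^t A S)` on curves of operators. -/
def volterra (E : Type*) [NormedAddCommGroup E] [NormedSpace ℝ E] :
    Curve (E →L[ℝ] E) →L[ℝ] Curve (E →L[ℝ] E) →L[ℝ] Curve (E →L[ℝ] E) :=
  LinearMap.mkContinuous₂
    (LinearMap.mk₂ ℝ (fun A S => primitive (E →L[ℝ] E) (A * S))
      (fun _ _ _ => by rw [add_mul, map_add]) (fun _ _ _ => by rw [smul_mul_assoc, map_smul])
      (fun _ _ _ => by rw [mul_add, map_add]) (fun _ _ _ => by rw [mul_smul_comm, map_smul])) 1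
    fun A S => by
      rw [one_mul]
      exact (norm_primitive_le _).trans (norm_mul_le A S)

lemma norm_volterra_le (A : Curve (E →L[ℝ] E)) : ‖volterra E A‖ ≤ ‖A‖ := by
  refine ContinuousLinearMap.opNorm_le_bound _ (norm_nonneg _) fun S => ?_
  exact (norm_primitive_le _).trans (norm_mul_le A S)

/-- The propagator `S' = A S`, `S(0) = 1`, of a linear equation. -/
def propagator (A : Curve (E →L[ℝ] E)) : Curve (E →L[ℝ] E) :=
  Ring.inverse (1 - volterra E A) 1

/-- The Volterra operator has norm at most `‖A‖ < 1`, so the Neumann series inverts `1 - volterra E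
A`. -/
lemma propagator_eq {A : Curve (E →L[ℝ] E)} (hA : ‖A‖ < 1) :
    propagator A = 1 + primitive (E →L[ℝ] E) (A * propagator A) := by
  have hu : IsUnit (1 - volterra E A) :=
    isUnit_one_sub_of_norm_lt_one ((norm_volterra_le A).trans_lt hA)
  have h1 := congrArg (fun L => L (1 : Curve (E →L[ℝ] E))) (Ring.mul_inverse_cancel _ hu)
  have h2 : propagator A - volterra E A (propagator A) = 1 := h1
  exact sub_eq_iff_eq_add.1 h2

lemma analyticAt_propagator {A : Curve (E →L[ℝ] E)} (hA : ‖A‖ < 1) :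
    AnalyticAt ℝ (propagator (E := E)) A := by
  have hu : IsUnit (1 - volterra E A) :=
    isUnit_one_sub_of_norm_lt_one ((norm_volterra_le A).trans_lt hA)
  have h1 : AnalyticAt ℝ (fun A => Ring.inverse (1 - volterra E A)) A :=
    AnalyticAt.comp (g := Ring.inverse) (f := fun A => 1 - volterra E A)
      (analyticOnNhd_inverse _ hu) (analyticAt_const.sub ((volterra E).analyticAt A))
  exact analyticAt_clm_apply h1 analyticAt_const

lemma norm_one_curve_le : ‖(1 : Curve (E →L[ℝ] E))‖ ≤ 1 := by
  rw [ContinuousMap.norm_le _ zero_le_one]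
  exact fun t => ContinuousLinearMap.norm_id_le

/-- From `‖S - 1‖ ≤ ‖A‖ (‖S - 1‖ + 1)` one gets `‖S - 1‖ ≤ ‖A‖ / (1 - ‖A‖)`, which is below 1 once
`‖A‖ < 1/2`. This is where the threshold `1/2` used later comes from: it makes the propagator
invertible. -/
lemma norm_propagator_sub_one_lt {A : Curve (E →L[ℝ] E)} (hA : ‖A‖ < 1 / 2) :
    ‖propagator A - 1‖ < 1 := by
  have h1 : ‖propagator A - 1‖ ≤ ‖A‖ * ‖propagator A‖ := by
    have : propagator A - 1 = primitive (E →L[ℝ] E) (A * propagator A) :=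
      sub_eq_iff_eq_add'.2 (propagator_eq (hA.trans (by norm_num)))
    rw [this]
    exact (norm_primitive_le _).trans (norm_mul_le _ _)
  have h2 : ‖propagator A‖ ≤ ‖propagator A - 1‖ + 1 := by
    have := norm_add_le (propagator A - 1) 1
    rw [sub_add_cancel] at this
    linarith [norm_one_curve_le (E := E)]
  nlinarith [norm_nonneg A, norm_nonneg (propagator A - 1)]

lemma isUnit_propagator {A : Curve (E →L[ℝ] E)} (hA : ‖A‖ < 1 / 2) : IsUnit (propagator A) := by
  have := isUnit_one_sub_of_norm_lt_one (x := 1 - propagator A)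
    (by rw [norm_sub_rev]; exact norm_propagator_sub_one_lt hA)
  simpa using this

lemma propagator_zero : propagator (0 : Curve (E →L[ℝ] E)) = 1 := by
  rw [propagator_eq (by simp)]
  simp

/-- The pointwise inverse of the propagator. -/
def propagatorInv (A : Curve (E →L[ℝ] E)) : Curve (E →L[ℝ] E) := Ring.inverse (propagator A)

lemma propagator_mul_inv {A : Curve (E →L[ℝ] E)} (hA : ‖A‖ < 1 / 2) (t : unitInterval) (x : E) :
    propagator A t (propagatorInv A t x) = x := by
  have := congrArg (fun S : Curve (E →L[ℝ] E) => S t x)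
    (Ring.mul_inverse_cancel _ (isUnit_propagator hA))
  exact this

lemma analyticAt_propagatorInv {A : Curve (E →L[ℝ] E)} (hA : ‖A‖ < 1 / 2) :
    AnalyticAt ℝ (propagatorInv (E := E)) A :=
  AnalyticAt.comp (g := Ring.inverse) (f := propagator)
    (analyticOnNhd_inverse _ (isUnit_propagator hA))
    (analyticAt_propagator (hA.trans (by norm_num)))

lemma propagatorInv_zero : propagatorInv (0 : Curve (E →L[ℝ] E)) = 1 := by
  rw [propagatorInv, propagator_zero, Ring.inverse_one]

lemma propagatorInv_sub_one_isBigO :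
    (fun A : Curve (E →L[ℝ] E) => propagatorInv A - 1) =O[𝓝 0] fun A => A := by
  have h := (analyticAt_propagatorInv (A := (0 : Curve (E →L[ℝ] E)))
    (by simp)).differentiableAt.isBigO_sub
  simpa [propagatorInv_zero] using h

/-- The propagator applied to a vector solves the linear equation. -/
lemma propagator_apply_eq {A : Curve (E →L[ℝ] E)} (hA : ‖A‖ < 1) (v : E) :
    curveApp (propagator A) (curveConst E v) = curveConst E v +
      primitive E (curveApp A (curveApp (propagator A) (curveConst E v))) := by
  ext t
  have h := congrArg (fun S : Curve (E →L[ℝ] E) => S t v) (propagator_eq hA)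
  simp only [ContinuousMap.add_apply, ContinuousMap.one_apply, _root_.add_apply,
    primitive_apply] at h
  rw [curveApp_apply, curveConst_apply, h, ContinuousMap.add_apply, primitive_apply,
    ContinuousLinearMap.intervalIntegral_apply (Curve.intervalIntegrable _ _ _)]
  rfl

/-- The propagator preserves a bilinear form for which all `A(t)` are skew. -/
lemma propagator_preserves {A : Curve (E →L[ℝ] E)} (hA : ‖A‖ < 1) (ω : E →L[ℝ] E →L[ℝ] ℝ)
    (hω : ∀ t x y, ω (A t x) y + ω x (A t y) = 0) (t : unitInterval) (x y : E) :
    ω (propagator A t x) (propagator A t y) = ω x y := by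
  set η := curveApp (propagator A) (curveConst E x) with hη
  set ζ := curveApp (propagator A) (curveConst E y) with hζ
  have hx := propagator_apply_eq hA x
  have hy := propagator_apply_eq hA y
  -- The derivative of `ω(η, ζ)` is `ω(A η, ζ) + ω(η, A ζ)`, which vanishes by skewness.
  have hd : ∀ s ∈ Set.Icc (0 : ℝ) 1,
      HasDerivWithinAt (fun s => ω (η.extend s) (ζ.extend s)) 0 (Set.Icc 0 1) s := by
    intro s hs
    have h1 := hasDerivWithinAt_extend hx hs
    have h2 := hasDerivWithinAt_extend hy hs
    have h3 := (ω.hasFDerivAt.comp_hasDerivWithinAt s h1).clm_apply h2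
    refine h3.congr_deriv ?_
    simp only [Function.comp_apply, Curve.extend_of_mem _ hs]
    exact hω ⟨s, hs⟩ (η ⟨s, hs⟩) (ζ ⟨s, hs⟩)
  have hc := constant_of_has_deriv_right_zero (f := fun s => ω (η.extend s) (ζ.extend s))
    (a := 0) (b := 1) (fun s hs => (hd s hs).continuousWithinAt)
    (fun s hs => (hd s (Set.Ico_subset_Icc_self hs)).mono_of_mem_nhdsWithin
      (Icc_mem_nhdsGE_of_mem hs)) t t.2
  have h0 : ∀ z : E, propagator A 0 z = z := by
    intro z
    rw [propagator_eq hA]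
    simp [primitive_apply]
  simp only [Curve.extend_coe] at hc
  rw [Curve.extend_of_mem η ⟨le_rfl, zero_le_one⟩, Curve.extend_of_mem ζ ⟨le_rfl, zero_le_one⟩]
    at hc
  rw [hη, hζ] at hc
  simp only [curveApp_apply, curveConst_apply] at hc
  rw [hc]
  exact congrArg₂ (fun a b => ω a b) (h0 x) (h0 y)

end Flow

/-! ### Convolution estimates for nonnegative series -/

section Convolution

open scoped ENNReal

/-- The momentum condition determines each index from the other three. In this form the fact enters
Young's inequality. -/
lemma tsum_indicator_le_one {ι : Type*} {P : ι → Prop} [DecidablePred P]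
    (h : ∀ i j, P i → P j → i = j) : ∑' i, (if P i then (1 : ℝ≥0∞) else 0) ≤ 1 := by
  by_cases hP : ∃ i, P i
  · obtain ⟨i, hi⟩ := hP
    rw [tsum_eq_single i fun j hj => if_neg fun hPj => hj (h j i hPj hi)]
    rw [if_pos hi]
  · push Not at hP
    simp [hP]

lemma ennreal_two_mul_le_add_sq (x y : ℝ≥0∞) : 2 * (x * y) ≤ x ^ 2 + y ^ 2 := by
  by_cases hx : x = ⊤
  · simp [hx]
  by_cases hy : y = ⊤
  · simp [hy]
  lift x to NNReal using hx
  lift y to NNReal using hy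
  have := two_mul_le_add_sq x y
  rw [mul_assoc] at this
  exact_mod_cast this

/-- The weighted Cauchy-Schwarz inequality. -/
lemma tsum_mul_sq_le {ι : Type*} (μ h : ι → ℝ≥0∞) :
    (∑' t, μ t * h t) ^ 2 ≤ (∑' t, μ t * h t ^ 2) * ∑' t, μ t := by
  have key : 2 * (∑' t, μ t * h t) ^ 2 ≤ 2 * ((∑' t, μ t * h t ^ 2) * ∑' t, μ t) := by
    calc 2 * (∑' t, μ t * h t) ^ 2
        = ∑' t, ∑' r, μ t * μ r * (2 * (h t * h r)) := by
          rw [sq, ← ENNReal.tsum_mul_right, ← ENNReal.tsum_mul_left]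
          refine tsum_congr fun t => ?_
          rw [← ENNReal.tsum_mul_left, ← ENNReal.tsum_mul_left]
          exact tsum_congr fun r => by ring
      _ ≤ ∑' t, ∑' r, μ t * μ r * (h t ^ 2 + h r ^ 2) :=
          ENNReal.tsum_le_tsum fun t => ENNReal.tsum_le_tsum fun r =>
            mul_le_mul_right (ennreal_two_mul_le_add_sq _ _) _
      _ = ∑' t, ∑' r, μ t * h t ^ 2 * μ r + ∑' t, ∑' r, μ t * (μ r * h r ^ 2) := by
          rw [← ENNReal.tsum_add]
          refine tsum_congr fun t => ?_
          rw [← ENNReal.tsum_add]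
          exact tsum_congr fun r => by ring
      _ = 2 * ((∑' t, μ t * h t ^ 2) * ∑' t, μ t) := by
          simp_rw [ENNReal.tsum_mul_left, ENNReal.tsum_mul_right]
          ring
  exact (ENNReal.mul_le_mul_iff_right (by norm_num) (by norm_num)).1 key

/-- Young's inequality `ℓ² * ℓ¹ * ℓ¹ ⊆ ℓ²` for convolution kernels. -/
lemma young_le {ι : Type*} (δ : ι → ι → ι → ι → ℝ≥0∞) (hi : ∀ j k l, ∑' i, δ i j k l ≤ 1)
    (hl : ∀ i j k, ∑' l, δ i j k l ≤ 1) (u v w : ι → ℝ≥0∞) :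
    ∑' l, (∑' i, ∑' j, ∑' k, δ i j k l * (u i * v j * w k)) ^ 2 ≤
      (∑' i, u i ^ 2) * (∑' j, v j) ^ 2 * (∑' k, w k) ^ 2 := by
  have h1 : ∀ l, (∑' i, ∑' j, ∑' k, δ i j k l * (u i * v j * w k)) ^ 2 ≤
      (∑' i, ∑' j, ∑' k, δ i j k l * (u i ^ 2 * v j * w k)) * ((∑' j, v j) * ∑' k, w k) := by
    intro l
    -- Cauchy-Schwarz for the measure `δ v w`. Its total mass is at most `‖v‖₁ ‖w‖₁`, because `i` is
    -- determined by `j, k, l`.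
    have h2 := tsum_mul_sq_le (fun t : ι × ι × ι => δ t.1 t.2.1 t.2.2 l * (v t.2.1 * w t.2.2))
      (fun t => u t.1)
    simp only [ENNReal.tsum_prod'] at h2
    have h3 : ∑' i, ∑' j, ∑' k, δ i j k l * (v j * w k) ≤ (∑' j, v j) * ∑' k, w k := by
      rw [ENNReal.tsum_comm, ← ENNReal.tsum_mul_right]
      refine ENNReal.tsum_le_tsum fun j => ?_
      rw [ENNReal.tsum_comm, ← ENNReal.tsum_mul_left]
      refine ENNReal.tsum_le_tsum fun k => ?_
      rw [ENNReal.tsum_mul_right]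
      exact mul_le_of_le_one_left' (hi j k l)
    refine le_trans (le_of_eq ?_) (h2.trans (mul_le_mul' (le_of_eq ?_) h3))
    · congr 1
      exact tsum_congr fun i => tsum_congr fun j => tsum_congr fun k => by ring
    · exact tsum_congr fun i => tsum_congr fun j => tsum_congr fun k => by ring
  refine (ENNReal.tsum_le_tsum h1).trans ?_
  rw [ENNReal.tsum_mul_right]
  -- After the squares have been moved onto `u`, the sum over `l` is taken innermost; here `l` is
  -- determined by `i, j, k`.
  have h4 : ∑' l, ∑' i, ∑' j, ∑' k, δ i j k l * (u i ^ 2 * v j * w k) ≤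
      (∑' i, u i ^ 2) * ((∑' j, v j) * ∑' k, w k) := by
    rw [ENNReal.tsum_comm, ← ENNReal.tsum_mul_right]
    refine ENNReal.tsum_le_tsum fun i => ?_
    rw [ENNReal.tsum_comm, ← ENNReal.tsum_mul_right, ← ENNReal.tsum_mul_left]
    refine ENNReal.tsum_le_tsum fun j => ?_
    rw [ENNReal.tsum_comm, ← ENNReal.tsum_mul_left, ← ENNReal.tsum_mul_left]
    refine ENNReal.tsum_le_tsum fun k => ?_
    rw [ENNReal.tsum_mul_right, ← mul_assoc (u i ^ 2)]
    exact mul_le_of_le_one_left' (hl i j k)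
  refine (mul_le_mul_left h4 _).trans (le_of_eq ?_)
  ring

end Convolution

/-! ### Weighted spaces -/

section Weighted

open scoped ENNReal

variable {a s s' : ℝ}

lemma Ell.ext' {x y : Ell a s} (h : ∀ n, x n = y n) : x = y := Subtype.ext (funext h)

@[simp] lemma Ell.add_coe (x y : Ell a s) (n : ZStar) : (x + y) n = x n + y n := rfl
@[simp] lemma Ell.smul_coe (c : ℝ) (x : Ell a s) (n : ZStar) : (c • x) n = c * x n :=
  Complex.real_smul

/-- The isometry of `ℓ^{a,p}` with the unweighted space. -/
def ellIso (a s : ℝ) : Ell a s ≃ₗᵢ[ℝ] lp (fun _ : ZStar => ℂ) 2 :=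
  LinearIsometryEquiv.ofSurjective ⟨toEllTwo a s, fun _ => rfl⟩ fun f => by
    have hmul : ∀ n, weight a s n • ((weight a s n)⁻¹ • f n) = f n := fun n => by
      rw [smul_smul, mul_inv_cancel₀ (weight_pos a s n).ne', one_smul]
    refine ⟨⟨fun n => (weight a s n)⁻¹ • f n, (summable_iff_memℓp a s _).2 ?_⟩, ?_⟩
    · simp only [hmul]
      exact f.2
    · ext n
      exact hmul n

instance : CompleteSpace (Ell a s) :=
  (ellIso a s).toIsometryEquiv.completeSpace

/-- The square of the norm of `ℓ^{a,s}` for sequences of extended nonnegative numbers. -/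
def ennormSq (a s : ℝ) (u : ZStar → ℝ≥0∞) : ℝ≥0∞ :=
  ∑' n, (ENNReal.ofReal (weight a s n) * u n) ^ 2

lemma term_eq (q : ZStar → ℂ) (n : ZStar) :
    ENNReal.ofReal (‖q n‖ ^ 2 * |(n.1 : ℝ)| ^ (2 * s) * Real.exp (2 * a * |(n.1 : ℝ)|)) =
      (ENNReal.ofReal (weight a s n) * ‖q n‖ₑ) ^ 2 := by
  rw [mul_assoc, ← weight_sq, mul_pow, ENNReal.ofReal_mul (by positivity),
    ENNReal.ofReal_pow (norm_nonneg _), ENNReal.ofReal_pow (weight_pos a s n).le, ofReal_norm,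
    mul_comm]

lemma mem_of_ennormSq_ne_top {q : ZStar → ℂ} (h : ennormSq a s (fun n => ‖q n‖ₑ) ≠ ⊤) :
    q ∈ ellSubmodule a s := by
  have h0 : ∀ n : ZStar, 0 ≤ ‖q n‖ ^ 2 * |(n.1 : ℝ)| ^ (2 * s) * Real.exp (2 * a * |(n.1 : ℝ)|) :=
    fun n => by positivity
  have h1 : ∑' n : ZStar, ENNReal.ofReal
      (‖q n‖ ^ 2 * |(n.1 : ℝ)| ^ (2 * s) * Real.exp (2 * a * |(n.1 : ℝ)|)) ≠ ⊤ := by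
    simpa only [term_eq, ennormSq] using h
  have h2 := ENNReal.summable_toReal h1
  simp only [fun n => ENNReal.toReal_ofReal (h0 n)] at h2
  exact h2

lemma ennormSq_coe (q : Ell a s) : ennormSq a s (fun n => ‖q n‖ₑ) = ENNReal.ofReal (‖q‖ ^ 2) := by
  rw [norm_sq_eq, ENNReal.ofReal_tsum_of_nonneg (fun n => by positivity) q.2]
  exact tsum_congr fun n => (term_eq q.1 n).symm

lemma norm_coe_le (q : Ell a s) (n : ZStar) : weight a s n * ‖q n‖ ≤ ‖q‖ := by
  have h := lp.norm_apply_le_norm (p := 2) (by norm_num) (toEllTwo a s q) n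
  change ‖weight a s n • q n‖ ≤ ‖q‖ at h
  rwa [norm_smul, Real.norm_of_nonneg (weight_pos a s n).le] at h

lemma one_le_abs (n : ZStar) : 1 ≤ |(n.1 : ℝ)| := by
  exact_mod_cast Int.one_le_abs n.2

lemma weight_mono (hs : s' ≤ s) (n : ZStar) : weight a s' n ≤ weight a s n := by
  unfold weight
  gcongr
  exact one_le_abs n

lemma one_le_weight (ha : 0 ≤ a) (hs : 0 ≤ s) (n : ZStar) : 1 ≤ weight a s n := by
  unfold weight
  have h1 := Real.one_le_rpow (one_le_abs n) hs
  have h2 := Real.one_le_exp (mul_nonneg ha (abs_nonneg (n.1 : ℝ)))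
  nlinarith

lemma summable_abs_rpow (hs : 1 / 2 < s) :
    Summable fun n : ZStar => |(n.1 : ℝ)| ^ (-(2 * s)) := by
  have h := Real.summable_abs_int_rpow (b := 2 * s) (by linarith)
  exact h.comp_injective Subtype.val_injective

/-- The square of the norm of the embedding `ℓ^{a,s} ⊆ ℓ^{a,0}_1`. -/
def embConst (s : ℝ) : ℝ≥0∞ := ∑' n : ZStar, ENNReal.ofReal (|(n.1 : ℝ)| ^ (-(2 * s)))

lemma embConst_ne_top (hs : 1 / 2 < s) : embConst s ≠ ⊤ := by
  rw [embConst, ← ENNReal.ofReal_tsum_of_nonneg (fun n => by positivity) (summable_abs_rpow hs)]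
  exact ENNReal.ofReal_ne_top

/-- Cauchy-Schwarz with the measure `|n|^{-2s}`, which is finite for `s > 1/2`: the space `ℓ^{a,s}`
embeds into `ℓ¹` with weight `e^{a|n|}`. -/
lemma tsum_weight_zero_sq_le (a s : ℝ) (u : ZStar → ℝ≥0∞) :
    (∑' n, ENNReal.ofReal (weight a 0 n) * u n) ^ 2 ≤ embConst s * ennormSq a s u := by
  have h := tsum_mul_sq_le (fun n : ZStar => ENNReal.ofReal (|(n.1 : ℝ)| ^ (-(2 * s))))
    (fun n => ENNReal.ofReal (|(n.1 : ℝ)| ^ (2 * s) * weight a 0 n) * u n)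
  have hpos : ∀ n : ZStar, 0 < |(n.1 : ℝ)| := fun n => zero_lt_one.trans_le (one_le_abs n)
  rw [mul_comm (embConst s)]
  refine le_trans (le_of_eq ?_) (h.trans (le_of_eq ?_))
  · congr 1
    refine tsum_congr fun n => ?_
    rw [← mul_assoc, ← ENNReal.ofReal_mul (by positivity), ← mul_assoc,
      ← Real.rpow_add (hpos n)]
    simp
  · congr 1
    refine tsum_congr fun n => ?_
    rw [mul_pow, mul_pow, ← mul_assoc, ← ENNReal.ofReal_pow (by have := weight_pos a 0 n; positivity),
      ← ENNReal.ofReal_mul (by positivity), ← ENNReal.ofReal_pow (weight_pos a s n).le]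
    congr 2
    have h1 : weight a s n = |(n.1 : ℝ)| ^ s * weight a 0 n := by simp [weight]
    have h2 : |(n.1 : ℝ)| ^ (2 * s) = (|(n.1 : ℝ)| ^ s) ^ 2 := by
      rw [← Real.rpow_natCast, ← Real.rpow_mul (abs_nonneg _)]
      congr 1
      push_cast
      ring
    rw [h1, Real.rpow_neg (abs_nonneg _), h2]
    have := Real.rpow_pos_of_pos (hpos n) s
    field_simp

/-- `|i| + |j| + |k|`. -/
def Quad.size (x : Quad) : ℝ := |(x.i.1 : ℝ)| + |(x.j.1 : ℝ)| + |(x.k.1 : ℝ)|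

lemma Quad.one_le_size (x : Quad) : 1 ≤ x.size := by
  have := one_le_abs x.i
  have := abs_nonneg (x.j.1 : ℝ)
  have := abs_nonneg (x.k.1 : ℝ)
  unfold Quad.size
  linarith

lemma Quad.Momentum.abs_le_size {x : Quad} (h : x.Momentum) : |(x.l.1 : ℝ)| ≤ x.size := by
  have h1 : (x.l.1 : ℝ) = x.i.1 + x.j.1 - x.k.1 := by
    have : (x.i.1 : ℝ) + x.j.1 = x.k.1 + x.l.1 := by exact_mod_cast h
    linarith
  rw [h1, Quad.size]
  exact (abs_sub _ _).trans (add_le_add_left (abs_add_le _ _) _)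

/-- Since `|l| ≤ |i| + |j| + |k|`, the exponential weight is submultiplicative, and the total power
`size^s` is at most `3^s` times the `s`-th power of the largest index. So one factor carries the
full weight, as an `ℓ²` sequence, and the other two need only `e^{a|n|}`, as `ℓ¹` sequences. -/
lemma weight_mul_size_le (ha : 0 ≤ a) (hs' : 0 ≤ s') (hs : s' ≤ s) {x : Quad} (h : x.Momentum) :
    weight a s' x.l * x.size ^ (s - s') ≤
      3 ^ s * (weight a s x.i * weight a 0 x.j * weight a 0 x.k +
        weight a 0 x.i * weight a s x.j * weight a 0 x.k +
        weight a 0 x.i * weight a 0 x.j * weight a s x.k) := by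
  have hsz := x.one_le_size
  have hs0 : 0 ≤ s := hs'.trans hs
  have h1 : weight a s' x.l * x.size ^ (s - s') ≤ x.size ^ s * Real.exp (a * x.size) := by
    have : x.size ^ s = x.size ^ s' * x.size ^ (s - s') := by
      rw [← Real.rpow_add (by linarith)]
      congr 1
      ring
    rw [this, weight]
    have hl := h.abs_le_size
    calc |(x.l.1 : ℝ)| ^ s' * Real.exp (a * |(x.l.1 : ℝ)|) * x.size ^ (s - s')
        ≤ x.size ^ s' * Real.exp (a * x.size) * x.size ^ (s - s') := by gcongr
      _ = _ := by ring
  have h2 : x.size ^ s ≤ 3 ^ s * (|(x.i.1 : ℝ)| ^ s + |(x.j.1 : ℝ)| ^ s + |(x.k.1 : ℝ)| ^ s) := by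
    have hi := abs_nonneg (x.i.1 : ℝ)
    have hj := abs_nonneg (x.j.1 : ℝ)
    have hk := abs_nonneg (x.k.1 : ℝ)
    have hmax : ∀ y : ℝ, 0 ≤ y → x.size ≤ 3 * y → x.size ^ s ≤ 3 ^ s * y ^ s := by
      intro y hy hle
      rw [← Real.mul_rpow (by norm_num) hy]
      gcongr
    have pi := Real.rpow_nonneg hi s
    have pj := Real.rpow_nonneg hj s
    have pk := Real.rpow_nonneg hk s
    have p3 : (0 : ℝ) ≤ 3 ^ s := by positivity
    rcases le_total |(x.i.1 : ℝ)| |(x.j.1 : ℝ)| with hij | hij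
    · rcases le_total |(x.j.1 : ℝ)| |(x.k.1 : ℝ)| with hjk | hjk
      · exact (hmax _ hk (by unfold Quad.size; linarith)).trans (by gcongr; linarith)
      · exact (hmax _ hj (by unfold Quad.size; linarith)).trans (by gcongr; linarith)
    · rcases le_total |(x.i.1 : ℝ)| |(x.k.1 : ℝ)| with hik | hik
      · exact (hmax _ hk (by unfold Quad.size; linarith)).trans (by gcongr; linarith)
      · exact (hmax _ hi (by unfold Quad.size; linarith)).trans (by gcongr; linarith)
  have h3 : Real.exp (a * x.size) = Real.exp (a * |(x.i.1 : ℝ)|) * Real.exp (a * |(x.j.1 : ℝ)|) *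
      Real.exp (a * |(x.k.1 : ℝ)|) := by
    rw [← Real.exp_add, ← Real.exp_add, Quad.size]
    congr 1
    ring
  refine h1.trans ((mul_le_mul_of_nonneg_right h2 (Real.exp_nonneg _)).trans (le_of_eq ?_))
  rw [h3]
  simp only [weight, Real.rpow_zero, one_mul]
  ring

end Weighted

/-! ### Trilinear convolution operators -/

section Trilinear

open scoped ENNReal

variable {a s s' : ℝ}

/-- Kernels `b_{ijkl}` that are supported on `i + j = k + l` and bounded by
`(|i| + |j| + |k|)^{s-s'}`. -/
structure IsKernel (s s' : ℝ) (b : Quad → ℂ) : Prop where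
  momentum : ∀ x, ¬ x.Momentum → b x = 0
  bound : ∃ C : ℝ, 0 ≤ C ∧ ∀ x, ‖b x‖ ≤ C * x.size ^ (s - s')

/-- The quadruple with first three components `t` and last component `l`. -/
abbrev quadOf (t : ZStar × ZStar × ZStar) (l : ZStar) : Quad := ⟨t.1, t.2.1, t.2.2, l⟩

/-- The convolution with kernel `κ` of sequences of extended nonnegative numbers. -/
def convSeq (κ : Quad → ℝ≥0∞) (u v w : ZStar → ℝ≥0∞) (l : ZStar) : ℝ≥0∞ :=
  ∑' t : ZStar × ZStar × ZStar, κ (quadOf t l) * (u t.1 * v t.2.1 * w t.2.2)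

lemma ennreal_add_sq_le (x y z : ℝ≥0∞) : (x + y + z) ^ 2 ≤ 9 * (x ^ 2 + y ^ 2 + z ^ 2) := by
  have hmax : ∀ m : ℝ≥0∞, x ≤ m → y ≤ m → z ≤ m → (x + y + z) ^ 2 ≤ 9 * m ^ 2 := by
    intro m h1 h2 h3
    calc (x + y + z) ^ 2 ≤ (m + m + m) ^ 2 := by gcongr
      _ = 9 * m ^ 2 := by ring
  rcases le_total x y with hxy | hxy
  · rcases le_total y z with hyz | hyz
    · exact (hmax z (hxy.trans hyz) hyz le_rfl).trans (by gcongr; exact le_add_self)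
    · exact (hmax y hxy le_rfl hyz).trans
        (by gcongr; exact le_add_self.trans le_self_add)
  · rcases le_total x z with hxz | hxz
    · exact (hmax z hxz (hxy.trans hxz) le_rfl).trans (by gcongr; exact le_add_self)
    · exact (hmax x le_rfl hxy hxz).trans
        (by gcongr; exact le_self_add.trans le_self_add)

/-- The convolution is bounded in the weighted norms. -/
lemma ennormSq_convSeq_le (ha : 0 ≤ a) (hs' : 0 ≤ s') (hss : s' ≤ s) {C : ℝ} (hC : 0 ≤ C)
    {κ : Quad → ℝ≥0∞} (hm : ∀ x, ¬ x.Momentum → κ x = 0)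
    (hκ : ∀ x, κ x ≤ ENNReal.ofReal (C * x.size ^ (s - s'))) (u v w : ZStar → ℝ≥0∞) :
    ennormSq a s' (convSeq κ u v w) ≤
      ENNReal.ofReal (C * 3 ^ s) ^ 2 * (27 * embConst s ^ 2) *
        (ennormSq a s u * ennormSq a s v * ennormSq a s w) := by
  classical
  set W : ZStar → ℝ≥0∞ := fun n => ENNReal.ofReal (weight a s n) with hW
  set e : ZStar → ℝ≥0∞ := fun n => ENNReal.ofReal (weight a 0 n) with he
  let δ : ZStar → ZStar → ZStar → ZStar → ℝ≥0∞ := fun i j k l =>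
    if (Quad.mk i j k l).Momentum then 1 else 0
  -- The weight of the output is distributed over the inputs, giving three terms according to which
  -- input receives the power `s`.
  have hpt : ∀ i j k l, ENNReal.ofReal (weight a s' l) * (κ ⟨i, j, k, l⟩ * (u i * v j * w k)) ≤
      ENNReal.ofReal (C * 3 ^ s) * (δ i j k l * ((W i * u i) * (e j * v j) * (e k * w k)) +
        δ i j k l * ((e i * u i) * (W j * v j) * (e k * w k)) +
        δ i j k l * ((e i * u i) * (e j * v j) * (W k * w k))) := by
    intro i j k l
    by_cases hM : (Quad.mk i j k l).Momentum
    · have hwt : ∀ r n, 0 ≤ weight a r n := fun r n => (weight_pos a r n).le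
      have h1 : ENNReal.ofReal (weight a s' l) * κ ⟨i, j, k, l⟩ ≤ ENNReal.ofReal (C * 3 ^ s) *
          (W i * e j * e k + e i * W j * e k + e i * e j * W k) := by
        refine (mul_le_mul_right (hκ _) _).trans ?_
        simp only [hW, he]
        rw [← ENNReal.ofReal_mul (hwt _ _), ← ENNReal.ofReal_mul (hwt _ _),
          ← ENNReal.ofReal_mul (hwt _ _), ← ENNReal.ofReal_mul (hwt _ _),
          ← ENNReal.ofReal_mul (mul_nonneg (hwt _ _) (hwt _ _)),
          ← ENNReal.ofReal_mul (mul_nonneg (hwt _ _) (hwt _ _)),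
          ← ENNReal.ofReal_mul (mul_nonneg (hwt _ _) (hwt _ _)),
          ← ENNReal.ofReal_add (mul_nonneg (mul_nonneg (hwt _ _) (hwt _ _)) (hwt _ _))
            (mul_nonneg (mul_nonneg (hwt _ _) (hwt _ _)) (hwt _ _)),
          ← ENNReal.ofReal_add (add_nonneg (mul_nonneg (mul_nonneg (hwt _ _) (hwt _ _)) (hwt _ _))
            (mul_nonneg (mul_nonneg (hwt _ _) (hwt _ _)) (hwt _ _)))
            (mul_nonneg (mul_nonneg (hwt _ _) (hwt _ _)) (hwt _ _)),
          ← ENNReal.ofReal_mul (by positivity)]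
        refine ENNReal.ofReal_le_ofReal ?_
        have h2 := mul_le_mul_of_nonneg_left (weight_mul_size_le ha hs' hss hM) hC
        refine le_trans (le_of_eq ?_) (h2.trans (le_of_eq ?_)) <;> ring
      simp only [δ, if_pos hM, one_mul]
      calc ENNReal.ofReal (weight a s' l) * (κ ⟨i, j, k, l⟩ * (u i * v j * w k))
          = (ENNReal.ofReal (weight a s' l) * κ ⟨i, j, k, l⟩) * (u i * v j * w k) := by ring
        _ ≤ _ := mul_le_mul_left h1 _
        _ = _ := by ring
    · rw [hm _ hM]
      simp
  have hi : ∀ j k l, ∑' i, δ i j k l ≤ 1 := fun j k l => tsum_indicator_le_one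
    fun i i' h h' => by simp only [Quad.Momentum] at h h'; exact Subtype.ext (by omega)
  have hj : ∀ i k l, ∑' j, δ i j k l ≤ 1 := fun j k l => tsum_indicator_le_one
    fun i i' h h' => by simp only [Quad.Momentum] at h h'; exact Subtype.ext (by omega)
  have hk : ∀ i j l, ∑' k, δ i j k l ≤ 1 := fun j k l => tsum_indicator_le_one
    fun i i' h h' => by simp only [Quad.Momentum] at h h'; exact Subtype.ext (by omega)
  have hl : ∀ i j k, ∑' l, δ i j k l ≤ 1 := fun j k l => tsum_indicator_le_one
    fun i i' h h' => by simp only [Quad.Momentum] at h h'; exact Subtype.ext (by omega)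
  -- Young's inequality three times, with each of the three inputs in turn in the role of the `ℓ²`
  -- factor.
  have y1 := young_le δ hi hl (fun i => W i * u i) (fun j => e j * v j) (fun k => e k * w k)
  have y2 := young_le (fun j i k l => δ i j k l) (fun i k l => hj i k l) (fun j i k => hl i j k)
    (fun j => W j * v j) (fun i => e i * u i) (fun k => e k * w k)
  have y3 := young_le (fun k i j l => δ i j k l) (fun i j l => hk i j l) (fun k i j => hl i j k)
    (fun k => W k * w k) (fun i => e i * u i) (fun j => e j * v j)
  have E := tsum_weight_zero_sq_le a s
  set Nu := ennormSq a s u with hNu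
  set Nv := ennormSq a s v with hNv
  set Nw := ennormSq a s w with hNw
  have step : ∀ l, (ENNReal.ofReal (weight a s' l) * convSeq κ u v w l) ^ 2 ≤
      ENNReal.ofReal (C * 3 ^ s) ^ 2 * (9 *
        ((∑' i, ∑' j, ∑' k, δ i j k l * ((W i * u i) * (e j * v j) * (e k * w k))) ^ 2 +
        (∑' j, ∑' i, ∑' k, δ i j k l * ((W j * v j) * (e i * u i) * (e k * w k))) ^ 2 +
        (∑' k, ∑' i, ∑' j, δ i j k l * ((W k * w k) * (e i * u i) * (e j * v j))) ^ 2)) := by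
    intro l
    refine le_trans ?_ (mul_le_mul_right (ennreal_add_sq_le _ _ _) _)
    rw [← mul_pow]
    refine pow_le_pow_left' ?_ 2
    rw [convSeq, ← ENNReal.tsum_mul_left]
    refine (ENNReal.tsum_le_tsum fun (t : ZStar × ZStar × ZStar) => hpt t.1 t.2.1 t.2.2 l).trans (le_of_eq ?_)
    rw [ENNReal.tsum_mul_left, ENNReal.tsum_add, ENNReal.tsum_add]
    simp only [ENNReal.tsum_prod']
    refine congrArg (ENNReal.ofReal (C * 3 ^ s) * ·)
      (congrArg₂ (· + ·) (congrArg₂ (· + ·) rfl ?_) ?_)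
    · rw [ENNReal.tsum_comm]
      exact tsum_congr fun j => tsum_congr fun i => tsum_congr fun k => by ring
    · have : ∀ i, ∑' j, ∑' k, δ i j k l * (e i * u i * (e j * v j) * (W k * w k)) =
          ∑' k, ∑' j, δ i j k l * (e i * u i * (e j * v j) * (W k * w k)) :=
        fun i => ENNReal.tsum_comm
      simp_rw [this]
      rw [ENNReal.tsum_comm]
      exact tsum_congr fun j => tsum_congr fun i => tsum_congr fun k => by ring
  refine (ENNReal.tsum_le_tsum step).trans ?_
  rw [ENNReal.tsum_mul_left, ENNReal.tsum_mul_left, ENNReal.tsum_add, ENNReal.tsum_add, mul_assoc]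
  gcongr ENNReal.ofReal (C * 3 ^ s) ^ 2 * ?_
  calc _ ≤ 9 * (Nu * (embConst s * Nv) * (embConst s * Nw) +
        Nv * (embConst s * Nu) * (embConst s * Nw) +
        Nw * (embConst s * Nu) * (embConst s * Nv)) := by
        gcongr
        · exact y1.trans (mul_le_mul' (mul_le_mul' le_rfl (E v)) (E w))
        · exact y2.trans (mul_le_mul' (mul_le_mul' le_rfl (E u)) (E w))
        · exact y3.trans (mul_le_mul' (mul_le_mul' le_rfl (E u)) (E v))
    _ = _ := by ring

/-- The convolution `∑_{i,j,k} b_{ijkl} u_i v_j w̄_k`. -/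
def triSeq (b : Quad → ℂ) (u v w : ZStar → ℂ) (l : ZStar) : ℂ :=
  ∑' t : ZStar × ZStar × ZStar,
    b (quadOf t l) * (u t.1 * v t.2.1 * (starRingEnd ℂ) (w t.2.2))

lemma enorm_triSeq_term (b : Quad → ℂ) (u v w : ZStar → ℂ) (t : ZStar × ZStar × ZStar)
    (l : ZStar) : ‖b (quadOf t l) * (u t.1 * v t.2.1 * (starRingEnd ℂ) (w t.2.2))‖ₑ =
      ‖b (quadOf t l)‖ₑ * (‖u t.1‖ₑ * ‖v t.2.1‖ₑ * ‖w t.2.2‖ₑ) := by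
  simp [enorm_mul]

lemma enorm_triSeq_le (b : Quad → ℂ) (u v w : ZStar → ℂ) (l : ZStar) :
    ‖triSeq b u v w l‖ₑ ≤ convSeq (fun x => ‖b x‖ₑ) (fun n => ‖u n‖ₑ) (fun n => ‖v n‖ₑ)
      (fun n => ‖w n‖ₑ) l := by
  refine (enorm_tsum_le_tsum_enorm).trans (le_of_eq ?_)
  exact tsum_congr fun t => enorm_triSeq_term b u v w t l

lemma ennormSq_mono {u v : ZStar → ℝ≥0∞} (h : ∀ n, u n ≤ v n) : ennormSq a s u ≤ ennormSq a s v :=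
  ENNReal.tsum_le_tsum fun n => by gcongr; exact h n

/-- The conditions on the exponents under which convolutions map `ℓ^{a,s}` to `ℓ^{a,s'}`. -/
structure IsGood (a s s' : ℝ) : Prop where
  a_nonneg : 0 ≤ a
  nonneg : 0 ≤ s'
  le : s' ≤ s
  half_lt : 1 / 2 < s

/-- The estimate is stated for the convolution of absolute values, so it yields at once the
convergence of `triSeq`, its trilinear bound, and the absolute convergence of the quartic sums. -/
lemma IsKernel.exists_bound {b : Quad → ℂ} (hb : IsKernel s s' b) (hg : IsGood a s s') :
    ∃ D : ℝ, 0 ≤ D ∧ ∀ u v w : Ell a s,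
      ennormSq a s' (convSeq (fun x => ‖b x‖ₑ) (fun n => ‖u n‖ₑ) (fun n => ‖v n‖ₑ)
        (fun n => ‖w n‖ₑ)) ≤ ENNReal.ofReal ((D * ‖u‖ * ‖v‖ * ‖w‖) ^ 2) := by
  obtain ⟨C, hC, hCb⟩ := hb.bound
  set D2 : ℝ≥0∞ := ENNReal.ofReal (C * 3 ^ s) ^ 2 * (27 * embConst s ^ 2) with hD2
  have hD : D2 ≠ ⊤ := ENNReal.mul_ne_top (ENNReal.pow_ne_top ENNReal.ofReal_ne_top)
    (ENNReal.mul_ne_top (by norm_num) (ENNReal.pow_ne_top (embConst_ne_top hg.half_lt)))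
  refine ⟨Real.sqrt D2.toReal, Real.sqrt_nonneg _, fun u v w => ?_⟩
  refine (ennormSq_convSeq_le hg.a_nonneg hg.nonneg hg.le hC (κ := fun x => ‖b x‖ₑ)
    (fun x hx => by simp [hb.momentum x hx]) (fun x => ?_) _ _ _).trans (le_of_eq ?_)
  · rw [← ofReal_norm]
    exact ENNReal.ofReal_le_ofReal (hCb x)
  · rw [ennormSq_coe, ennormSq_coe, ennormSq_coe, ← hD2, mul_pow, mul_pow, mul_pow,
      Real.sq_sqrt ENNReal.toReal_nonneg, ENNReal.ofReal_mul (by positivity),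
      ENNReal.ofReal_mul (by positivity), ENNReal.ofReal_mul (by positivity),
      ENNReal.ofReal_toReal hD]
    ring

lemma ne_top_of_ennormSq_ne_top {u : ZStar → ℝ≥0∞} (h : ennormSq a s u ≠ ⊤) (n : ZStar) :
    u n ≠ ⊤ := by
  intro hn
  refine ENNReal.ne_top_of_tsum_ne_top h n ?_
  rw [hn, ENNReal.mul_top, ENNReal.top_pow (by norm_num)]
  exact (ENNReal.ofReal_pos.2 (weight_pos a s n)).ne'

lemma IsKernel.convSeq_ne_top {b : Quad → ℂ} (hb : IsKernel s s' b) (hg : IsGood a s s')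
    (u v w : Ell a s) (l : ZStar) : convSeq (fun x => ‖b x‖ₑ) (fun n => ‖u n‖ₑ) (fun n => ‖v n‖ₑ)
        (fun n => ‖w n‖ₑ) l ≠ ⊤ := by
  obtain ⟨D, -, hD⟩ := hb.exists_bound hg
  exact ne_top_of_ennormSq_ne_top ((hD u v w).trans_lt ENNReal.ofReal_lt_top).ne l

lemma summable_of_tsum_enorm_ne_top {ι F : Type*} [NormedAddCommGroup F] [CompleteSpace F]
    {f : ι → F} (h : ∑' i, ‖f i‖ₑ ≠ ⊤) : Summable f := by
  refine Summable.of_norm ?_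
  have := ENNReal.summable_toReal h
  simpa using this

lemma IsKernel.summable {b : Quad → ℂ} (hb : IsKernel s s' b) (hg : IsGood a s s')
    (u v w : Ell a s) (l : ZStar) : Summable fun t : ZStar × ZStar × ZStar =>
      b (quadOf t l) * (u t.1 * v t.2.1 * (starRingEnd ℂ) (w t.2.2)) := by
  refine summable_of_tsum_enorm_ne_top ?_
  simp only [enorm_triSeq_term]
  exact hb.convSeq_ne_top hg u v w l

/-- A trilinear map with a bound, as a continuous trilinear map. -/
def mkTri {E F : Type*} [NormedAddCommGroup E] [NormedSpace ℝ E] [NormedAddCommGroup F]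
    [NormedSpace ℝ F] (f : E → E → E → F) (h1 : ∀ u u' v w, f (u + u') v w = f u v w + f u' v w)
    (h1' : ∀ (c : ℝ) u v w, f (c • u) v w = c • f u v w)
    (h2 : ∀ u v v' w, f u (v + v') w = f u v w + f u v' w)
    (h2' : ∀ (c : ℝ) u v w, f u (c • v) w = c • f u v w)
    (h3 : ∀ u v w w', f u v (w + w') = f u v w + f u v w')
    (h3' : ∀ (c : ℝ) u v w, f u v (c • w) = c • f u v w)
    (h : ∃ D : ℝ, 0 ≤ D ∧ ∀ u v w, ‖f u v w‖ ≤ D * ‖u‖ * ‖v‖ * ‖w‖) :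
    E →L[ℝ] E →L[ℝ] E →L[ℝ] F :=
  LinearMap.mkContinuous
    { toFun := fun u => LinearMap.mkContinuous₂
        (LinearMap.mk₂ ℝ (f u) (h2 u) (fun c => h2' c u) (h3 u) (fun c => h3' c u))
        (h.choose * ‖u‖) (h.choose_spec.2 u)
      map_add' := fun u u' => by
        ext v w
        exact h1 u u' v w
      map_smul' := fun c u => by
        ext v w
        exact h1' c u v w }
    h.choose fun u => LinearMap.mkContinuous₂_norm_le _
      (mul_nonneg h.choose_spec.1 (norm_nonneg u)) (h.choose_spec.2 u)

lemma norm_le_of_ennormSq_le {q : Ell a s} {D : ℝ} (hD : 0 ≤ D)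
    (h : ennormSq a s (fun n => ‖q n‖ₑ) ≤ ENNReal.ofReal (D ^ 2)) : ‖q‖ ≤ D := by
  rw [ennormSq_coe, ENNReal.ofReal_le_ofReal_iff (by positivity)] at h
  exact (sq_le_sq₀ (norm_nonneg q) hD).1 h

/-- The element of `ℓ^{a,s}` with given entries. -/
def Ell.mk (q : ZStar → ℂ) (h : q ∈ ellSubmodule a s) : Ell a s := ⟨q, h⟩

@[simp] lemma Ell.mk_coe (q : ZStar → ℂ) (h : q ∈ ellSubmodule a s) (n : ZStar) :
    Ell.mk q h n = q n := rfl

/-- The trilinear map `(u, v, w) ↦ (∑_{i,j,k} b_{ijkl} u_i v_j w̄_k)_l`. -/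
def tri {b : Quad → ℂ} (hb : IsKernel s s' b) (hg : IsGood a s s') :
    Ell a s →L[ℝ] Ell a s →L[ℝ] Ell a s →L[ℝ] Ell a s' :=
  have hle : ∃ D : ℝ, 0 ≤ D ∧ ∀ u v w : Ell a s,
      ennormSq a s' (fun l => ‖triSeq b u v w l‖ₑ) ≤ ENNReal.ofReal ((D * ‖u‖ * ‖v‖ * ‖w‖) ^ 2) :=
    (hb.exists_bound hg).imp fun _ h => ⟨h.1, fun u v w =>
      (ennormSq_mono fun l => enorm_triSeq_le b u v w l).trans (h.2 u v w)⟩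
  have hmem : ∀ u v w : Ell a s, triSeq b u v w ∈ ellSubmodule a s' := fun u v w =>
    mem_of_ennormSq_ne_top ((hle.choose_spec.2 u v w).trans_lt ENNReal.ofReal_lt_top).ne
  mkTri (fun u v w => Ell.mk (triSeq b u v w) (hmem u v w))
    (fun u u' v w => Ell.ext' fun l => by
      refine Eq.trans (tsum_congr fun t => ?_)
        ((hb.summable hg u v w l).tsum_add (hb.summable hg u' v w l))
      rw [Ell.add_coe]; ring)
    (fun c u v w => Ell.ext' fun l => by
      refine Eq.trans (Eq.trans (tsum_congr fun t => ?_) tsum_mul_left)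
        (Ell.smul_coe c (Ell.mk _ (hmem u v w)) l).symm
      rw [Ell.smul_coe]; ring)
    (fun u v v' w => Ell.ext' fun l => by
      refine Eq.trans (tsum_congr fun t => ?_)
        ((hb.summable hg u v w l).tsum_add (hb.summable hg u v' w l))
      rw [Ell.add_coe]; ring)
    (fun c u v w => Ell.ext' fun l => by
      refine Eq.trans (Eq.trans (tsum_congr fun t => ?_) tsum_mul_left)
        (Ell.smul_coe c (Ell.mk _ (hmem u v w)) l).symm
      rw [Ell.smul_coe]; ring)
    (fun u v w w' => Ell.ext' fun l => by
      refine Eq.trans (tsum_congr fun t => ?_)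
        ((hb.summable hg u v w l).tsum_add (hb.summable hg u v w' l))
      rw [Ell.add_coe, map_add]; ring)
    (fun c u v w => Ell.ext' fun l => by
      refine Eq.trans (Eq.trans (tsum_congr fun t => ?_) tsum_mul_left)
        (Ell.smul_coe c (Ell.mk _ (hmem u v w)) l).symm
      rw [Ell.smul_coe, map_mul, Complex.conj_ofReal]; ring)
    ⟨hle.choose, hle.choose_spec.1, fun u v w => norm_le_of_ennormSq_le
      (by have := hle.choose_spec.1; positivity) (hle.choose_spec.2 u v w)⟩

lemma tri_coe {b : Quad → ℂ} (hb : IsKernel s s' b) (hg : IsGood a s s') (u v w : Ell a s)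
    (l : ZStar) : tri hb hg u v w l = triSeq b u v w l := rfl

end Trilinear

/-! ### Multiplication operators and the symplectic form -/

section Pairing

open scoped ENNReal ComplexConjugate

variable {a a' s s' : ℝ}

/-- Multiplication by a real sequence that is bounded relative to the weights. -/
def mulOp (m : ZStar → ℝ) (h : ∀ n, weight a' s' n * |m n| ≤ weight a s n) :
    Ell a s →L[ℝ] Ell a' s' :=
  have hle : ∀ q : Ell a s, ennormSq a' s' (fun n => ‖(m n : ℂ) * q n‖ₑ) ≤
      ENNReal.ofReal (‖q‖ ^ 2) := fun q => by
    rw [← ennormSq_coe]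
    refine ENNReal.tsum_le_tsum fun n => ?_
    refine pow_le_pow_left' ?_ 2
    beta_reduce
    rw [enorm_mul, ← mul_assoc, ← ofReal_norm (m n : ℂ), Complex.norm_real, Real.norm_eq_abs,
      ← ENNReal.ofReal_mul (weight_pos a' s' n).le]
    gcongr
    exact h n
  have hmem : ∀ q : Ell a s, (fun n => (m n : ℂ) * q n) ∈ ellSubmodule a' s' := fun q =>
    mem_of_ennormSq_ne_top ((hle q).trans_lt ENNReal.ofReal_lt_top).ne
  LinearMap.mkContinuous
    { toFun := fun q => Ell.mk (fun n => (m n : ℂ) * q n) (hmem q)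
      map_add' := fun q r => Ell.ext' fun n => mul_add _ _ _
      map_smul' := fun c q => Ell.ext' fun n => by
        refine Eq.trans ?_ (Ell.smul_coe c (Ell.mk _ (hmem q)) n).symm
        rw [Ell.mk_coe, Ell.smul_coe, Ell.mk_coe]
        ring } 1 fun q => by
    rw [one_mul]
    exact norm_le_of_ennormSq_le (norm_nonneg q) (hle q)

@[simp] lemma mulOp_coe (m : ZStar → ℝ) (h : ∀ n, weight a' s' n * |m n| ≤ weight a s n)
    (q : Ell a s) (n : ZStar) : mulOp m h q n = m n * q n := rfl

lemma norm_mulOp_le (m : ZStar → ℝ) (h : ∀ n, weight a' s' n * |m n| ≤ weight a s n)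
    (q : Ell a s) : ‖mulOp m h q‖ ≤ ‖q‖ := by
  have h1 : ‖mulOp m h‖ ≤ 1 := by
    unfold mulOp
    exact LinearMap.mkContinuous_norm_le _ zero_le_one _
  simpa using (mulOp m h).le_of_opNorm_le h1 q

/-- The inclusion `ℓ^{a,s} ⊆ ℓ^{a,s'}`. -/
def incl (a : ℝ) (h : s' ≤ s) : Ell a s →L[ℝ] Ell a s' :=
  mulOp (fun _ => 1) fun n => by simpa using weight_mono h n

@[simp] lemma incl_coe (h : s' ≤ s) (q : Ell a s) (n : ZStar) : incl a h q n = q n := by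
  simp [incl]

lemma incl_refl (q : Ell a s) : incl a (le_refl s) q = q := Ell.ext' fun n => by simp

/-- The operator `q ↦ (n q_n)_n`, which is `-i ∂_x` on the Fourier side. -/
def ellDeriv (a s : ℝ) : Ell a s →L[ℝ] Ell a (s - 1) :=
  mulOp (fun n => n.1) fun n => by
    have h : 0 < |(n.1 : ℝ)| := zero_lt_one.trans_le (one_le_abs n)
    rw [weight, weight, mul_right_comm, ← Real.rpow_add_one h.ne', sub_add_cancel]

@[simp] lemma ellDeriv_coe (q : Ell a s) (n : ZStar) : ellDeriv a s q n = n.1 * q n := by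
  simp [ellDeriv]

/-- The inclusion `ℓ^{a,s} ⊆ ℓ²`. -/
def toUnweighted (ha : 0 ≤ a) (hs : 0 ≤ s) : Ell a s →L[ℝ] lp (fun _ : ZStar => ℂ) 2 :=
  (ellIso 0 0).toContinuousLinearEquiv.toContinuousLinearMap ∘L
    mulOp (fun _ => 1) fun n => by simpa [weight] using one_le_weight ha hs n

lemma toUnweighted_coe (ha : 0 ≤ a) (hs : 0 ≤ s) (q : Ell a s) (n : ZStar) :
    toUnweighted ha hs q n = q n := by
  change weight 0 0 n • (((1 : ℝ) : ℂ) * q n) = q n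
  simp [weight]

lemma norm_toUnweighted_le (ha : 0 ≤ a) (hs : 0 ≤ s) (q : Ell a s) :
    ‖toUnweighted ha hs q‖ ≤ ‖q‖ := by
  have h : ∀ n : ZStar, weight 0 0 n * |(1 : ℝ)| ≤ weight a s n := fun n => by
    simpa [weight] using one_le_weight ha hs n
  exact ((ellIso 0 0).norm_map _).le.trans (norm_mulOp_le (fun _ => 1) h q)

/-- The pairing `(u, v) ↦ ∑ u_n v̄_n`. -/
def pair (ha : 0 ≤ a) (hs : 0 ≤ s) : Ell a s →L[ℝ] Ell a s →L[ℝ] ℂ :=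
  LinearMap.mkContinuous₂
    (LinearMap.mk₂ ℝ (fun u v => inner ℂ (toUnweighted ha hs v) (toUnweighted ha hs u))
      (fun _ _ _ => by rw [map_add, inner_add_right])
      (fun c _ _ => by rw [map_smul, inner_smul_right_eq_smul])
      (fun _ _ _ => by rw [map_add, inner_add_left])
      (fun c _ _ => by rw [map_smul, inner_smul_left_eq_star_smul, starRingEnd_apply, star_trivial])) 1 fun u v => by
    rw [one_mul, mul_comm]
    refine (norm_inner_le_norm (𝕜 := ℂ) (toUnweighted ha hs v) (toUnweighted ha hs u)).trans ?_
    gcongr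
    · exact norm_toUnweighted_le ha hs v
    · exact norm_toUnweighted_le ha hs u

lemma hasSum_pair (ha : 0 ≤ a) (hs : 0 ≤ s) (u v : Ell a s) :
    HasSum (fun n => u n * conj (v n)) (pair ha hs u v) := by
  have h := lp.hasSum_inner (𝕜 := ℂ) (toUnweighted ha hs v) (toUnweighted ha hs u)
  simp only [toUnweighted_coe] at h
  exact h

lemma conj_pair (ha : 0 ≤ a) (hs : 0 ≤ s) (u v : Ell a s) :
    conj (pair ha hs u v) = pair ha hs v u := by
  change conj (inner ℂ (toUnweighted ha hs v) (toUnweighted ha hs u)) =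
    inner ℂ (toUnweighted ha hs u) (toUnweighted ha hs v)
  exact inner_conj_symm _ _

/-- The real bilinear form `(v, w) ↦ 2 Im ∑ v_n w̄_n`. -/
def om (ha : 0 ≤ a) (hs : 0 ≤ s) : Ell a s →L[ℝ] Ell a s →L[ℝ] ℝ :=
  (ContinuousLinearMap.compL ℝ (Ell a s) ℂ ℝ ((2 : ℝ) • Complex.imCLM)) ∘L pair ha hs

lemma om_apply (ha : 0 ≤ a) (hs : 0 ≤ s) (u v : Ell a s) :
    om ha hs u v = 2 * (pair ha hs u v).im := rfl

lemma om_antisymm (ha : 0 ≤ a) (hs : 0 ≤ s) (u v : Ell a s) : om ha hs u v = -om ha hs v u := by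
  rw [om_apply, om_apply, ← conj_pair ha hs v u, Complex.conj_im]
  ring

lemma symp_eq_om (ha : 0 ≤ a) (hs : 0 ≤ s) (u v : Ell a s) : symp u v = om ha hs u v := by
  have h := (hasSum_pair ha hs u v).sub (hasSum_pair ha hs v u)
  rw [symp, h.tsum_eq, ← conj_pair ha hs u v, om_apply, Complex.sub_conj]
  push_cast
  linear_combination (-2 * ((pair ha hs u v).im : ℂ)) * Complex.I_mul_I

/-- The symplectic pairing does not involve the weights. Symplecticity in `ℓ^{a,s}` can therefore be
checked in `ℓ^{a,s'}`, where the propagator lives. -/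
lemma om_incl (ha : 0 ≤ a) (hs' : 0 ≤ s') (h : s' ≤ s) (u v : Ell a s) :
    om ha hs' (incl a h u) (incl a h v) = om ha (hs'.trans h) u v := by
  have h1 := hasSum_pair ha hs' (incl a h u) (incl a h v)
  simp only [incl_coe] at h1
  rw [om_apply, om_apply, h1.unique (hasSum_pair ha (hs'.trans h) u v)]

@[simp] lemma single_coe_self (j : ZStar) (z : ℂ) : (single j z : Ell a s) j = z :=
  Pi.single_eq_same (M := fun _ : ZStar => ℂ) j z

lemma single_coe_of_ne {j n : ZStar} (h : n ≠ j) (z : ℂ) : (single j z : Ell a s) n = 0 :=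
  Pi.single_eq_of_ne (M := fun _ : ZStar => ℂ) h z

lemma om_single (ha : 0 ≤ a) (hs' : 0 ≤ s') (h : s' ≤ s) (j : ZStar) (z : ℂ) (v : Ell a s') :
    om ha hs' (incl a h (single j z)) v = 2 * (z * conj (v j)).im := by
  have h1 := hasSum_pair ha hs' (incl a h (single j z)) v
  have h2 := hasSum_single (f := fun n => (incl a h (single j z)) n * conj (v n)) j
    fun n hn => by simp [single_coe_of_ne hn]
  rw [om_apply, h1.unique h2]
  simp

/-- A vector field that represents the differential by means of the symplectic form is the
Hamiltonian vector field. -/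
lemma HasAnalyticVF.of_fderiv (ha : 0 ≤ a) (hs' : 0 ≤ s') (h : s' ≤ s) {H : Ell a s → ℝ}
    {X : Ell a s → Ell a s'} {U : Set (Ell a s)} (hH : AnalyticOnNhd ℝ H U)
    (hX : AnalyticOnNhd ℝ X U) (hd : ∀ q ∈ U, ∀ v, fderiv ℝ H q v = om ha hs' (incl a h v) (X q)) :
    HasAnalyticVF H X U := by
  refine ⟨hH, hX, fun q hq j => ?_⟩
  -- The two real derivatives are `-2 Im X_j` in direction `1` and `2 Re X_j` in direction `i`, so
  -- that `∂H/∂q̄_j = i X_j`.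
  rw [dbar, hd q hq, hd q hq, om_single, om_single]
  apply Complex.ext <;> simp

/-- The equivalence of `Quad` with pairs of the last component and the first three. -/
def quadEquiv : ZStar × (ZStar × ZStar × ZStar) ≃ Quad where
  toFun x := quadOf x.2 x.1
  invFun x := (x.l, x.i, x.j, x.k)
  left_inv _ := rfl
  right_inv _ := rfl

/-- The terms `b_{ijkl} u_i v_j w̄_k z̄_l`. -/
def quarticTerm (b : Quad → ℂ) (u v w z : ZStar → ℂ) (x : Quad) : ℂ :=
  b x * (u x.i * v x.j * conj (w x.k)) * conj (z x.l)

/-- Summing over `i, j, k` first leaves the product of two sequences of finite weighted norm,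
summable by `2xy ≤ x² + y²` since the weights are at least 1. -/
lemma IsKernel.summable_quarticTerm {b : Quad → ℂ} (hb : IsKernel s s' b) (hg : IsGood a s s')
    (u v w : Ell a s) (z : Ell a s') : Summable (quarticTerm b u v w z) := by
  rw [← quadEquiv.summable_iff]
  refine summable_of_tsum_enorm_ne_top ?_
  obtain ⟨D, -, hD⟩ := hb.exists_bound hg
  have h1 : ∀ l, ∑' t, ‖(quarticTerm b u v w z ∘ quadEquiv) (l, t)‖ₑ =
      convSeq (fun x => ‖b x‖ₑ) (fun n => ‖u n‖ₑ) (fun n => ‖v n‖ₑ) (fun n => ‖w n‖ₑ) l *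
        ‖z l‖ₑ := by
    intro l
    rw [convSeq, ← ENNReal.tsum_mul_right]
    refine tsum_congr fun t => ?_
    rw [← enorm_triSeq_term]
    simp [quarticTerm, quadEquiv, enorm_mul]
  rw [ENNReal.tsum_prod']
  simp only [h1]
  set c := convSeq (fun x => ‖b x‖ₑ) (fun n => ‖u n‖ₑ) (fun n => ‖v n‖ₑ) (fun n => ‖w n‖ₑ)
  have h2 : ∀ l, c l * ‖z l‖ₑ ≤ (ENNReal.ofReal (weight a s' l) * c l) ^ 2 +
      (ENNReal.ofReal (weight a s' l) * ‖z l‖ₑ) ^ 2 := by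
    intro l
    have hw : 1 ≤ ENNReal.ofReal (weight a s' l) := by
      rw [← ENNReal.ofReal_one]
      exact ENNReal.ofReal_le_ofReal (one_le_weight hg.a_nonneg hg.nonneg l)
    refine le_trans ?_ (ennreal_two_mul_le_add_sq _ _)
    refine le_trans ?_ (le_mul_of_one_le_left' one_le_two)
    exact mul_le_mul' (le_mul_of_one_le_left' hw) (le_mul_of_one_le_left' hw)
  refine ((ENNReal.tsum_le_tsum h2).trans_lt ?_).ne
  rw [ENNReal.tsum_add]
  refine ENNReal.add_lt_top.2 ⟨(hD u v w).trans_lt ENNReal.ofReal_lt_top, ?_⟩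
  exact (ennormSq_coe z).trans_lt ENNReal.ofReal_lt_top

lemma hasSum_pair_tri {b : Quad → ℂ} (hb : IsKernel s s' b) (hg : IsGood a s s')
    (u v w : Ell a s) (z : Ell a s') :
    HasSum (quarticTerm b u v w z) (pair hg.a_nonneg hg.nonneg (tri hb hg u v w) z) := by
  have hs := (quadEquiv.summable_iff.2 (hb.summable_quarticTerm hg u v w z)).hasSum
  have h1 := hs.prod_fiberwise (g := fun l => tri hb hg u v w l * conj (z l)) fun l => by
    have := (hb.summable hg u v w l).hasSum.mul_right (conj (z l))
    exact this
  rw [(hasSum_pair hg.a_nonneg hg.nonneg (tri hb hg u v w) z).unique h1]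
  exact quadEquiv.hasSum_iff.1 hs

end Pairing

/-! ### Quartic Hamiltonians -/

section Quartic

open scoped ComplexConjugate

variable {a s s' : ℝ} {b : Quad → ℂ}

lemma hasSum_of_eq {ι M : Type*} [AddCommMonoid M] [TopologicalSpace M] {f g : ι → M} {x y : M}
    (h : HasSum f x) (hf : ∀ i, g i = f i) (hy : y = x) : HasSum g y := by
  rw [hy, funext hf]
  exact h

/-- Interchange of the first two components. -/
def Quad.swapLeft : Quad ≃ Quad where
  toFun x := ⟨x.j, x.i, x.k, x.l⟩
  invFun x := ⟨x.j, x.i, x.k, x.l⟩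
  left_inv _ := rfl
  right_inv _ := rfl

/-- Interchange of the last two components. -/
def Quad.swapRight : Quad ≃ Quad where
  toFun x := ⟨x.i, x.j, x.l, x.k⟩
  invFun x := ⟨x.i, x.j, x.l, x.k⟩
  left_inv _ := rfl
  right_inv _ := rfl

/-- Interchange of the first two with the last two components. -/
def Quad.exchange : Quad ≃ Quad where
  toFun x := ⟨x.k, x.l, x.i, x.j⟩
  invFun x := ⟨x.k, x.l, x.i, x.j⟩
  left_inv _ := rfl
  right_inv _ := rfl

/-- Kernels of quartic Hamiltonians `½ ∑ b_{ijkl} q_i q_j q̄_k q̄_l`, normalised to have all the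
symmetries of the monomials. -/
structure IsHamKernel (s s' : ℝ) (b : Quad → ℂ) : Prop extends IsKernel s s' b where
  swapLeft : ∀ x, b (Quad.swapLeft x) = b x
  swapRight : ∀ x, b (Quad.swapRight x) = b x
  exchange : ∀ x, b (Quad.exchange x) = conj (b x)

lemma IsKernel.const_mul (hb : IsKernel s s' b) (c : ℂ) : IsKernel s s' (fun x => c * b x) := by
  refine ⟨fun x hx => by simp [hb.momentum x hx], ?_⟩
  obtain ⟨C, hC, h⟩ := hb.bound
  refine ⟨‖c‖ * C, by positivity, fun x => ?_⟩
  rw [norm_mul, mul_assoc]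
  gcongr
  exact h x

/-- The trilinear form of the Hamiltonian vector field of `½ ∑ b_{ijkl} q_i q_j q̄_k q̄_l`. -/
def vf (hb : IsHamKernel s s' b) (hg : IsGood a s s') :
    Ell a s →L[ℝ] Ell a s →L[ℝ] Ell a s →L[ℝ] Ell a s' :=
  tri (hb.toIsKernel.const_mul (-Complex.I)) hg

/-- Antisymmetry gives `-2 Im` of the pairing of the field with `z`, and the factor `-i` of a
Hamiltonian field turns this into `2 Re`. In this form the symmetries of the kernel become
symmetries in the four arguments. -/
lemma hasSum_om_vf (hb : IsHamKernel s s' b) (hg : IsGood a s s') (u v w : Ell a s)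
    (z : Ell a s') : HasSum (fun x => 2 * (quarticTerm b u v w z x).re)
      (om hg.a_nonneg hg.nonneg z (vf hb hg u v w)) := by
  have h := hasSum_pair_tri (hb.toIsKernel.const_mul (-Complex.I)) hg u v w z
  have h2 := (Complex.hasSum_im h).mul_left (-2)
  rw [om_antisymm, om_apply]
  refine hasSum_of_eq h2 (fun x => ?_) ?_
  · have : quarticTerm (fun x => -Complex.I * b x) u v w z x =
        -Complex.I * quarticTerm b u v w z x := by
      simp only [quarticTerm]
      ring
    rw [this]
    simp
  · rw [vf]
    ring

lemma om_vf_swapLeft (hb : IsHamKernel s s' b) (hg : IsGood a s s') (u v w : Ell a s)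
    (z : Ell a s') : om hg.a_nonneg hg.nonneg z (vf hb hg u v w) =
      om hg.a_nonneg hg.nonneg z (vf hb hg v u w) := by
  refine ((Quad.swapLeft.hasSum_iff).2 (hasSum_om_vf hb hg u v w z)).unique ?_
  convert hasSum_om_vf hb hg v u w z using 1
  funext x
  simp only [Function.comp_apply, quarticTerm, hb.swapLeft]
  simp only [Quad.swapLeft, Equiv.coe_fn_mk]
  rw [mul_comm (u x.j)]

/-- The two conjugated arguments `w` and `z` may be interchanged by relabelling `k` and `l`. Here
`z` must lie in the smaller space to be admissible as an argument of `vf`. -/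
lemma om_vf_swapRight (hb : IsHamKernel s s' b) (hg : IsGood a s s') (u v w z : Ell a s) :
    om hg.a_nonneg hg.nonneg (incl a hg.le z) (vf hb hg u v w) =
      om hg.a_nonneg hg.nonneg (incl a hg.le w) (vf hb hg u v z) := by
  refine ((Quad.swapRight.hasSum_iff).2 (hasSum_om_vf hb hg u v w (incl a hg.le z))).unique ?_
  convert hasSum_om_vf hb hg u v z (incl a hg.le w) using 1
  funext x
  simp only [Function.comp_apply, quarticTerm, hb.swapRight, incl_coe]
  simp only [Quad.swapRight, Equiv.coe_fn_mk]
  congr 2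
  ring

/-- The exchange symmetry conjugates every term, which does not affect the real part; it moves the
conjugated arguments into the unconjugated slots. -/
lemma om_vf_exchange (hb : IsHamKernel s s' b) (hg : IsGood a s s') (u v w z : Ell a s) :
    om hg.a_nonneg hg.nonneg (incl a hg.le z) (vf hb hg u v w) =
      om hg.a_nonneg hg.nonneg (incl a hg.le v) (vf hb hg w z u) := by
  refine ((Quad.exchange.hasSum_iff).2 (hasSum_om_vf hb hg u v w (incl a hg.le z))).unique ?_
  convert hasSum_om_vf hb hg w z u (incl a hg.le v) using 1
  funext x
  simp only [Function.comp_apply, quarticTerm, hb.exchange, incl_coe]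
  simp only [Quad.exchange, Equiv.coe_fn_mk]
  rw [← Complex.conj_re]
  simp only [map_mul, Complex.conj_conj]
  congr 2
  ring

/-- The linearised Hamiltonian vector field is skew with respect to the symplectic form. -/
lemma om_cubicDeriv_vf_skew (hb : IsHamKernel s s b) (hg : IsGood a s s) (q x y : Ell a s) :
    om hg.a_nonneg hg.nonneg (cubicDeriv (vf hb hg) q x) y +
      om hg.a_nonneg hg.nonneg x (cubicDeriv (vf hb hg) q y) = 0 := by
  have h1 := om_vf_swapRight hb hg q q x y
  have h2 := om_vf_exchange hb hg q x q y
  have h3 := om_vf_swapLeft hb hg x q q y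
  have h4 := om_vf_swapLeft hb hg y q q x
  simp only [incl_refl] at h1 h2
  rw [om_antisymm, cubicDeriv_apply, cubicDeriv_apply]
  simp only [map_add]
  linarith

/-- The quartic Hamiltonian `½ ∑ b_{ijkl} q_i q_j q̄_k q̄_l`. -/
def ham (hb : IsHamKernel s s' b) (hg : IsGood a s s') (q : Ell a s) : ℝ :=
  -- Euler's identity: a function of degree four satisfies `dH(q) q = 4 H(q)`.
  1 / 4 * om hg.a_nonneg hg.nonneg (incl a hg.le q) (cubic (vf hb hg) q)

lemma analyticAt_ham (hb : IsHamKernel s s' b) (hg : IsGood a s s') (q : Ell a s) :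
    AnalyticAt ℝ (ham hb hg) q :=
  analyticAt_const.mul (analyticAt_clm_apply (f := fun q => om hg.a_nonneg hg.nonneg
    (incl a hg.le q)) (analyticAt_clm_comp _ ((incl a hg.le).analyticAt q))
    (analyticAt_cubic _ q))

/-- The product rule gives four terms, one for each slot into which `v` may be put. They all
coincide by the kernel symmetries, and this cancels the factor `1/4`. -/
lemma fderiv_ham (hb : IsHamKernel s s' b) (hg : IsGood a s s') (q v : Ell a s) :
    fderiv ℝ (ham hb hg) q v =
      om hg.a_nonneg hg.nonneg (incl a hg.le v) (cubic (vf hb hg) q) := by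
  have h0 : HasFDerivAt (fun q => om hg.a_nonneg hg.nonneg (incl a hg.le q))
      (om hg.a_nonneg hg.nonneg ∘L incl a hg.le) q :=
    (om hg.a_nonneg hg.nonneg ∘L incl a hg.le).hasFDerivAt
  have h := (h0.clm_apply (hasFDerivAt_cubic (vf hb hg) q)).const_mul (1 / 4 : ℝ)
  have h1 : fderiv ℝ (ham hb hg) q v =
      1 / 4 * (om hg.a_nonneg hg.nonneg (incl a hg.le q) (cubicDeriv (vf hb hg) q v) +
        om hg.a_nonneg hg.nonneg (incl a hg.le v) (cubic (vf hb hg) q)) := by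
    rw [HasFDerivAt.fderiv (f := ham hb hg) h]
    rfl
  have h2 := om_vf_swapRight hb hg q q v q
  have h3 := om_vf_exchange hb hg q v q q
  have h4 := om_vf_swapLeft hb hg v q q (incl a hg.le q)
  rw [h1, cubicDeriv_apply]
  simp only [map_add, cubic]
  linarith

/-- The sum is real because exchanging `(i, j)` with `(k, l)` replaces each term by its complex
conjugate. -/
lemma hasSum_ham (hb : IsHamKernel s s' b) (hg : IsGood a s s') (q : Ell a s) :
    HasSum (fun x : Quad => 1 / 2 * (b x * x.mono q)) (ham hb hg q : ℂ) := by
  have h0 := (hb.toIsKernel.summable_quarticTerm hg q q q (incl a hg.le q)).hasSum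
  set S := ∑' x, quarticTerm b q q q (incl a hg.le q) x with hS
  have him : S.im = 0 := by
    have h1 := Complex.hasSum_im h0
    have h2 := (Quad.exchange.hasSum_iff).2 h1
    have h3 : HasSum (fun x => -(quarticTerm b q q q (incl a hg.le q) x).im) S.im := by
      convert h2 using 1
      funext x
      simp only [Function.comp_apply, quarticTerm, hb.exchange, incl_coe]
      simp only [Quad.exchange, Equiv.coe_fn_mk]
      rw [← Complex.conj_im]
      simp only [map_mul, Complex.conj_conj]
      congr 1
      ring
    have := h3.unique h1.neg
    linarith
  have hre : 2 * S.re = om hg.a_nonneg hg.nonneg (incl a hg.le q) (cubic (vf hb hg) q) :=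
    ((Complex.hasSum_re h0).mul_left 2).unique (hasSum_om_vf hb hg q q q (incl a hg.le q))
  have hval : (ham hb hg q : ℂ) = 1 / 2 * S := by
    apply Complex.ext
    · rw [Complex.ofReal_re, ham, ← hre]
      simp
      ring
    · simp [him]
  rw [hval]
  refine hasSum_of_eq (h0.mul_left (1 / 2 : ℂ)) (fun x => ?_) rfl
  simp only [quarticTerm, Quad.mono, incl_coe]
  ring

lemma hasAnalyticVF_ham (hb : IsHamKernel s s' b) (hg : IsGood a s s') (U : Set (Ell a s)) :
    HasAnalyticVF (ham hb hg) (cubic (vf hb hg)) U :=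
  HasAnalyticVF.of_fderiv hg.a_nonneg hg.nonneg hg.le (fun q _ => analyticAt_ham hb hg q)
    (fun q _ => analyticAt_cubic _ q) fun q _ v => fderiv_ham hb hg q v

/-! ### Size and Lipschitz estimates for cubic maps and quartic Hamiltonians. -/

lemma norm_trilinear_le {E F : Type*} [NormedAddCommGroup E] [NormedSpace ℝ E]
    [NormedAddCommGroup F] [NormedSpace ℝ F] (T : E →L[ℝ] E →L[ℝ] E →L[ℝ] F) (u v w : E) :
    ‖T u v w‖ ≤ ‖T‖ * ‖u‖ * ‖v‖ * ‖w‖ := by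
  refine ((T u v).le_opNorm w).trans ?_
  gcongr
  exact (T.le_opNorm₂ u v)

lemma norm_cubic_le {E F : Type*} [NormedAddCommGroup E] [NormedSpace ℝ E]
    [NormedAddCommGroup F] [NormedSpace ℝ F] (T : E →L[ℝ] E →L[ℝ] E →L[ℝ] F) (q : E) :
    ‖cubic T q‖ ≤ ‖T‖ * ‖q‖ ^ 3 :=
  (norm_trilinear_le T q q q).trans (le_of_eq (by ring))

lemma norm_cubic_sub_le {E F : Type*} [NormedAddCommGroup E] [NormedSpace ℝ E]
    [NormedAddCommGroup F] [NormedSpace ℝ F] (T : E →L[ℝ] E →L[ℝ] E →L[ℝ] F) {x y : E} {M : ℝ}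
    (hx : ‖x‖ ≤ M) (hy : ‖y‖ ≤ M) : ‖cubic T x - cubic T y‖ ≤ 3 * ‖T‖ * M ^ 2 * ‖x - y‖ := by
  have h : cubic T x - cubic T y = T (x - y) x x + T y (x - y) x + T y y (x - y) := by
    simp only [cubic, map_sub, _root_.sub_apply]
    abel
  have hM := (norm_nonneg x).trans hx
  have h1 : ‖T (x - y) x x‖ ≤ ‖T‖ * ‖x - y‖ * M * M :=
    (norm_trilinear_le T _ _ _).trans (by gcongr)
  have h2 : ‖T y (x - y) x‖ ≤ ‖T‖ * M * ‖x - y‖ * M :=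
    (norm_trilinear_le T _ _ _).trans (by gcongr)
  have h3 : ‖T y y (x - y)‖ ≤ ‖T‖ * M * M * ‖x - y‖ :=
    (norm_trilinear_le T _ _ _).trans (by gcongr)
  rw [h]
  refine (norm_add₃_le).trans ((add_le_add (add_le_add h1 h2) h3).trans (le_of_eq ?_))
  ring

lemma norm_incl_le (h : s' ≤ s) (q : Ell a s) : ‖incl a h q‖ ≤ ‖q‖ := norm_mulOp_le _ _ q

lemma abs_ham_le (hb : IsHamKernel s s' b) (hg : IsGood a s s') :
    ∃ C : ℝ, 0 ≤ C ∧ ∀ q, |ham hb hg q| ≤ C * ‖q‖ ^ 4 := by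
  refine ⟨1 / 4 * (‖om (a := a) hg.a_nonneg hg.nonneg‖ * ‖vf hb hg‖), by positivity, fun q => ?_⟩
  rw [ham, abs_mul, abs_of_nonneg (by norm_num : (0 : ℝ) ≤ 1 / 4), mul_assoc]
  gcongr
  rw [← Real.norm_eq_abs]
  calc _ ≤ ‖om (a := a) hg.a_nonneg hg.nonneg‖ * ‖incl a hg.le q‖ * ‖cubic (vf hb hg) q‖ :=
        ContinuousLinearMap.le_opNorm₂ _ _ _
    _ ≤ ‖om (a := a) hg.a_nonneg hg.nonneg‖ * ‖q‖ * (‖vf hb hg‖ * ‖q‖ ^ 3) := by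
        gcongr
        · exact norm_incl_le _ q
        · exact norm_cubic_le _ q
    _ = _ := by ring

/-- The Lipschitz constant on a ball of radius `M` is cubic in `M`. Together with a displacement of
order `‖q‖³` along the flow, this produces the order 6 of the remainder. -/
lemma abs_ham_sub_le (hb : IsHamKernel s s' b) (hg : IsGood a s s') :
    ∃ C : ℝ, 0 ≤ C ∧ ∀ (x y : Ell a s) (M : ℝ), ‖x‖ ≤ M → ‖y‖ ≤ M →
      |ham hb hg x - ham hb hg y| ≤ C * M ^ 3 * ‖x - y‖ := by
  refine ⟨‖om (a := a) hg.a_nonneg hg.nonneg‖ * ‖vf hb hg‖, by positivity, fun x y M hx hy => ?_⟩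
  have hM := (norm_nonneg x).trans hx
  have h : ham hb hg x - ham hb hg y = 1 / 4 *
      (om hg.a_nonneg hg.nonneg (incl a hg.le (x - y)) (cubic (vf hb hg) x) +
        om hg.a_nonneg hg.nonneg (incl a hg.le y) (cubic (vf hb hg) x - cubic (vf hb hg) y)) := by
    simp only [ham, map_sub, _root_.sub_apply]
    ring
  have h1 : |om hg.a_nonneg hg.nonneg (incl a hg.le (x - y)) (cubic (vf hb hg) x)| ≤
      ‖om (a := a) hg.a_nonneg hg.nonneg‖ * ‖x - y‖ * (‖vf hb hg‖ * M ^ 3) := by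
    rw [← Real.norm_eq_abs]
    refine (ContinuousLinearMap.le_opNorm₂ _ _ _).trans ?_
    gcongr
    · exact norm_incl_le _ _
    · exact (norm_cubic_le _ x).trans (by gcongr)
  have h2 : |om hg.a_nonneg hg.nonneg (incl a hg.le y)
      (cubic (vf hb hg) x - cubic (vf hb hg) y)| ≤
      ‖om (a := a) hg.a_nonneg hg.nonneg‖ * M * (3 * ‖vf hb hg‖ * M ^ 2 * ‖x - y‖) := by
    rw [← Real.norm_eq_abs]
    refine (ContinuousLinearMap.le_opNorm₂ _ _ _).trans ?_
    gcongr
    · exact (norm_incl_le _ _).trans hy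
    · exact norm_cubic_sub_le _ hx hy
  rw [h, abs_mul, abs_of_nonneg (by norm_num : (0 : ℝ) ≤ 1 / 4)]
  have h3 := (abs_add_le _ _).trans (add_le_add h1 h2)
  calc _ ≤ 1 / 4 * _ := mul_le_mul_of_nonneg_left h3 (by norm_num)
    _ = _ := by ring

end Quartic

/-! ### The kernels of the quartic Hamiltonians -/

section Kernels

open scoped ComplexConjugate

variable {a p s s' : ℝ} {b c : Quad → ℂ}

lemma IsKernel.sub (hb : IsKernel s s' b) (hc : IsKernel s s' c) :
    IsKernel s s' (fun x => b x - c x) := by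
  refine ⟨fun x hx => by simp [hb.momentum x hx, hc.momentum x hx], ?_⟩
  obtain ⟨C, hC, h⟩ := hb.bound
  obtain ⟨D, hD, h'⟩ := hc.bound
  refine ⟨C + D, by positivity, fun x => ?_⟩
  rw [add_mul]
  exact (norm_sub_le _ _).trans (add_le_add (h x) (h' x))

lemma IsHamKernel.sub (hb : IsHamKernel s s' b) (hc : IsHamKernel s s' c) :
    IsHamKernel s s' (fun x => b x - c x) where
  toIsKernel := hb.toIsKernel.sub hc.toIsKernel
  swapLeft x := by rw [hb.swapLeft, hc.swapLeft]
  swapRight x := by rw [hb.swapRight, hc.swapRight]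
  exchange x := by rw [hb.exchange, hc.exchange, map_sub]

/-- `i + j`. -/
def Quad.total (x : Quad) : ℝ := x.i.1 + x.j.1

lemma Quad.abs_total_le (x : Quad) : |x.total| ≤ x.size := by
  have := abs_nonneg (x.k.1 : ℝ)
  have := abs_add_le (x.i.1 : ℝ) x.j.1
  unfold Quad.total Quad.size
  linarith

lemma Quad.abs_j_le (x : Quad) : |(x.j.1 : ℝ)| ≤ x.size := by
  have := abs_nonneg (x.k.1 : ℝ)
  have := abs_nonneg (x.i.1 : ℝ)
  unfold Quad.size
  linarith

lemma Quad.momentum_swapLeft (x : Quad) : (Quad.swapLeft x).Momentum ↔ x.Momentum := by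
  simp only [Quad.Momentum, Quad.swapLeft, Equiv.coe_fn_mk]
  omega

lemma Quad.momentum_swapRight (x : Quad) : (Quad.swapRight x).Momentum ↔ x.Momentum := by
  simp only [Quad.Momentum, Quad.swapRight, Equiv.coe_fn_mk]
  omega

lemma Quad.momentum_exchange (x : Quad) : (Quad.exchange x).Momentum ↔ x.Momentum := by
  simp only [Quad.Momentum, Quad.exchange, Equiv.coe_fn_mk]
  omega

lemma Quad.resonant_iff (x : Quad) :
    x.Resonant ↔ (x.k = x.i ∧ x.l = x.j) ∨ (x.k = x.j ∧ x.l = x.i) := by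
  rw [Quad.Resonant, Set.pair_eq_pair_iff]
  tauto

lemma Quad.Resonant.momentum {x : Quad} (h : x.Resonant) : x.Momentum := by
  rw [Quad.resonant_iff] at h
  rcases h with ⟨h1, h2⟩ | ⟨h1, h2⟩
  · rw [Quad.Momentum, h1, h2]
  · rw [Quad.Momentum, h1, h2, add_comm]

/-- The non-resonant quadruples with two or more components in `{n₁, n₂}`. -/
def Quad.Removable (n₁ n₂ : ℤ) (x : Quad) : Prop :=
  x.Momentum ∧ ¬ x.Resonant ∧ ¬ 3 ≤ x.normalCount n₁ n₂

lemma Quad.removable_swapLeft (n₁ n₂ : ℤ) (x : Quad) :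
    (Quad.swapLeft x).Removable n₁ n₂ ↔ x.Removable n₁ n₂ := by
  have h1 : (Quad.swapLeft x).Resonant ↔ x.Resonant := by
    simp only [Quad.resonant_iff, Quad.swapLeft, Equiv.coe_fn_mk]
    tauto
  have h2 : (Quad.swapLeft x).normalCount n₁ n₂ = x.normalCount n₁ n₂ := by
    simp only [Quad.normalCount, List.countP_cons, List.countP_nil, Quad.swapLeft,
      Equiv.coe_fn_mk]
    ring
  rw [Quad.Removable, Quad.Removable, x.momentum_swapLeft, h1, h2]

lemma Quad.removable_swapRight (n₁ n₂ : ℤ) (x : Quad) :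
    (Quad.swapRight x).Removable n₁ n₂ ↔ x.Removable n₁ n₂ := by
  have h1 : (Quad.swapRight x).Resonant ↔ x.Resonant := by
    simp only [Quad.resonant_iff, Quad.swapRight, Equiv.coe_fn_mk]
    tauto
  have h2 : (Quad.swapRight x).normalCount n₁ n₂ = x.normalCount n₁ n₂ := by
    simp only [Quad.normalCount, List.countP_cons, List.countP_nil, Quad.swapRight,
      Equiv.coe_fn_mk]
    ring
  rw [Quad.Removable, Quad.Removable, x.momentum_swapRight, h1, h2]

lemma Quad.removable_exchange (n₁ n₂ : ℤ) (x : Quad) :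
    (Quad.exchange x).Removable n₁ n₂ ↔ x.Removable n₁ n₂ := by
  have h1 : (Quad.exchange x).Resonant ↔ x.Resonant := eq_comm
  have h2 : (Quad.exchange x).normalCount n₁ n₂ = x.normalCount n₁ n₂ := by
    simp only [Quad.normalCount, List.countP_cons, List.countP_nil, Quad.exchange,
      Equiv.coe_fn_mk]
    ring
  rw [Quad.Removable, Quad.Removable, x.momentum_exchange, h1, h2]

lemma Quad.total_swapLeft (x : Quad) : (Quad.swapLeft x).total = x.total := add_comm _ _

lemma Quad.total_swapRight (x : Quad) : (Quad.swapRight x).total = x.total := rfl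

lemma Quad.Momentum.total_exchange {x : Quad} (h : x.Momentum) :
    (Quad.exchange x).total = x.total := by
  simp only [Quad.total, Quad.exchange, Equiv.coe_fn_mk]
  exact_mod_cast h.symm

open Classical in
/-- The kernel `(i + j) / 4π` restricted to a set of quadruples. -/
def restrictedKernel (P : Quad → Prop) (x : Quad) : ℂ :=
  if P x then ((x.total / (4 * Real.pi) : ℝ) : ℂ) else 0

open Classical in
/-- The kernel `j / 4π` restricted to a set of quadruples. -/
def rawKernel (P : Quad → Prop) (x : Quad) : ℂ :=
  if P x then ((x.j.1 / (4 * Real.pi) : ℝ) : ℂ) else 0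

lemma restrictedKernel_congr {P Q : Quad → Prop} {x y : Quad} (h : P x ↔ Q y)
    (ht : Q y → x.total = y.total) : restrictedKernel P x = restrictedKernel Q y := by
  by_cases hQ : Q y
  · rw [restrictedKernel, restrictedKernel, if_pos hQ, if_pos (h.2 hQ), ht hQ]
  · rw [restrictedKernel, restrictedKernel, if_neg hQ, if_neg fun hP => hQ (h.1 hP)]

lemma conj_restrictedKernel (P : Quad → Prop) (x : Quad) :
    conj (restrictedKernel P x) = restrictedKernel P x := by
  rw [restrictedKernel]
  split_ifs
  · exact Complex.conj_ofReal _
  · exact map_zero _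

lemma div_four_pi_le {y z : ℝ} (h : |y| ≤ z) : |y / (4 * Real.pi)| ≤ z := by
  have hpi := Real.pi_gt_three
  rw [abs_div, abs_of_pos (by positivity : 0 < 4 * Real.pi), div_le_iff₀ (by positivity)]
  nlinarith [(abs_nonneg y).trans h]

lemma isKernel_raw {P : Quad → Prop} (hP : ∀ x, P x → x.Momentum) :
    IsKernel p (p - 1) (rawKernel P) := by
  refine ⟨fun x hx => if_neg fun h => hx (hP x h), 1, zero_le_one, fun x => ?_⟩
  rw [sub_sub_cancel, Real.rpow_one, one_mul, rawKernel]
  split_ifs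
  · rw [Complex.norm_real, Real.norm_eq_abs]
    exact div_four_pi_le x.abs_j_le
  · simpa using zero_le_one.trans x.one_le_size

lemma isHamKernel_restricted {P : Quad → Prop} (hP : ∀ x, P x → x.Momentum)
    (h1 : ∀ x, P (Quad.swapLeft x) ↔ P x) (h2 : ∀ x, P (Quad.swapRight x) ↔ P x)
    (h3 : ∀ x, P (Quad.exchange x) ↔ P x) : IsHamKernel p (p - 1) (restrictedKernel P) where
  momentum x hx := if_neg fun h => hx (hP x h)
  bound := by
    refine ⟨1, zero_le_one, fun x => ?_⟩
    rw [sub_sub_cancel, Real.rpow_one, one_mul, restrictedKernel]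
    split_ifs
    · rw [Complex.norm_real, Real.norm_eq_abs]
      exact div_four_pi_le x.abs_total_le
    · simpa using zero_le_one.trans x.one_le_size
  swapLeft x := restrictedKernel_congr (h1 x) fun _ => x.total_swapLeft
  swapRight x := restrictedKernel_congr (h2 x) fun _ => x.total_swapRight
  exchange x := by
    rw [conj_restrictedKernel]
    exact restrictedKernel_congr (h3 x) fun h => (hP x h).total_exchange

/-- The kernel of `G`. -/
abbrev kerG : Quad → ℂ := restrictedKernel Quad.Momentum

/-- The kernel of the terms that are removed from `G`. -/
abbrev kerN (n₁ n₂ : ℤ) : Quad → ℂ := restrictedKernel (Quad.Removable n₁ n₂)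

lemma isHamKernel_kerG : IsHamKernel p (p - 1) kerG :=
  isHamKernel_restricted (fun _ h => h) Quad.momentum_swapLeft Quad.momentum_swapRight
    Quad.momentum_exchange

lemma isHamKernel_kerN (n₁ n₂ : ℤ) : IsHamKernel p (p - 1) (kerN n₁ n₂) :=
  isHamKernel_restricted (fun _ h => h.1) (Quad.removable_swapLeft n₁ n₂)
    (Quad.removable_swapRight n₁ n₂) (Quad.removable_exchange n₁ n₂)

/-- The kernel of `Ḡ`. -/
def kerBar (x : Quad) : ℂ :=
  1 / 2 * (restrictedKernel (fun x => x.k = x.i ∧ x.l = x.j) x +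
    restrictedKernel (fun x => x.k = x.j ∧ x.l = x.i) x)

lemma isHamKernel_kerBar : IsHamKernel p (p - 1) kerBar where
  momentum x hx := by
    have h : ¬ x.Resonant := fun h => hx h.momentum
    rw [Quad.resonant_iff, not_or] at h
    simp [kerBar, restrictedKernel, h.1, h.2]
  bound := by
    refine ⟨1, zero_le_one, fun x => ?_⟩
    rw [sub_sub_cancel, Real.rpow_one, one_mul]
    have h : ∀ P : Quad → Prop, ‖restrictedKernel P x‖ ≤ x.size := by
      intro P
      rw [restrictedKernel]
      split_ifs
      · rw [Complex.norm_real, Real.norm_eq_abs]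
        exact div_four_pi_le x.abs_total_le
      · simpa using zero_le_one.trans x.one_le_size
    rw [kerBar, norm_mul]
    have h1 := (norm_add_le _ _).trans (add_le_add (h fun x => x.k = x.i ∧ x.l = x.j)
      (h fun x => x.k = x.j ∧ x.l = x.i))
    norm_num
    linarith
  swapLeft x := by
    rw [kerBar, kerBar, add_comm]
    exact congrArg _ (congrArg₂ _ (restrictedKernel_congr Iff.rfl fun _ => x.total_swapLeft)
      (restrictedKernel_congr Iff.rfl fun _ => x.total_swapLeft))
  swapRight x := by
    rw [kerBar, kerBar, add_comm]
    exact congrArg _ (congrArg₂ _ (restrictedKernel_congr and_comm fun _ => x.total_swapRight)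
      (restrictedKernel_congr and_comm fun _ => x.total_swapRight))
  exchange x := by
    rw [kerBar, kerBar, map_mul, map_add, conj_restrictedKernel, conj_restrictedKernel]
    have h : conj (1 / 2 : ℂ) = 1 / 2 := by simp [map_ofNat]
    rw [h]
    refine congrArg _ (congrArg₂ _ (restrictedKernel_congr ?_ fun h => ?_)
      (restrictedKernel_congr ?_ fun h => ?_))
    · exact and_congr eq_comm eq_comm
    · exact (Quad.Resonant.momentum ((x.resonant_iff).2 (Or.inl h))).total_exchange
    · exact ⟨fun h => ⟨h.2.symm, h.1.symm⟩, fun h => ⟨h.2.symm, h.1.symm⟩⟩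
    · exact (Quad.Resonant.momentum ((x.resonant_iff).2 (Or.inr h))).total_exchange

/-- The kernel of `Ĝ`. -/
def kerHat (n₁ n₂ : ℤ) (x : Quad) : ℂ := kerG x - kerBar x - kerN n₁ n₂ x

lemma isHamKernel_kerHat (n₁ n₂ : ℤ) : IsHamKernel p (p - 1) (kerHat n₁ n₂) :=
  (isHamKernel_kerG.sub isHamKernel_kerBar).sub (isHamKernel_kerN n₁ n₂)

/-! ### Small divisors and the generating Hamiltonian. -/

/-- The divisor `i² + j² - k² - l²`. -/
def Quad.divisor (x : Quad) : ℝ :=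
  (x.i.1 : ℝ) ^ 2 + (x.j.1 : ℝ) ^ 2 - (x.k.1 : ℝ) ^ 2 - (x.l.1 : ℝ) ^ 2

lemma Quad.Momentum.divisor_eq {x : Quad} (h : x.Momentum) :
    x.divisor = -2 * (((x.k.1 - x.i.1) * (x.k.1 - x.j.1) : ℤ) : ℝ) := by
  have h1 : (x.l.1 : ℝ) = x.i.1 + x.j.1 - x.k.1 := by
    have : (x.i.1 : ℝ) + x.j.1 = x.k.1 + x.l.1 := by exact_mod_cast h
    linarith
  rw [Quad.divisor, h1]
  push_cast
  ring

/-- By momentum conservation `k = i` forces `l = j`, and `k = j` forces `l = i`; both are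
resonances. -/
lemma Quad.Removable.ne {n₁ n₂ : ℤ} {x : Quad} (h : x.Removable n₁ n₂) :
    x.k.1 - x.i.1 ≠ 0 ∧ x.k.1 - x.j.1 ≠ 0 := by
  have hm : x.i.1 + x.j.1 = x.k.1 + x.l.1 := h.1
  have hr := h.2.1
  rw [Quad.resonant_iff, not_or] at hr
  refine ⟨fun h0 => hr.1 ⟨Subtype.ext ?_, Subtype.ext ?_⟩,
    fun h0 => hr.2 ⟨Subtype.ext ?_, Subtype.ext ?_⟩⟩ <;> omega

lemma Quad.Removable.divisor_ne_zero {n₁ n₂ : ℤ} {x : Quad} (h : x.Removable n₁ n₂) :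
    x.divisor ≠ 0 := by
  rw [h.1.divisor_eq]
  have := mul_ne_zero h.ne.1 h.ne.2
  refine mul_ne_zero (by norm_num) ?_
  exact_mod_cast this

/-- At least two components lie in `{n₁, n₂}`, and `i + j = k + l` equals a signed sum of any two of
the components, up to one of the differences `k - i`, `k - j`. This is the estimate by which the
division by the divisor compensates the derivative in `G`. -/
lemma Quad.Removable.abs_add_le {n₁ n₂ : ℤ} {x : Quad} (h : x.Removable n₁ n₂) :
    |x.i.1 + x.j.1| ≤
      (2 * (|n₁| + |n₂|) + 1) * (|x.k.1 - x.i.1| * |x.k.1 - x.j.1|) := by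
  obtain ⟨hA, hB⟩ := h.ne
  have hA1 := Int.one_le_abs hA
  have hB1 := Int.one_le_abs hB
  have hm : x.i.1 + x.j.1 = x.k.1 + x.l.1 := h.1
  have hcount := h.2.2
  set M := |n₁| + |n₂| with hM
  have hn1 := abs_nonneg n₁
  have hn2 := abs_nonneg n₂
  have hS : ∀ m : ℤ, m = n₁ ∨ m = n₂ → |m| ≤ M := by
    rintro m (rfl | rfl) <;> omega
  -- The six cases are the possible pairs of components in `{n₁, n₂}`. For example `i + j = i + k -
  -- (k - j)` serves when `i` and `k` are confined, and `i + j = i + l + (k - i)` when `i` and `l`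
  -- are.
  have key : |x.i.1 + x.j.1| ≤ 2 * M + max |x.k.1 - x.i.1| |x.k.1 - x.j.1| := by
    have hmA := le_max_left |x.k.1 - x.i.1| |x.k.1 - x.j.1|
    have hmB := le_max_right |x.k.1 - x.i.1| |x.k.1 - x.j.1|
    by_cases hi : x.i.1 = n₁ ∨ x.i.1 = n₂ <;> by_cases hj : x.j.1 = n₁ ∨ x.j.1 = n₂ <;>
    by_cases hk : x.k.1 = n₁ ∨ x.k.1 = n₂ <;> by_cases hl : x.l.1 = n₁ ∨ x.l.1 = n₂
    all_goals first
      | (have h1 := hS _ hi; have h2 := hS _ hj; grind)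
      | (have h1 := hS _ hk; have h2 := hS _ hl; grind)
      | (have h1 := hS _ hi; have h2 := hS _ hk; grind)
      | (have h1 := hS _ hi; have h2 := hS _ hl; grind)
      | (have h1 := hS _ hj; have h2 := hS _ hk; grind)
      | (have h1 := hS _ hj; have h2 := hS _ hl; grind)
      | (exfalso
         refine hcount ?_
         simp only [Quad.normalCount, List.countP_cons, List.countP_nil, decide_eq_true_eq,
           ← not_or]
         split_ifs
         omega)
  -- Both differences are nonzero integers, so their product dominates each of them and the constant
  -- `1`; the latter absorbs the term `2 M`.
  have hmax : max |x.k.1 - x.i.1| |x.k.1 - x.j.1| ≤ |x.k.1 - x.i.1| * |x.k.1 - x.j.1| :=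
    max_le (le_mul_of_one_le_right (by omega) hB1) (le_mul_of_one_le_left (by omega) hA1)
  have h1 : 1 ≤ |x.k.1 - x.i.1| * |x.k.1 - x.j.1| := hA1.trans ((le_max_left _ _).trans hmax)
  nlinarith

/-- The kernel of `F`. -/
def kerF (n₁ n₂ : ℤ) (x : Quad) : ℂ := Complex.I * kerN n₁ n₂ x / (x.divisor : ℂ)

lemma norm_kerF_le (n₁ n₂ : ℤ) (x : Quad) : ‖kerF n₁ n₂ x‖ ≤ 2 * (|n₁| + |n₂| : ℤ) + 1 := by
  have h0 : (0 : ℝ) ≤ 2 * (|n₁| + |n₂| : ℤ) + 1 := by positivity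
  by_cases h : x.Removable n₁ n₂
  · have h1 := h.abs_add_le
    have h2 : |x.total| ≤ (2 * (|n₁| + |n₂| : ℤ) + 1) * |x.divisor| := by
      rw [h.1.divisor_eq, Quad.total, abs_mul, Int.cast_mul, abs_mul, ← Int.cast_abs,
        ← Int.cast_abs]
      have h3 : |(x.i.1 : ℝ) + x.j.1| ≤ (2 * (|n₁| + |n₂| : ℤ) + 1) *
          ((|x.k.1 - x.i.1| : ℤ) * (|x.k.1 - x.j.1| : ℤ)) := by exact_mod_cast h1
      have h4 : (0 : ℝ) ≤ (2 * (|n₁| + |n₂| : ℤ) + 1) *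
          ((|x.k.1 - x.i.1| : ℤ) * (|x.k.1 - x.j.1| : ℤ)) := by positivity
      have h5 : |(-2 : ℝ)| = 2 := by norm_num
      rw [h5]
      linarith
    rw [kerF, norm_div, norm_mul, Complex.norm_I, one_mul, Complex.norm_real, Real.norm_eq_abs,
      div_le_iff₀ (abs_pos.2 h.divisor_ne_zero), kerN, restrictedKernel, if_pos h,
      Complex.norm_real, Real.norm_eq_abs]
    exact div_four_pi_le h2
  · simpa [kerF, kerN, restrictedKernel, h] using h0

/-- The exponent loss is zero because the kernel is bounded. In the exchange symmetry the sign of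
the divisor changes, and so does that of `i` under conjugation; the two cancel, which makes `F`
real. -/
lemma isHamKernel_kerF (n₁ n₂ : ℤ) : IsHamKernel s s (kerF n₁ n₂) where
  momentum x hx := by
    rw [kerF, (isHamKernel_kerN (p := 0) n₁ n₂).momentum x hx]
    simp
  bound := by
    refine ⟨2 * (|n₁| + |n₂| : ℤ) + 1, by positivity, fun x => ?_⟩
    rw [sub_self, Real.rpow_zero, mul_one]
    exact norm_kerF_le n₁ n₂ x
  swapLeft x := by
    have : (Quad.swapLeft x).divisor = x.divisor := by
      simp only [Quad.divisor, Quad.swapLeft, Equiv.coe_fn_mk]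
      ring
    rw [kerF, (isHamKernel_kerN (p := 0) n₁ n₂).swapLeft, this, kerF]
  swapRight x := by
    have : (Quad.swapRight x).divisor = x.divisor := by
      simp only [Quad.divisor, Quad.swapRight, Equiv.coe_fn_mk]
      ring
    rw [kerF, (isHamKernel_kerN (p := 0) n₁ n₂).swapRight, this, kerF]
  exchange x := by
    have : (Quad.exchange x).divisor = -x.divisor := by
      simp only [Quad.divisor, Quad.exchange, Equiv.coe_fn_mk]
      ring
    rw [kerF, (isHamKernel_kerN (p := 0) n₁ n₂).exchange, this, kerF, conj_restrictedKernel,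
      map_div₀, map_mul, conj_restrictedKernel, Complex.conj_I, Complex.conj_ofReal]
    push_cast
    ring

end Kernels

/-! ### Identities between the Hamiltonians -/

section Identities

open scoped ComplexConjugate

variable {a p : ℝ}

lemma isGood_deriv (ha : 0 < a) (hp : 3 / 2 < p) : IsGood a p (p - 1) :=
  ⟨ha.le, by linarith, by linarith, by linarith⟩

lemma isGood_self {s : ℝ} (ha : 0 < a) (hs : 1 / 2 < s) : IsGood a s s :=
  ⟨ha.le, by linarith, le_rfl, hs⟩

lemma summable_kernel_mul_mono {s s' : ℝ} {b : Quad → ℂ} (hb : IsKernel s s' b)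
    (hg : IsGood a s s') (q : Ell a s) : Summable fun x : Quad => b x * x.mono q := by
  refine (hb.summable_quarticTerm hg q q q (incl a hg.le q)).congr fun x => ?_
  simp only [quarticTerm, Quad.mono, incl_coe]
  ring

lemma Quad.mono_swapLeft (x : Quad) (q : Ell a p) : (Quad.swapLeft x).mono q = x.mono q := by
  simp only [Quad.mono, Quad.swapLeft, Equiv.coe_fn_mk]
  ring

lemma Quad.mono_swapRight (x : Quad) (q : Ell a p) : (Quad.swapRight x).mono q = x.mono q := by
  simp only [Quad.mono, Quad.swapRight, Equiv.coe_fn_mk]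
  ring

lemma Quad.mono_exchange (x : Quad) (q : Ell a p) :
    (Quad.exchange x).mono q = conj (x.mono q) := by
  simp only [Quad.mono, Quad.exchange, Equiv.coe_fn_mk, map_mul, Complex.conj_conj]
  ring

lemma rawKernel_of {P : Quad → Prop} {x : Quad} (h : P x) :
    rawKernel P x = ((x.j.1 / (4 * Real.pi) : ℝ) : ℂ) := if_pos h

lemma rawKernel_of_not {P : Quad → Prop} {x : Quad} (h : ¬ P x) : rawKernel P x = 0 := if_neg h

lemma restrictedKernel_of {P : Quad → Prop} {x : Quad} (h : P x) :
    restrictedKernel P x = ((x.total / (4 * Real.pi) : ℝ) : ℂ) := if_pos h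

lemma restrictedKernel_of_not {P : Quad → Prop} {x : Quad} (h : ¬ P x) :
    restrictedKernel P x = 0 := if_neg h

lemma rawKernel_add_swapLeft {P : Quad → Prop} (hP : ∀ x, P (Quad.swapLeft x) ↔ P x) (x : Quad) :
    rawKernel P x + rawKernel P (Quad.swapLeft x) = restrictedKernel P x := by
  by_cases h : P x
  · rw [rawKernel, rawKernel, if_pos h, if_pos ((hP x).2 h), restrictedKernel, if_pos h,
      ← Complex.ofReal_add, ← add_div, Quad.total, add_comm]
    rfl
  · rw [rawKernel, rawKernel, if_neg h, if_neg fun h' => h ((hP x).1 h'), restrictedKernel,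
      if_neg h, add_zero]

/-- Sums with the kernel `j / 4π` are given by the symmetrised Hamiltonian. -/
lemma hasSum_raw_of_ham {P : Quad → Prop} (hg : IsGood a p (p - 1))
    (hP : ∀ x, P x → x.Momentum) (h1 : ∀ x, P (Quad.swapLeft x) ↔ P x)
    (hb : IsHamKernel p (p - 1) (restrictedKernel P)) (q : Ell a p) :
    HasSum (fun x : Quad => rawKernel P x * x.mono q) (ham hb hg q : ℂ) := by
  have h0 := (summable_kernel_mul_mono (isKernel_raw hP) hg q).hasSum
  have h2 := (Quad.swapLeft.hasSum_iff).2 h0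
  have h3 := (h0.add h2).mul_left (1 / 2)
  have h4 := hasSum_ham hb hg q
  have h5 : (ham hb hg q : ℂ) = ∑' x : Quad, rawKernel P x * x.mono q := by
    refine h4.unique (hasSum_of_eq h3 (fun x => ?_) (by ring))
    rw [Function.comp_apply, x.mono_swapLeft, ← rawKernel_add_swapLeft h1]
    ring
  rw [h5]
  exact h0

/-- For a family of resonances parametrised by pairs `(i, j)`, the quartic sum collapses to a double
sum in the `|q_i|² |q_j|²`. -/
lemma hasSum_raw_pairs (hg : IsGood a p (p - 1)) {P : Quad → Prop} (hP : ∀ x, P x → x.Momentum)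
    (e : ZStar × ZStar → Quad) (he : Function.Injective e) (hr : ∀ x, P x → x ∈ Set.range e)
    (hj : ∀ x, (e x).j = x.2) (hm : ∀ x, (e x).mono (a := a) (p := p) =
      fun q => (‖q x.1‖ ^ 2 * ‖q x.2‖ ^ 2 : ℂ))
    (q : Ell a p) (f : ZStar × ZStar → ℝ)
    (hf : ∀ x, P (e x) → f x = x.2.1 * ‖q x.1‖ ^ 2 * ‖q x.2‖ ^ 2) (hf' : ∀ x, ¬ P (e x) → f x = 0) :
    HasSum (fun x : Quad => rawKernel P x * x.mono q)
      ((1 / (4 * Real.pi) * ∑' x, f x : ℝ) : ℂ) := by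
  have h0 := (summable_kernel_mul_mono (isKernel_raw hP) hg q).hasSum
  have h1 := (he.hasSum_iff (f := fun x : Quad => rawKernel P x * x.mono q) fun x hx => by
    rw [rawKernel, if_neg fun h => hx (hr x h), zero_mul]).2 h0
  have h2 : ∀ x, ((1 / (4 * Real.pi) * f x : ℝ) : ℂ) = rawKernel P (e x) * (e x).mono q := by
    intro x
    by_cases h : P (e x)
    · rw [rawKernel, if_pos h, hf x h, hm x, hj x]
      push_cast
      ring
    · rw [rawKernel, if_neg h, hf' x h]
      simp
  have h3 : ((1 / (4 * Real.pi) * ∑' x, f x : ℝ) : ℂ) = ∑' x : Quad, rawKernel P x * x.mono q := by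
    rw [← h1.tsum_eq, ← tsum_mul_left, Complex.ofReal_tsum]
    exact tsum_congr h2
  rw [h3]
  exact h0

lemma hasSum_raw_Gbar (hg : IsGood a p (p - 1)) (q : Ell a p) :
    HasSum (fun x : Quad => rawKernel (fun x => x.k = x.i ∧ x.l = x.j) x * x.mono q)
      (Gbar q : ℂ) := by
  refine hasSum_raw_pairs hg (fun x h => ((x.resonant_iff).2 (Or.inl h)).momentum)
    (fun y => ⟨y.1, y.2, y.1, y.2⟩) (fun y z h => ?_) (fun x h => ⟨(x.i, x.j), ?_⟩) (fun _ => rfl)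
    (fun y => funext fun q => ?_) q _ (fun _ _ => rfl) (fun y h => absurd ⟨rfl, rfl⟩ h)
  · simp only [Quad.mk.injEq] at h
    exact Prod.ext h.1 h.2.1
  · obtain ⟨i, j, k, l⟩ := x
    simp only at h
    rw [h.1, h.2]
  · rw [← Complex.mul_conj', ← Complex.mul_conj', Quad.mono]
    ring

/-- The condition `i ≠ j` removes the quadruples with all components equal, which belong to both
resonance families and are already counted in `Ḡ`. -/
lemma hasSum_raw_offDiag (hg : IsGood a p (p - 1)) (q : Ell a p) :
    HasSum (fun x : Quad => rawKernel (fun x => (x.k = x.j ∧ x.l = x.i) ∧ x.i ≠ x.j) x * x.mono q)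
      (offDiag q : ℂ) := by
  refine hasSum_raw_pairs hg (fun x h => ((x.resonant_iff).2 (Or.inr h.1)).momentum)
    (fun y => ⟨y.1, y.2, y.2, y.1⟩) (fun y z h => ?_) (fun x h => ⟨(x.i, x.j), ?_⟩) (fun _ => rfl)
    (fun y => funext fun q => ?_) q _ (fun y h => if_pos h.2)
    (fun y h => if_neg fun h' => h ⟨⟨rfl, rfl⟩, h'⟩)
  · simp only [Quad.mk.injEq] at h
    exact Prod.ext h.1 h.2.1
  · obtain ⟨i, j, k, l⟩ := x
    simp only at h
    rw [h.1.1, h.1.2]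
  · rw [← Complex.mul_conj', ← Complex.mul_conj', Quad.mono]
    ring

/-- Averaging the kernel `j / 4π` on `k = i, l = j` over the four relabellings generated by the two
swaps does not change the sum. Two of them combine to the kernel `(i + j) / 4π` on this resonance
family, and the other two to the same kernel on the family `k = j, l = i`. -/
lemma Gbar_eq_ham (hg : IsGood a p (p - 1)) :
    Gbar = ham (isHamKernel_kerBar (p := p)) hg := by
  funext q
  have h0 := hasSum_raw_Gbar hg q
  have h1 := (Quad.swapLeft.hasSum_iff).2 h0
  have h2 := (Quad.swapRight.hasSum_iff).2 h0
  have h3 := (Quad.swapRight.hasSum_iff).2 h1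
  have h4 := (((h0.add h1).add h2).add h3).mul_left (1 / 4)
  have h5 := hasSum_ham (isHamKernel_kerBar (p := p)) hg q
  refine Complex.ofReal_injective ?_
  refine (hasSum_of_eq h4 (fun x => ?_) ?_).unique h5
  · have hL : rawKernel (fun x => x.k = x.i ∧ x.l = x.j) x + rawKernel (fun x => x.k = x.i ∧ x.l = x.j)
        (Quad.swapLeft (Quad.swapRight x)) = restrictedKernel (fun x => x.k = x.i ∧ x.l = x.j) x := by
      by_cases h : x.k = x.i ∧ x.l = x.j
      · rw [rawKernel_of h, rawKernel_of (x := Quad.swapLeft (Quad.swapRight x)) ⟨h.2, h.1⟩,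
          restrictedKernel_of h, ← Complex.ofReal_add, ← add_div, add_comm]
        rfl
      · rw [rawKernel_of_not h, rawKernel_of_not (x := Quad.swapLeft (Quad.swapRight x))
          fun h' => h ⟨h'.2, h'.1⟩, restrictedKernel_of_not h, add_zero]
    have hR : rawKernel (fun x => x.k = x.i ∧ x.l = x.j) (Quad.swapLeft x) +
        rawKernel (fun x => x.k = x.i ∧ x.l = x.j) (Quad.swapRight x) =
          restrictedKernel (fun x => x.k = x.j ∧ x.l = x.i) x := by
      by_cases h : x.k = x.j ∧ x.l = x.i
      · rw [rawKernel_of (x := Quad.swapLeft x) h, rawKernel_of (x := Quad.swapRight x) ⟨h.2, h.1⟩,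
          restrictedKernel_of h, ← Complex.ofReal_add, ← add_div]
        rfl
      · rw [rawKernel_of_not (x := Quad.swapLeft x) h, rawKernel_of_not (x := Quad.swapRight x)
          fun h' => h ⟨h'.2, h'.1⟩, restrictedKernel_of_not h, add_zero]
    simp only [Function.comp_apply, Quad.mono_swapLeft, Quad.mono_swapRight]
    rw [kerBar, ← hL, ← hR]
    ring
  · ring

/-- The Hamiltonian that is left in the normal form. -/
lemma hasSum_deltaThree (hg : IsGood a p (p - 1)) (n₁ n₂ : ℤ) (q : Ell a p) :
    HasSum (deltaThreeTerm n₁ n₂ q)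
      ((ham (isHamKernel_kerHat (p := p) n₁ n₂) hg q - offDiag q : ℝ) : ℂ) := by
  have hG := hasSum_raw_of_ham hg (fun _ h => h) Quad.momentum_swapLeft
    (isHamKernel_kerG (p := p)) q
  have hN := hasSum_raw_of_ham hg (fun _ h => h.1) (Quad.removable_swapLeft n₁ n₂)
    (isHamKernel_kerN (p := p) n₁ n₂) q
  have hB := hasSum_raw_Gbar hg q
  have hO := hasSum_raw_offDiag hg q
  have hH := hasSum_ham (isHamKernel_kerHat (p := p) n₁ n₂) hg q
  have hG' := hasSum_ham (isHamKernel_kerG (p := p)) hg q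
  have hN' := hasSum_ham (isHamKernel_kerN (p := p) n₁ n₂) hg q
  have hB' := hasSum_ham (isHamKernel_kerBar (p := p)) hg q
  have hval := hH.unique (hasSum_of_eq ((hG'.sub hB').sub hN') (fun x => by
    rw [kerHat]
    ring) rfl)
  rw [← Gbar_eq_ham hg] at hval
  refine hasSum_of_eq (((hG.sub hB).sub hN).sub hO) (fun x => ?_) ?_
  · have hA := @Quad.Resonant.momentum x
    rw [Quad.resonant_iff] at hA
    have hj : ((1 / (4 * Real.pi) : ℝ) : ℂ) * (x.j.1 : ℂ) = ((x.j.1 / (4 * Real.pi) : ℝ) : ℂ) := by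
      push_cast
      ring
    rw [deltaThreeTerm, hj]
    -- On `i + j = k + l` each quadruple belongs to exactly one class: first resonance family (`Ḡ`),
    -- second family with `i ≠ j`, non-resonant and removed, non-resonant and kept. Only the last
    -- contributes on either side.
    by_cases hM : x.Momentum
    · rw [rawKernel_of hM]
      by_cases h1 : x.k = x.i ∧ x.l = x.j
      · have hres := (x.resonant_iff).2 (Or.inl h1)
        rw [rawKernel_of h1, rawKernel_of_not fun h => h.2.1 hres,
          rawKernel_of_not fun h => h.2 (h1.1.symm.trans h.1.1), if_neg fun h => h.2.1 hres]
        ring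
      · rw [rawKernel_of_not h1]
        by_cases h2 : x.k = x.j ∧ x.l = x.i
        · have h3 : x.i ≠ x.j := fun h => h1 ⟨h2.1.trans h.symm, h2.2.trans h⟩
          have hres := (x.resonant_iff).2 (Or.inr h2)
          rw [rawKernel_of_not fun h => h.2.1 hres, rawKernel_of ⟨h2, h3⟩,
            if_neg fun h => h.2.1 hres]
          ring
        · have hres : ¬ x.Resonant := fun h => ((x.resonant_iff).1 h).elim h1 h2
          rw [rawKernel_of_not (P := fun x : Quad => (x.k = x.j ∧ x.l = x.i) ∧ x.i ≠ x.j) (x := x) fun h => h2 h.1]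
          by_cases h3 : 3 ≤ x.normalCount n₁ n₂
          · rw [rawKernel_of_not fun h => h.2.2 h3, if_pos ⟨hM, hres, h3⟩]
            ring
          · rw [rawKernel_of ⟨hM, hres, h3⟩, if_neg fun h => h3 h.2.2]
            ring
    · rw [rawKernel_of_not hM, rawKernel_of_not fun h => hM (hA (Or.inl h)),
        rawKernel_of_not fun h => hM h.1, rawKernel_of_not fun h => hM (hA (Or.inr h.1)),
        if_neg fun h => hM h.1]
      ring
  · push_cast
    rw [hval]

/-- The sum of the parts of `G`. -/
lemma ham_G_eq (hg : IsGood a p (p - 1)) (n₁ n₂ : ℤ) (q : Ell a p) :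
    ham (isHamKernel_kerG (p := p)) hg q = Gbar q +
      ham (isHamKernel_kerHat (p := p) n₁ n₂) hg q + ham (isHamKernel_kerN (p := p) n₁ n₂) hg q := by
  have hH := hasSum_ham (isHamKernel_kerHat (p := p) n₁ n₂) hg q
  have hG' := hasSum_ham (isHamKernel_kerG (p := p)) hg q
  have hN' := hasSum_ham (isHamKernel_kerN (p := p) n₁ n₂) hg q
  have hB' := hasSum_ham (isHamKernel_kerBar (p := p)) hg q
  have hval := hH.unique (hasSum_of_eq ((hG'.sub hB').sub hN') (fun x => by
    rw [kerHat]
    ring) rfl)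
  rw [Gbar_eq_ham hg]
  have h : ham (isHamKernel_kerHat (p := p) n₁ n₂) hg q = ham (isHamKernel_kerG (p := p)) hg q -
      ham (isHamKernel_kerBar (p := p)) hg q - ham (isHamKernel_kerN (p := p) n₁ n₂) hg q := by
    exact_mod_cast hval
  linarith

/-! ### The quadratic Hamiltonian -/

lemma hasSum_Lam (ha : 0 ≤ a) (hp : 1 ≤ p) (q : Ell a p) :
    HasSum (fun j : ZStar => (j.1 : ℂ) * q j * conj ((j.1 : ℂ) * q j)) (Lam q : ℂ) := by
  have h := hasSum_pair ha (by linarith : 0 ≤ p - 1) (ellDeriv a p q) (ellDeriv a p q)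
  simp only [ellDeriv_coe] at h
  have h1 : (Lam q : ℂ) = pair ha (by linarith : 0 ≤ p - 1) (ellDeriv a p q) (ellDeriv a p q) := by
    rw [← h.tsum_eq, Lam, Complex.ofReal_tsum]
    refine tsum_congr fun j => ?_
    rw [Complex.mul_conj']
    rw [norm_mul, Complex.norm_intCast]
    push_cast
    rw [mul_pow, ← Complex.ofReal_pow, ← Complex.ofReal_pow, sq_abs]
    push_cast
    ring
  rw [h1]
  exact h

/-- Splitting `j²` evenly between the two arguments makes `Λ` a bounded quadratic form on `ℓ^{a,p}`,
hence differentiable there. -/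
lemma Lam_eq (ha : 0 ≤ a) (hp : 0 ≤ p - 1) (q : Ell a p) :
    Lam q = (pair ha hp (ellDeriv a p q) (ellDeriv a p q)).re := by
  have h := hasSum_pair ha hp (ellDeriv a p q) (ellDeriv a p q)
  simp only [ellDeriv_coe] at h
  rw [h.unique (hasSum_Lam ha (by linarith) q), Complex.ofReal_re]

lemma hasFDerivAt_Lam (ha : 0 ≤ a) (hp : 0 ≤ p - 1) (q : Ell a p) :
    ∃ L : Ell a p →L[ℝ] ℝ, HasFDerivAt (Lam (a := a) (p := p)) L q ∧
      ∀ v, L v = 2 * (pair ha hp (ellDeriv a p v) (ellDeriv a p q)).re := by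
  have h0 : HasFDerivAt (fun q => pair ha hp (ellDeriv a p q)) (pair ha hp ∘L ellDeriv a p) q :=
    (pair ha hp ∘L ellDeriv a p).hasFDerivAt
  have h1 := Complex.reCLM.hasFDerivAt.comp q (h0.clm_apply (ellDeriv a p).hasFDerivAt)
  have h2 : (Lam (a := a) (p := p)) =
      Complex.reCLM ∘ fun q => pair ha hp (ellDeriv a p q) (ellDeriv a p q) :=
    funext fun q => Lam_eq ha hp q
  refine ⟨_, h2 ▸ h1, fun v => ?_⟩
  change (pair ha hp (ellDeriv a p q) (ellDeriv a p v) +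
    pair ha hp (ellDeriv a p v) (ellDeriv a p q)).re = _
  rw [Complex.add_re, ← conj_pair ha hp (ellDeriv a p v), Complex.conj_re]
  ring

/-- Multiplication by `l` costs one power of the size, so the derivative of `X_F` is again a
convolution, now with values in `ℓ^{a,p-1}`. -/
lemma isKernel_l_mul_kerF (n₁ n₂ : ℤ) :
    IsKernel p (p - 1) fun x => (x.l.1 : ℂ) * (-Complex.I * kerF n₁ n₂ x) := by
  refine ⟨fun x hx => by simp [(isHamKernel_kerF (s := p) n₁ n₂).momentum x hx],
    2 * (|n₁| + |n₂| : ℤ) + 1, by positivity, fun x => ?_⟩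
  rw [sub_sub_cancel, Real.rpow_one]
  by_cases hM : x.Momentum
  · rw [norm_mul, norm_mul, norm_neg, Complex.norm_I, one_mul, mul_comm]
    have h : ‖(x.l.1 : ℂ)‖ = |(x.l.1 : ℝ)| := by
      rw [← Complex.norm_intCast]
    rw [h]
    exact mul_le_mul (norm_kerF_le n₁ n₂ x) hM.abs_le_size (abs_nonneg _) (by positivity)
  · rw [(isHamKernel_kerF (s := p) n₁ n₂).momentum x hM]
    have := x.one_le_size
    simp only [mul_zero, norm_zero]
    positivity

/-- The homological equation `{Λ, F} = -N`. -/
lemma pair_vf_kerF (ha : 0 < a) (hp : 3 / 2 < p) (hp' : 0 ≤ p - 1) (n₁ n₂ : ℤ) (q : Ell a p) :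
    2 * (pair ha.le hp' (ellDeriv a p
      (cubic (vf (isHamKernel_kerF n₁ n₂) (isGood_self ha (by linarith))) q)) (ellDeriv a p q)).re =
      -ham (isHamKernel_kerN (p := p) n₁ n₂) (isGood_deriv ha hp) q := by
  have hg := isGood_deriv ha hp
  set P := pair ha.le hp' (ellDeriv a p
      (cubic (vf (isHamKernel_kerF n₁ n₂) (isGood_self ha (by linarith))) q)) (ellDeriv a p q)
    with hP
  have e : ellDeriv a p (cubic (vf (isHamKernel_kerF n₁ n₂) (isGood_self ha (by linarith))) q) =
      tri (isKernel_l_mul_kerF n₁ n₂) hg q q q := by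
    refine Ell.ext' fun l => ?_
    rw [ellDeriv_coe, tri_coe, cubic, vf, tri_coe, triSeq, triSeq, ← tsum_mul_left]
    refine tsum_congr fun t => ?_
    ring
  have h0 : HasSum (fun x : Quad => -Complex.I * kerF n₁ n₂ x * (x.l.1 : ℂ) ^ 2 * x.mono q) P := by
    rw [hP, e]
    refine hasSum_of_eq (hasSum_pair_tri (isKernel_l_mul_kerF n₁ n₂) hg q q q (ellDeriv a p q))
      (fun x => ?_) rfl
    simp only [quarticTerm, ellDeriv_coe, Quad.mono, map_mul, map_intCast]
    ring
  have hF := isHamKernel_kerF (s := p) n₁ n₂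
  -- Averaging over `k ↔ l` replaces `l²` by `(k² + l²) / 2`. Adding the conjugate, rewritten by the
  -- exchange symmetry, brings in `i² + j²` with the opposite sign, so the divisor appears and
  -- cancels the denominator of `F`.
  have h1 := (Quad.swapRight.hasSum_iff).2 h0
  have h2 := (h0.add h1).mul_left (1 / 2)
  have h3 := (Quad.exchange.hasSum_iff).2
    (h2.map (starRingEnd ℂ).toAddMonoidHom Complex.continuous_conj)
  have h5 := (hasSum_ham (isHamKernel_kerN (p := p) n₁ n₂) hg q).neg
  have h6 := h5.unique (hasSum_of_eq (h2.add h3) (fun x => ?_) rfl)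
  · have h7 : conj (1 / 2 * (P + P)) = conj P := congrArg _ (by ring)
    change _ = 1 / 2 * (P + P) + conj (1 / 2 * (P + P)) at h6
    rw [h7] at h6
    have h8 := congrArg Complex.re h6
    rw [Complex.add_re, Complex.conj_re, ← Complex.ofReal_neg, Complex.ofReal_re] at h8
    rw [h8, show (1 / 2 * (P + P) : ℂ) = P by ring]
    ring
  · change _ = 1 / 2 * (-Complex.I * kerF n₁ n₂ x * (x.l.1 : ℂ) ^ 2 * x.mono q +
        -Complex.I * kerF n₁ n₂ (Quad.swapRight x) * (x.k.1 : ℂ) ^ 2 *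
          (Quad.swapRight x).mono q) +
      conj (1 / 2 * (-Complex.I * kerF n₁ n₂ (Quad.exchange x) * (x.j.1 : ℂ) ^ 2 *
          (Quad.exchange x).mono q +
        -Complex.I * kerF n₁ n₂ (Quad.swapRight (Quad.exchange x)) * (x.i.1 : ℂ) ^ 2 *
          (Quad.swapRight (Quad.exchange x)).mono q))
    rw [hF.swapRight, hF.swapRight, hF.exchange, x.mono_swapRight, Quad.mono_swapRight,
      x.mono_exchange]
    simp only [map_mul, map_add, map_neg, map_pow, map_intCast, Complex.conj_conj, Complex.conj_I,
      map_div₀, map_one, map_ofNat, neg_neg]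
    have hd : kerF n₁ n₂ x * (x.divisor : ℂ) = Complex.I * kerN n₁ n₂ x := by
      by_cases h : x.Removable n₁ n₂
      · rw [kerF, div_mul_cancel₀]
        exact_mod_cast h.divisor_ne_zero
      · rw [kerF, kerN, restrictedKernel_of_not h]
        simp
    have hd' : (x.divisor : ℂ) = (x.i.1 : ℂ) ^ 2 + (x.j.1 : ℂ) ^ 2 - (x.k.1 : ℂ) ^ 2 -
        (x.l.1 : ℂ) ^ 2 := by
      rw [Quad.divisor]
      push_cast
      rfl
    rw [hd'] at hd
    linear_combination (-Complex.I / 2 * x.mono q) * hd -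
      (kerN n₁ n₂ x * x.mono q / 2) * Complex.I_mul_I

end Identities

/-! ### Tree expansion of the flow -/

section Trees

open scoped ENNReal

/-- Ternary trees. -/
inductive Tree : Type
  | leaf : Tree
  | node : Tree → Tree → Tree → Tree

namespace Tree

/-- The number of inner nodes. -/
def size : Tree → ℕ
  | leaf => 0
  | node a b c => a.size + b.size + c.size + 1

/-- Trees are leaves or triples of trees. -/
def equiv : Unit ⊕ (Tree × Tree × Tree) ≃ Tree where
  toFun
    | Sum.inl _ => leaf
    | Sum.inr t => node t.1 t.2.1 t.2.2
  invFun
    | leaf => Sum.inl ()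
    | node a b c => Sum.inr (a, b, c)
  left_inv := by rintro (_ | _) <;> rfl
  right_inv := by rintro (_ | _) <;> rfl

lemma tsum_eq (f : Tree → ℝ≥0∞) :
    ∑' τ, f τ = f leaf + ∑' t : Tree × Tree × Tree, f (node t.1 t.2.1 t.2.2) := by
  rw [← equiv.tsum_eq, ENNReal.summable.tsum_sum ENNReal.summable]
  simp [equiv]

lemma hasSum_of {E : Type*} [NormedAddCommGroup E] {f : Tree → E} {x : E}
    (h : HasSum (fun t : Tree × Tree × Tree => f (node t.1 t.2.1 t.2.2)) x) :
    HasSum f (f leaf + x) := by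
  rw [← equiv.hasSum_iff]
  refine HasSum.sum (f := f ∘ equiv) ?_ h
  exact hasSum_unique fun _ : Unit => f leaf

/-- The bounds for the terms of the tree expansion. -/
def bound (D r : ℝ≥0∞) : Tree → ℝ≥0∞
  | leaf => r
  | node a b c => D * (a.bound D r * (b.bound D r * c.bound D r))

/-- The bounds, with trees of large depth removed. -/
def boundTrunc (D r : ℝ≥0∞) : ℕ → Tree → ℝ≥0∞
  | 0, _ => 0
  | _ + 1, leaf => r
  | n + 1, node a b c => D * (a.boundTrunc D r n * (b.boundTrunc D r n * c.boundTrunc D r n))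

/-- The number of inner nodes bounds the depth, so the truncation does not affect a tree with fewer
than `n` of them. -/
lemma boundTrunc_eq (D r : ℝ≥0∞) (τ : Tree) :
    ∀ n, τ.size < n → τ.boundTrunc D r n = τ.bound D r := by
  induction τ with
  | leaf =>
    rintro (_ | n) h
    · simp at h
    · rfl
  | node a b c ha hb hc =>
    rintro (_ | n) h
    · simp at h
    · simp only [size] at h
      simp only [boundTrunc, bound, ha n (by omega), hb n (by omega), hc n (by omega)]

/-- Cutting at the root gives the recursion `x ↦ r + D x³`, which preserves `x ≤ 2r` because `D
(2r)³ = 8 D r² · r ≤ r`. -/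
lemma tsum_boundTrunc_le {D r : ℝ≥0∞} (h : 8 * D * r ^ 2 ≤ 1) (n : ℕ) :
    ∑' τ, boundTrunc D r n τ ≤ 2 * r := by
  induction n with
  | zero => simp [boundTrunc]
  | succ n ih =>
    rw [tsum_eq]
    simp only [boundTrunc]
    rw [ENNReal.tsum_mul_left, ENNReal.tsum_prod']
    simp only [ENNReal.tsum_mul_left, ENNReal.tsum_mul_right]
    rw [ENNReal.tsum_prod']
    simp only [ENNReal.tsum_mul_left, ENNReal.tsum_mul_right]
    calc r + _ ≤ r + D * (2 * r * (2 * r * (2 * r))) := by gcongr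
      _ = r + 8 * D * r ^ 2 * r := by ring
      _ ≤ r + 1 * r := by gcongr
      _ = 2 * r := by ring

lemma tsum_bound_le {D r : ℝ≥0∞} (h : 8 * D * r ^ 2 ≤ 1) : ∑' τ, bound D r τ ≤ 2 * r := by
  rw [ENNReal.tsum_eq_iSup_sum]
  refine iSup_le fun S => ?_
  calc ∑ τ ∈ S, bound D r τ = ∑ τ ∈ S, boundTrunc D r (S.sup size + 1) τ :=
        Finset.sum_congr rfl fun τ hτ =>
          (boundTrunc_eq D r τ _ (Nat.lt_succ_of_le (Finset.le_sup hτ))).symm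
    _ ≤ ∑' τ, boundTrunc D r (S.sup size + 1) τ := ENNReal.sum_le_tsum S
    _ ≤ 2 * r := tsum_boundTrunc_le h _

end Tree

/-! ### Picard iteration of a cubic field, resolved into trees. -/

variable {E F W : Type*} [NormedAddCommGroup E] [NormedSpace ℝ E]
  [NormedAddCommGroup F] [NormedSpace ℝ F] [NormedAddCommGroup W] [NormedSpace ℝ W]

/-- The coefficients of the tree expansion of the flow of a cubic vector field. -/
def treeTerm (T : E →L[ℝ] E →L[ℝ] E →L[ℝ] E) (q : E) : Tree → E
  | Tree.leaf => q
  -- The denominator comes from `∫ tⁿ dt`: a tree with `n` inner nodes contributes `tⁿ` times its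
  -- coefficient to the flow line.
  | Tree.node a b c => (1 / ((a.size + b.size + c.size : ℕ) + 1 : ℝ)) •
      T (treeTerm T q a) (treeTerm T q b) (treeTerm T q c)

lemma abs_one_div_succ_le (n : ℕ) : |1 / ((n : ℝ) + 1)| ≤ 1 := by
  have : (0 : ℝ) ≤ n := n.cast_nonneg
  rw [abs_of_nonneg (by positivity), div_le_one (by positivity)]
  linarith

lemma enorm_treeTerm_le {T : E →L[ℝ] E →L[ℝ] E →L[ℝ] E} {q : E} {D r : ℝ} (hT : ‖T‖ ≤ D)
    (hq : ‖q‖ ≤ r) (τ : Tree) :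
    ‖treeTerm T q τ‖ₑ ≤ τ.bound (ENNReal.ofReal D) (ENNReal.ofReal r) := by
  have hD : 0 ≤ D := (norm_nonneg T).trans hT
  induction τ with
  | leaf => simpa [treeTerm, Tree.bound, ← ofReal_norm] using ENNReal.ofReal_le_ofReal hq
  | node a b c ha hb hc =>
    simp only [Tree.bound]
    refine le_trans ?_ (mul_le_mul_right (mul_le_mul' ha (mul_le_mul' hb hc)) _)
    simp only [← ofReal_norm]
    rw [← ENNReal.ofReal_mul (norm_nonneg _), ← ENNReal.ofReal_mul (norm_nonneg _),
      ← ENNReal.ofReal_mul hD]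
    refine ENNReal.ofReal_le_ofReal ?_
    rw [treeTerm, norm_smul, Real.norm_eq_abs]
    calc _ ≤ 1 * (‖T‖ * ‖treeTerm T q a‖ * ‖treeTerm T q b‖ * ‖treeTerm T q c‖) :=
          mul_le_mul (abs_one_div_succ_le _) (norm_trilinear_le T _ _ _) (norm_nonneg _)
            zero_le_one
      _ ≤ 1 * (D * ‖treeTerm T q a‖ * ‖treeTerm T q b‖ * ‖treeTerm T q c‖) := by gcongr
      _ = _ := by ring

/-- The curve `t ↦ t^n v`. -/
def curvePow (n : ℕ) (v : E) : Curve E :=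
  ⟨fun t => (t : ℝ) ^ n • v, by fun_prop⟩

lemma curvePow_apply (n : ℕ) (v : E) (t : unitInterval) : curvePow n v t = (t : ℝ) ^ n • v := rfl

lemma norm_curvePow_le (n : ℕ) (v : E) : ‖curvePow n v‖ ≤ ‖v‖ := by
  rw [ContinuousMap.norm_le _ (norm_nonneg v)]
  intro t
  rw [curvePow_apply, norm_smul, Real.norm_eq_abs, abs_pow, abs_of_nonneg t.2.1]
  exact mul_le_of_le_one_left (norm_nonneg v) (pow_le_one₀ t.2.1 t.2.2)

lemma primitive_curvePow [CompleteSpace E] (n : ℕ) (v : E) :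
    primitive E (curvePow n v) = curvePow (n + 1) ((1 / ((n : ℝ) + 1)) • v) := by
  ext t
  rw [primitive_apply, curvePow_apply]
  have : ∫ s in (0 : ℝ)..t, (curvePow n v).extend s = ∫ s in (0 : ℝ)..t, s ^ n • v := by
    refine intervalIntegral.integral_congr fun s hs => ?_
    rw [Set.uIcc_of_le t.2.1] at hs
    rw [Curve.extend_of_mem _ ⟨hs.1, hs.2.trans t.2.2⟩, curvePow_apply]
  rw [this, intervalIntegral.integral_smul_const, integral_pow, smul_smul]
  congr 1
  simp
  ring

/-- The trilinear map on curves. -/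
lemma curveApp_curvePow (T : E →L[ℝ] E →L[ℝ] E →L[ℝ] F) (k m n : ℕ) (u v w : E) :
    curveApp (curveApp (curveMap T (curvePow k u)) (curvePow m v)) (curvePow n w) =
      curvePow (k + m + n) (T u v w) := by
  ext t
  simp only [curveApp_apply, curveMap_apply, curvePow_apply, map_smul, _root_.smul_apply,
    smul_smul]
  congr 1
  ring

lemma hasSum_bilinear [CompleteSpace W] {ι κ : Type*} (B : E →L[ℝ] F →L[ℝ] W) {f : ι → E}
    {g : κ → F} {x : E} {y : F}
    (hf : Summable fun i => ‖f i‖) (hg : Summable fun i => ‖g i‖) (hx : HasSum f x)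
    (hy : HasSum g y) :
    HasSum (fun t : ι × κ => B (f t.1) (g t.2)) (B x y) ∧
      Summable fun t : ι × κ => ‖B (f t.1) (g t.2)‖ := by
  have h1 : Summable fun t : ι × κ => ‖B (f t.1) (g t.2)‖ := by
    refine Summable.of_nonneg_of_le (fun _ => norm_nonneg _) (fun t => B.le_opNorm₂ _ _)
      (f := fun t : ι × κ => ‖B‖ * ‖f t.1‖ * ‖g t.2‖) ?_
    simp only [mul_assoc]
    exact (hf.mul_of_nonneg hg (fun _ => norm_nonneg _) fun _ => norm_nonneg _).mul_left _
  refine ⟨?_, h1⟩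
  have h2 := h1.of_norm.hasSum
  have h3 := h2.prod_fiberwise fun i => (B (f i)).hasSum hy
  have h4 := ((B.flip y).hasSum hx)
  have : HasSum (fun i => B (f i) y) (B x y) := h4
  rwa [← h3.unique this]

/-- The curves of the tree expansion sum up to an integral curve. -/
lemma isIntegralCurve_tsum [CompleteSpace E] (T : E →L[ℝ] E →L[ℝ] E →L[ℝ] E) (q : E)
    (h : Summable fun τ => ‖treeTerm T q τ‖) :
    IsIntegralCurve T q (∑' τ : Tree, curvePow τ.size (treeTerm T q τ)) := by
  set σ : Tree → Curve E := fun τ => curvePow τ.size (treeTerm T q τ) with hσ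
  have hs : Summable fun τ => ‖σ τ‖ :=
    Summable.of_nonneg_of_le (fun _ => norm_nonneg _) (fun _ => norm_curvePow_le _ _) h
  have hS : HasSum σ (∑' τ, σ τ) := hs.of_norm.hasSum
  set S := ∑' τ, σ τ with hSdef
  have hC : Summable fun τ => ‖curveMap T (σ τ)‖ :=
    Summable.of_nonneg_of_le (fun _ => norm_nonneg _) (fun _ => (curveMap T).le_opNorm _)
      (hs.mul_left _)
  have h1 := hasSum_bilinear curveApp hC hs ((curveMap T).hasSum hS) hS
  have h2 := (hasSum_bilinear curveApp h1.2 hs h1.1 hS).1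
  have h3 := (primitive E).hasSum h2
  -- The primitive of the cubic term of the three subtrees is the curve of the tree that joins them,
  -- so the nodes sum to the integral term. The leaf is the initial value.
  have h4 : HasSum (fun t : Tree × Tree × Tree => σ (Tree.node t.1 t.2.1 t.2.2))
      (primitive E (curveCubic T S)) := by
    rw [← (Equiv.prodAssoc Tree Tree Tree).hasSum_iff]
    refine hasSum_of_eq h3 (fun t => ?_) rfl
    simp only [Function.comp, Equiv.prodAssoc_apply, hσ, curveApp_curvePow, primitive_curvePow,
      Tree.size, treeTerm]
  have h5 := Tree.hasSum_of h4
  rw [IsIntegralCurve]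
  have h6 : σ Tree.leaf = curveConst E q := by
    ext t
    simp [hσ, curvePow_apply, Tree.size, treeTerm]
  rw [h6] at h5
  exact hS.unique h5

lemma summable_treeTerm {T : E →L[ℝ] E →L[ℝ] E →L[ℝ] E} {q : E} {D r : ℝ} (hT : ‖T‖ ≤ D)
    (hq : ‖q‖ ≤ r) (hr : 8 * ENNReal.ofReal D * ENNReal.ofReal r ^ 2 ≤ 1) :
    (Summable fun τ => ‖treeTerm T q τ‖) ∧ ∑' τ, ‖treeTerm T q τ‖ ≤ 2 * r := by
  have hr0 : 0 ≤ r := (norm_nonneg q).trans hq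
  have h1 : ∑' τ, ‖treeTerm T q τ‖ₑ ≤ ENNReal.ofReal (2 * r) := by
    rw [ENNReal.ofReal_mul (by norm_num), ENNReal.ofReal_ofNat]
    exact (ENNReal.tsum_le_tsum (enorm_treeTerm_le hT hq)).trans (Tree.tsum_bound_le hr)
  have h2 : Summable fun τ => ‖treeTerm T q τ‖ := by
    refine summable_of_tsum_enorm_ne_top (F := ℝ) ?_
    simpa only [enorm_norm] using ne_top_of_le_ne_top ENNReal.ofReal_ne_top h1
  refine ⟨h2, ?_⟩
  rw [← ENNReal.ofReal_le_ofReal_iff (by positivity),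
    ENNReal.ofReal_tsum_of_nonneg (fun _ => norm_nonneg _) h2]
  simpa only [ofReal_norm] using h1

/-- Near the origin, the flow is given by the tree expansion. -/
lemma eventually_hasSum_flow [CompleteSpace E] {T : E →L[ℝ] E →L[ℝ] E →L[ℝ] E} {Φ : E → Curve E}
    (hΦ : ∀ᶠ γ in 𝓝 (0 : Curve E), ∀ q, IsIntegralCurve T q γ → γ = Φ q) :
    ∀ᶠ q in 𝓝 (0 : E), HasSum (treeTerm T q) (Φ q 1) := by
  obtain ⟨ε, hε, hball⟩ := Metric.eventually_nhds_iff_ball.1 hΦ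
  have hlim : Filter.Tendsto (fun r : ℝ => 8 * ‖T‖ * r ^ 2) (𝓝 0) (𝓝 0) := by
    have : Continuous fun r : ℝ => 8 * ‖T‖ * r ^ 2 := by fun_prop
    simpa using this.tendsto 0
  have hn : Filter.Tendsto (fun q : E => ‖q‖) (𝓝 0) (𝓝 0) := by
    simpa using (continuous_norm (E := E)).tendsto 0
  filter_upwards [(hlim.comp hn).eventually (gt_mem_nhds zero_lt_one),
    hn.eventually (gt_mem_nhds (half_pos hε))] with q h1 h2
  have h3 : 8 * ENNReal.ofReal ‖T‖ * ENNReal.ofReal ‖q‖ ^ 2 ≤ 1 := by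
    have h4 : (8 : ℝ≥0∞) = ENNReal.ofReal 8 := by simp
    rw [← ENNReal.ofReal_pow (norm_nonneg _), h4, ← ENNReal.ofReal_mul (by norm_num),
      ← ENNReal.ofReal_mul (by positivity), ← ENNReal.ofReal_one]
    exact ENNReal.ofReal_le_ofReal (le_of_lt h1)
  obtain ⟨h4, h5⟩ := summable_treeTerm le_rfl le_rfl h3
  have h6 := isIntegralCurve_tsum T q h4
  have hs : Summable fun τ : Tree => ‖curvePow τ.size (treeTerm T q τ)‖ :=
    Summable.of_nonneg_of_le (fun _ => norm_nonneg _) (fun _ => norm_curvePow_le _ _) h4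
  have h7 : ‖∑' τ : Tree, curvePow τ.size (treeTerm T q τ)‖ < ε := by
    refine (norm_tsum_le_tsum_norm hs).trans_lt ?_
    refine (hs.tsum_le_tsum (fun _ => norm_curvePow_le _ _) h4).trans_lt ?_
    linarith
  -- The sum of the trees is an integral curve of norm at most `2 ‖q‖ < ε`, hence equals the flow
  -- line by uniqueness among small curves.
  have h8 := hball _ (mem_ball_zero_iff.2 h7) q h6
  have h9 := (curveEval (E := E) 1).hasSum hs.of_norm.hasSum
  rw [h8] at h9
  refine hasSum_of_eq h9 (fun τ => ?_) rfl
  simp [curvePow_apply]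

end Trees

/-! ### Absolutely convergent expansions -/

section Expansions

open scoped ENNReal ComplexConjugate

variable {a s s' : ℝ} {b : Quad → ℂ}

/-- Pairs of exponents `(α, β)`. -/
abbrev Expo : Type := (ZStar →₀ ℕ) × (ZStar →₀ ℕ)

/-- The monomial `q^α q̄^β`. -/
def Expo.mono (x : Expo) (q : ZStar → ℂ) : ℂ :=
  (x.1.prod fun n m => q n ^ m) * (x.2.prod fun n m => conj (q n) ^ m)

/-- The momentum `∑ (α_n - β_n) n`. -/
def Expo.momentum (x : Expo) : ℤ :=
  (x.1.sum fun n m => (m : ℤ) * n.1) - (x.2.sum fun n m => (m : ℤ) * n.1)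

/-- The charge `∑ (α_n - β_n)`. -/
def Expo.charge (x : Expo) : ℤ :=
  (x.1.sum fun _ m => (m : ℤ)) - (x.2.sum fun _ m => (m : ℤ))

lemma Expo.mono_add (x y : Expo) (q : ZStar → ℂ) : (x + y).mono q = x.mono q * y.mono q := by
  simp only [Expo.mono, Prod.fst_add, Prod.snd_add]
  rw [Finsupp.prod_add_index' (fun _ => pow_zero _) (fun _ _ _ => pow_add _ _ _),
    Finsupp.prod_add_index' (fun _ => pow_zero _) (fun _ _ _ => pow_add _ _ _)]
  ring

lemma Expo.momentum_add (x y : Expo) : (x + y).momentum = x.momentum + y.momentum := by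
  simp only [Expo.momentum, Prod.fst_add, Prod.snd_add]
  rw [Finsupp.sum_add_index' (fun _ => by simp) (fun _ _ _ => by push_cast; ring),
    Finsupp.sum_add_index' (fun _ => by simp) (fun _ _ _ => by push_cast; ring)]
  ring

lemma Expo.charge_add (x y : Expo) : (x + y).charge = x.charge + y.charge := by
  simp only [Expo.charge, Prod.fst_add, Prod.snd_add]
  rw [Finsupp.sum_add_index' (fun _ => by simp) (fun _ _ _ => by push_cast; ring),
    Finsupp.sum_add_index' (fun _ => by simp) (fun _ _ _ => by push_cast; ring)]
  ring

lemma Expo.mono_swap (x : Expo) (q : ZStar → ℂ) : Expo.mono x.swap q = conj (x.mono q) := by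
  simp only [Expo.mono, Prod.fst_swap, Prod.snd_swap, map_mul, Finsupp.prod, map_prod, map_pow,
    Complex.conj_conj]
  ring

lemma Expo.momentum_swap (x : Expo) : Expo.momentum x.swap = -x.momentum := by
  simp [Expo.momentum]

lemma Expo.charge_swap (x : Expo) : Expo.charge x.swap = -x.charge := by
  simp [Expo.charge]

/-- On `U`, the function `f` is the sum of an absolutely convergent series of monomials of momentum
`m` and charge `g`, and the sum of the absolute values is bounded by `M`. -/
def Expands (U : Set (Ell a s)) (m g : ℤ) (f : Ell a s → ℂ) (M : Ell a s → ℝ≥0∞) : Prop :=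
  ∃ (ι : Type) (w : ι → ℂ) (x : ι → Expo),
    (∀ i, w i ≠ 0 → (x i).momentum = m ∧ (x i).charge = g) ∧
    ∀ q ∈ U, ∑' i, ‖w i * (x i).mono q‖ₑ ≤ M q ∧ HasSum (fun i => w i * (x i).mono q) (f q)

variable {U : Set (Ell a s)} {m g m' g' : ℤ} {f f' : Ell a s → ℂ} {M M' : Ell a s → ℝ≥0∞}

/-! ### Operations on absolutely convergent expansions. -/

lemma Expands.mono (h : Expands U m g f M) (hM : ∀ q ∈ U, M q ≤ M' q) : Expands U m g f M' := by
  obtain ⟨ι, w, x, h1, h2⟩ := h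
  exact ⟨ι, w, x, h1, fun q hq => ⟨(h2 q hq).1.trans (hM q hq), (h2 q hq).2⟩⟩

lemma Expands.congr (h : Expands U m g f M) (hf : ∀ q ∈ U, f' q = f q) : Expands U m g f' M := by
  obtain ⟨ι, w, x, h1, h2⟩ := h
  exact ⟨ι, w, x, h1, fun q hq => ⟨(h2 q hq).1, by rw [hf q hq]; exact (h2 q hq).2⟩⟩

lemma expands_coord (U : Set (Ell a s)) (j : ZStar) :
    Expands U j.1 1 (fun q => q j) (fun q => ‖q j‖ₑ) := by
  have hm : ∀ q : Ell a s, Expo.mono (Finsupp.single j 1, 0) q = q j := fun q => by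
    simp [Expo.mono]
  refine ⟨Unit, fun _ => 1, fun _ => (Finsupp.single j 1, 0), fun _ _ => ?_, fun q _ => ?_⟩
  · simp [Expo.momentum, Expo.charge]
  · simp only [hm, one_mul]
    exact ⟨by simp, hasSum_unique fun _ : Unit => q j⟩

lemma Expands.conj (h : Expands U m g f M) : Expands U (-m) (-g) (fun q => conj (f q)) M := by
  obtain ⟨ι, w, x, h1, h2⟩ := h
  refine ⟨ι, fun i => (starRingEnd ℂ) (w i), fun i => (x i).swap, fun i hi => ?_, fun q hq => ?_⟩
  · rw [Expo.momentum_swap, Expo.charge_swap]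
    have := h1 i fun h => hi (by simp [h])
    exact ⟨by rw [this.1], by rw [this.2]⟩
  · simp only [Expo.mono_swap, ← map_mul]
    refine ⟨?_, Complex.hasSum_conj'.2 (h2 q hq).2⟩
    refine le_trans (le_of_eq (tsum_congr fun i => ?_)) (h2 q hq).1
    rw [← ofReal_norm, ← ofReal_norm, RCLike.norm_conj]

lemma Expands.mul (h : Expands U m g f M) (h' : Expands U m' g' f' M')
    (hM : ∀ q ∈ U, M q ≠ ⊤) (hM' : ∀ q ∈ U, M' q ≠ ⊤) :
    Expands U (m + m') (g + g') (fun q => f q * f' q) (fun q => M q * M' q) := by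
  obtain ⟨ι, w, x, h1, h2⟩ := h
  obtain ⟨κ, v, y, h3, h4⟩ := h'
  refine ⟨ι × κ, fun t => w t.1 * v t.2, fun t => x t.1 + y t.2, fun t ht => ?_, fun q hq => ?_⟩
  · rw [Expo.momentum_add, Expo.charge_add, (h1 _ (left_ne_zero_of_mul ht)).1,
      (h1 _ (left_ne_zero_of_mul ht)).2, (h3 _ (right_ne_zero_of_mul ht)).1,
      (h3 _ (right_ne_zero_of_mul ht)).2]
    exact ⟨rfl, rfl⟩
  · have hterm : ∀ t : ι × κ, w t.1 * v t.2 * (x t.1 + y t.2).mono q =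
        w t.1 * (x t.1).mono q * (v t.2 * (y t.2).mono q) := fun t => by
      rw [Expo.mono_add, mul_mul_mul_comm]
    have hb : ∑' t : ι × κ, ‖w t.1 * v t.2 * (x t.1 + y t.2).mono q‖ₑ ≤ M q * M' q := by
      simp only [hterm, enorm_mul (w _ * _)]
      rw [ENNReal.tsum_prod']
      simp only [ENNReal.tsum_mul_left, ENNReal.tsum_mul_right]
      exact mul_le_mul' (h2 q hq).1 (h4 q hq).1
    refine ⟨hb, ?_⟩
    have hs := summable_of_tsum_enorm_ne_top (ne_top_of_le_ne_top
      (ENNReal.mul_ne_top (hM q hq) (hM' q hq)) hb)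
    simp only [hterm] at hs ⊢
    exact HasSum.mul (f := fun i => w i * (x i).mono q) (g := fun i => v i * (y i).mono q)
      (h2 q hq).2 (h4 q hq).2 hs

/-- The expansion of `f` is required only for `c ≠ 0`: when `c` is a kernel coefficient, momentum
conservation holds only where it does not vanish. For `c = 0` the empty family is used. -/
lemma Expands.const_mul (c : ℂ) (h : c ≠ 0 → Expands U m g f M) :
    Expands U m g (fun q => c * f q) (fun q => ‖c‖ₑ * M q) := by
  by_cases hc : c = 0
  · refine ⟨Empty, fun i => i.elim, fun i => i.elim, fun i => i.elim, fun q _ => ?_⟩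
    simp [hc, hasSum_empty]
  · obtain ⟨ι, w, x, h1, h2⟩ := h hc
    refine ⟨ι, fun i => c * w i, x, fun i hi => h1 i (right_ne_zero_of_mul hi), fun q hq => ?_⟩
    simp only [mul_assoc, enorm_mul c, ENNReal.tsum_mul_left]
    exact ⟨mul_le_mul_right (h2 q hq).1 _, (h2 q hq).2.mul_left c⟩

lemma Expands.tsum {κ : Type} {f : κ → Ell a s → ℂ} {M : κ → Ell a s → ℝ≥0∞}
    {F : Ell a s → ℂ} (h : ∀ k, Expands U m g (f k) (M k))
    (hM : ∀ q ∈ U, ∑' k, M k q ≠ ⊤) (hF : ∀ q ∈ U, HasSum (fun k => f k q) (F q)) :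
    Expands U m g F (fun q => ∑' k, M k q) := by
  choose ι w x h1 h2 using h
  refine ⟨Σ k, ι k, fun t => w t.1 t.2, fun t => x t.1 t.2, fun t => h1 t.1 t.2, fun q hq => ?_⟩
  have hb : ∑' t : Σ k, ι k, ‖w t.1 t.2 * (x t.1 t.2).mono q‖ₑ ≤ ∑' k, M k q := by
    rw [ENNReal.tsum_sigma']
    exact ENNReal.tsum_le_tsum fun k => (h2 k q hq).1
  refine ⟨hb, ?_⟩
  have hs := (summable_of_tsum_enorm_ne_top (ne_top_of_le_ne_top (hM q hq) hb)).hasSum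
  have h3 := hs.sigma fun k => (h2 k q hq).2
  rwa [h3.unique (hF q hq)] at hs

lemma Expands.add (h : Expands U m g f M) (h' : Expands U m g f' M') :
    Expands U m g (fun q => f q + f' q) (fun q => M q + M' q) := by
  obtain ⟨ι, w, x, h1, h2⟩ := h
  obtain ⟨κ, v, y, h3, h4⟩ := h'
  refine ⟨ι ⊕ κ, Sum.elim w v, Sum.elim x y, ?_, fun q hq => ⟨?_, ?_⟩⟩
  · rintro (i | i)
    exacts [h1 i, h3 i]
  · rw [ENNReal.summable.tsum_sum ENNReal.summable]
    exact add_le_add (h2 q hq).1 (h4 q hq).1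
  · exact HasSum.sum (h2 q hq).2 (h4 q hq).2

lemma Expands.neg (h : Expands U m g f M) : Expands U m g (fun q => -f q) M := by
  obtain ⟨ι, w, x, h1, h2⟩ := h
  refine ⟨ι, fun i => -w i, x, fun i hi => h1 i (neg_ne_zero.1 hi), fun q hq => ?_⟩
  simp only [neg_mul, enorm_neg]
  exact ⟨(h2 q hq).1, (h2 q hq).2.neg⟩

/-- Absolute convergence permits collecting all terms with the same exponents; the resulting
coefficients do not depend on `q`. -/
lemma Expands.inClassA {K : Ell a s → ℝ} (h : Expands U 0 0 (fun q => (K q : ℂ)) M) :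
    InClassA K U := by
  obtain ⟨ι, w, x, h1, h2⟩ := h
  refine ⟨fun y => ∑' i : {i // x i = y}, w i, fun q hq => ?_, fun y hy => ?_, fun y hy => ?_⟩
  · have h3 := (Equiv.sigmaFiberEquiv x).hasSum_iff.2 (h2 q hq).2
    have h4 := h3.sigma fun y => (h3.summable.sigma_factor y).hasSum
    refine hasSum_of_eq h4 (fun y => ?_) rfl
    have h5 : ∀ i : {i // x i = y}, w i * (x i).mono q = w i * Expo.mono y q := fun i => by rw [i.2]
    -- A non-summable fibre of coefficients has the default sum zero. The common factor can still be
    -- pulled out: if nonzero it preserves non-summability, and if zero both sides vanish.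
    simp only [Function.comp, Equiv.sigmaFiberEquiv_apply, h5, tsum_mul_right]
    rw [mul_assoc]
    rfl
  · have h3 : ∀ i : {i // x i = y}, w i = 0 := fun i => by
      by_contra hi
      have h4 := (h1 i hi).1
      rw [i.2] at h4
      exact hy h4
    simp [h3]
  · have h3 : ∀ i : {i // x i = y}, w i = 0 := fun i => by
      by_contra hi
      have h4 := (h1 i hi).2
      rw [i.2] at h4
      exact hy h4
    simp [h3]

/-! ### Expansions of the flow and of the Hamiltonians -/

/-- A majorant of the entries of the terms of the tree expansion. -/
def treeMaj (b : Quad → ℂ) (q : Ell a s) : Tree → ZStar → ℝ≥0∞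
  | Tree.leaf => fun n => ‖q n‖ₑ
  | Tree.node t₁ t₂ t₃ =>
    convSeq (fun x => ‖b x‖ₑ) (treeMaj b q t₁) (treeMaj b q t₂) (treeMaj b q t₃)

/-- A majorant of the entries of the flow. -/
def flowMaj (b : Quad → ℂ) (q : Ell a s) (n : ZStar) : ℝ≥0∞ := ∑' τ, treeMaj b q τ n

/-- The constant is enlarged to be at least 1, so that `D ≤ d²` and the bounds of all trees are
nonzero for `r > 0`; both are needed to sum over trees. -/
lemma ennormSq_treeMaj_le (hb : IsKernel s s b) (hg : IsGood a s s) :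
    ∃ d : ℝ, 1 ≤ d ∧ ∀ (q : Ell a s) (r : ℝ), ‖q‖ ≤ r → ∀ τ,
      ennormSq a s (treeMaj b q τ) ≤ τ.bound (ENNReal.ofReal d) (ENNReal.ofReal r) ^ 2 := by
  obtain ⟨C, hC, hCb⟩ := hb.bound
  set D : ℝ≥0∞ := ENNReal.ofReal (C * 3 ^ s) ^ 2 * (27 * embConst s ^ 2) with hD
  have hDt : D ≠ ⊤ := ENNReal.mul_ne_top (ENNReal.pow_ne_top ENNReal.ofReal_ne_top)
    (ENNReal.mul_ne_top (by norm_num) (ENNReal.pow_ne_top (embConst_ne_top hg.half_lt)))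
  refine ⟨D.toReal + 1, by linarith [D.toReal_nonneg], fun q r hq τ => ?_⟩
  have hD2 : D ≤ ENNReal.ofReal (D.toReal + 1) ^ 2 := by
    rw [ENNReal.ofReal_add ENNReal.toReal_nonneg zero_le_one, ENNReal.ofReal_toReal hDt,
      ENNReal.ofReal_one]
    calc D ≤ D + 1 := le_self_add
      _ ≤ (D + 1) ^ 2 := le_self_pow₀ le_add_self two_ne_zero
  induction τ with
  | leaf =>
    simp only [treeMaj, Tree.bound]
    rw [ennormSq_coe, ← ENNReal.ofReal_pow ((norm_nonneg q).trans hq)]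
    exact ENNReal.ofReal_le_ofReal (by gcongr)
  | node t₁ t₂ t₃ h₁ h₂ h₃ =>
    simp only [treeMaj, Tree.bound]
    refine (ennormSq_convSeq_le hg.a_nonneg hg.nonneg hg.le hC (fun x hx => ?_) (fun x => ?_)
      _ _ _).trans ?_
    · simp [hb.momentum x hx]
    · rw [← ofReal_norm]
      exact ENNReal.ofReal_le_ofReal (hCb x)
    · rw [← hD]
      calc _ ≤ ENNReal.ofReal (D.toReal + 1) ^ 2 * (t₁.bound _ _ ^ 2 * t₂.bound _ _ ^ 2 *
            t₃.bound _ _ ^ 2) := mul_le_mul' hD2 (mul_le_mul' (mul_le_mul' h₁ h₂) h₃)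
        _ = _ := by ring

/-- Cauchy-Schwarz in the form `(∑ Y_i)² ≤ (∑ Y_i² / B_i) (∑ B_i)` takes the place of Minkowski's
inequality; it requires nonzero `B_i`. -/
lemma ennormSq_tsum_ne_top {ι : Type*} {Y : ι → ZStar → ℝ≥0∞} {B : ι → ℝ≥0∞}
    (h0 : ∀ i, B i ≠ 0) (hB : ∑' i, B i ≠ ⊤) (h : ∀ i, ennormSq a s (Y i) ≤ B i ^ 2) :
    ennormSq a s (fun n => ∑' i, Y i n) ≠ ⊤ := by
  have ht : ∀ i, B i ≠ ⊤ := fun i => ne_top_of_le_ne_top hB (ENNReal.le_tsum i)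
  refine ne_top_of_le_ne_top (ENNReal.mul_ne_top hB hB) ?_
  calc ennormSq a s (fun n => ∑' i, Y i n)
      ≤ ∑' n, (∑' i, (ENNReal.ofReal (weight a s n) * Y i n) ^ 2 / B i) * ∑' i, B i := by
        refine ENNReal.tsum_le_tsum fun n => ?_
        rw [← ENNReal.tsum_mul_left]
        have h1 := tsum_mul_sq_le B fun i => (ENNReal.ofReal (weight a s n) * Y i n) / B i
        simp only [ENNReal.mul_div_cancel (h0 _) (ht _)] at h1
        refine h1.trans (mul_le_mul_left (ENNReal.tsum_le_tsum fun i => le_of_eq ?_) _)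
        rw [sq, ← mul_assoc, ENNReal.mul_div_cancel (h0 _) (ht _), sq]
        simp only [div_eq_mul_inv, mul_assoc]
    _ = (∑' i, ennormSq a s (Y i) / B i) * ∑' i, B i := by
        rw [ENNReal.tsum_mul_right, ENNReal.tsum_comm]
        simp only [ennormSq, div_eq_mul_inv, ENNReal.tsum_mul_right]
    _ ≤ (∑' i, B i) * ∑' i, B i := by
        refine mul_le_mul_left (ENNReal.tsum_le_tsum fun i => ?_) _
        refine ENNReal.div_le_of_le_mul ((h i).trans (le_of_eq (sq _)))

lemma Tree.bound_ne_zero {D r : ℝ≥0∞} (hD : D ≠ 0) (hr : r ≠ 0) (τ : Tree) : τ.bound D r ≠ 0 := by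
  induction τ with
  | leaf => exact hr
  | node t₁ t₂ t₃ h₁ h₂ h₃ => exact mul_ne_zero hD (mul_ne_zero h₁ (mul_ne_zero h₂ h₃))

lemma exists_flowMaj_ne_top (hb : IsKernel s s b) (hg : IsGood a s s) :
    ∃ r : ℝ, 0 < r ∧ ∀ q : Ell a s, ‖q‖ ≤ r →
      (∀ τ, ennormSq a s (treeMaj b q τ) ≠ ⊤) ∧ ennormSq a s (flowMaj b q) ≠ ⊤ := by
  obtain ⟨d, hd, h⟩ := ennormSq_treeMaj_le (a := a) hb hg
  -- With this radius `8 d r² = 1 / (8 d) ≤ 1`, which is the convergence condition for the sum over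
  -- trees.
  have hr : 0 < 1 / (8 * d) := by positivity
  refine ⟨1 / (8 * d), hr, fun q hq => ?_⟩
  have h8 : 8 * ENNReal.ofReal d * ENNReal.ofReal (1 / (8 * d)) ^ 2 ≤ 1 := by
    have h4 : (8 : ℝ≥0∞) = ENNReal.ofReal 8 := by simp
    rw [← ENNReal.ofReal_pow hr.le, h4, ← ENNReal.ofReal_mul (by norm_num),
      ← ENNReal.ofReal_mul (by positivity), ← ENNReal.ofReal_one]
    refine ENNReal.ofReal_le_ofReal ?_
    have : 8 * d * (1 / (8 * d)) ^ 2 = 1 / (8 * d) := by field_simp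
    rw [this, div_le_one (by positivity)]
    linarith
  have hB := Tree.tsum_bound_le h8
  have hBt : ∑' τ, Tree.bound (ENNReal.ofReal d) (ENNReal.ofReal (1 / (8 * d))) τ ≠ ⊤ :=
    ne_top_of_le_ne_top (ENNReal.mul_ne_top (by norm_num) ENNReal.ofReal_ne_top) hB
  refine ⟨fun τ => ne_top_of_le_ne_top (ENNReal.pow_ne_top ?_) (h q _ hq τ),
    ennormSq_tsum_ne_top (fun τ => Tree.bound_ne_zero ?_ ?_ τ) hBt (h q _ hq)⟩
  · exact ne_top_of_le_ne_top hBt (ENNReal.le_tsum τ)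
  · exact (ENNReal.ofReal_pos.2 (by linarith)).ne'
  · exact (ENNReal.ofReal_pos.2 hr).ne'

/-- A sequence in `ℓ^{a,s}` with prescribed absolute values. -/
lemma exists_ell_enorm_eq {u : ZStar → ℝ≥0∞} (h : ennormSq a s u ≠ ⊤) :
    ∃ y : Ell a s, ∀ n, ‖y n‖ₑ = u n := by
  have h1 : ∀ n, ‖((u n).toReal : ℂ)‖ₑ = u n := fun n => by
    rw [← ofReal_norm, Complex.norm_real, Real.norm_of_nonneg ENNReal.toReal_nonneg,
      ENNReal.ofReal_toReal (ne_top_of_ennormSq_ne_top h n)]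
  refine ⟨Ell.mk (fun n => ((u n).toReal : ℂ)) (mem_of_ennormSq_ne_top ?_), h1⟩
  simpa only [h1] using h

/-- A node multiplies two entries and one conjugated entry: momenta add to `i + j - k = l` and
charges to `1 + 1 - 1 = 1`. -/
lemma expands_treeTerm (hb : IsKernel s s b) (hg : IsGood a s s)
    (hU : ∀ q ∈ U, ∀ τ, ennormSq a s (treeMaj b q τ) ≠ ⊤) (τ : Tree) :
    ∀ j : ZStar, Expands U j.1 1 (fun q => (treeTerm (tri hb hg) q τ : Ell a s) j)
      (fun q => treeMaj b q τ j) := by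
  have ht : ∀ q ∈ U, ∀ τ n, treeMaj b q τ n ≠ ⊤ := fun q hq τ n =>
    ne_top_of_ennormSq_ne_top (hU q hq τ) n
  induction τ with
  | leaf => exact fun j => expands_coord U j
  | node t₁ t₂ t₃ h₁ h₂ h₃ =>
    intro j
    set c : ℝ := 1 / ((t₁.size + t₂.size + t₃.size : ℕ) + 1 : ℝ) with hc
    have hsum : Expands U j.1 1 (fun q => triSeq b (treeTerm (tri hb hg) q t₁ : Ell a s)
        (treeTerm (tri hb hg) q t₂ : Ell a s) (treeTerm (tri hb hg) q t₃ : Ell a s) j)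
        (fun q => treeMaj b q (Tree.node t₁ t₂ t₃) j) := by
      refine Expands.tsum (fun t => ?_) (fun q hq => ht q hq (Tree.node t₁ t₂ t₃) j) (fun q _ =>
        (hb.summable hg _ _ _ j).hasSum)
      refine Expands.const_mul _ fun hbt => ?_
      have hm : (quadOf t j).Momentum := by
        by_contra h
        exact hbt (hb.momentum _ h)
      have hm' : j.1 = t.1.1 + t.2.1.1 + -t.2.2.1 := by
        simp only [Quad.Momentum] at hm
        omega
      rw [hm']
      exact ((h₁ t.1).mul (h₂ t.2.1) (fun q hq => ht q hq _ _) fun q hq => ht q hq _ _).mul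
        (h₃ t.2.2).conj (fun q hq => ENNReal.mul_ne_top (ht q hq _ _) (ht q hq _ _))
        fun q hq => ht q hq _ _
    have h4 := (Expands.const_mul (c : ℂ) fun _ => hsum)
    refine (h4.mono fun q _ => ?_).congr fun q _ => ?_
    · refine mul_le_of_le_one_left' ?_
      rw [← ofReal_norm, Complex.norm_real, Real.norm_eq_abs, ← ENNReal.ofReal_one]
      exact ENNReal.ofReal_le_ofReal (abs_one_div_succ_le _)
    · change (c • tri hb hg _ _ _ : Ell a s) j = _
      rw [Ell.smul_coe, tri_coe]

/-- The entry of a sequence as a continuous linear function. -/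
def coordCLM (a s : ℝ) (j : ZStar) : Ell a s →L[ℝ] ℂ :=
  LinearMap.mkContinuous
    { toFun := fun q => q j
      map_add' := fun _ _ => rfl
      map_smul' := fun c q => Ell.smul_coe c q j } (weight a s j)⁻¹ fun q => by
    rw [inv_mul_eq_div, le_div_iff₀ (weight_pos a s j), mul_comm]
    exact norm_coe_le q j

/-- The entries of the flow. -/
lemma expands_flow {Θ : Ell a s → Ell a s} (hb : IsKernel s s b) (hg : IsGood a s s)
    (hU : ∀ q ∈ U, (∀ τ, ennormSq a s (treeMaj b q τ) ≠ ⊤) ∧ ennormSq a s (flowMaj b q) ≠ ⊤)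
    (hΘ : ∀ q ∈ U, HasSum (treeTerm (tri hb hg) q) (Θ q)) (j : ZStar) :
    Expands U j.1 1 (fun q => Θ q j) (fun q => flowMaj b q j) :=
  Expands.tsum (expands_treeTerm hb hg (fun q hq => (hU q hq).1) · j)
    (fun q hq => ne_top_of_ennormSq_ne_top (hU q hq).2 j)
    fun q hq => by
      have h := (coordCLM a s j).hasSum (hΘ q hq)
      exact h

lemma tsum_enorm_ne_top_of_summable {ι : Type*} {f : ι → ℂ} (h : Summable f) :
    ∑' i, ‖f i‖ₑ ≠ ⊤ :=
  tsum_enorm_ne_top_iff_summable_nnnorm.2 (NNReal.summable_coe.1 h.norm)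

/-- Finiteness of the majorant series follows by evaluating the same quadratic form at a sequence
`y` of `ℓ^{a,s}` whose absolute values are the majorant `Y`. The quartic Hamiltonians below are
treated in the same way. -/
lemma expands_Lam {Θ : Ell a s → Ell a s} {Y : Ell a s → ZStar → ℝ≥0∞} (ha : 0 ≤ a) (hs : 1 ≤ s)
    (hY : ∀ q ∈ U, ennormSq a s (Y q) ≠ ⊤)
    (hΘ : ∀ j : ZStar, Expands U j.1 1 (fun q => Θ q j) (fun q => Y q j)) :
    ∃ M, Expands U 0 0 (fun q => (Lam (Θ q) : ℂ)) M := by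
  have ht : ∀ q ∈ U, ∀ n, Y q n ≠ ⊤ := fun q hq n => ne_top_of_ennormSq_ne_top (hY q hq) n
  refine ⟨_, Expands.tsum (f := fun j q => (j.1 : ℂ) * Θ q j * conj ((j.1 : ℂ) * Θ q j))
    (M := fun j q => ‖(j.1 : ℂ)‖ₑ * Y q j * (‖(j.1 : ℂ)‖ₑ * Y q j)) (fun j => ?_) (fun q hq => ?_)
    fun q _ => hasSum_Lam ha hs (Θ q)⟩
  · have h1 := Expands.const_mul (j.1 : ℂ) fun _ => hΘ j
    have h2 := h1.mul h1.conj (fun q hq => ENNReal.mul_ne_top enorm_ne_top (ht q hq j))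
      (fun q hq => ENNReal.mul_ne_top enorm_ne_top (ht q hq j))
    rwa [add_neg_cancel, add_neg_cancel] at h2
  · obtain ⟨y, hy⟩ := exists_ell_enorm_eq (hY q hq)
    have h := tsum_enorm_ne_top_of_summable (hasSum_Lam ha hs y).summable
    simpa only [enorm_mul, RCLike.enorm_conj, hy] using h

lemma expands_ham {s' : ℝ} {Θ : Ell a s → Ell a s} {Y : Ell a s → ZStar → ℝ≥0∞}
    (hb : IsHamKernel s s' b) (hg : IsGood a s s') (hY : ∀ q ∈ U, ennormSq a s (Y q) ≠ ⊤)
    (hΘ : ∀ j : ZStar, Expands U j.1 1 (fun q => Θ q j) (fun q => Y q j)) :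
    ∃ M, Expands U 0 0 (fun q => (ham hb hg (Θ q) : ℂ)) M := by
  have ht : ∀ q ∈ U, ∀ n, Y q n ≠ ⊤ := fun q hq n => ne_top_of_ennormSq_ne_top (hY q hq) n
  refine ⟨_, Expands.tsum (f := fun x q => 1 / 2 * (b x * x.mono (Θ q)))
    (M := fun x q => ‖(1 / 2 : ℂ)‖ₑ * (‖b x‖ₑ * (Y q x.i * Y q x.j * Y q x.k * Y q x.l)))
    (fun x => ?_) (fun q hq => ?_) fun q _ => hasSum_ham hb hg (Θ q)⟩
  · refine Expands.const_mul _ fun _ => Expands.const_mul _ fun hbx => ?_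
    have hm : x.Momentum := by
      by_contra h
      exact hbx (hb.momentum _ h)
    have hm' : (0 : ℤ) = x.i.1 + x.j.1 + -x.k.1 + -x.l.1 := by
      simp only [Quad.Momentum] at hm
      omega
    have h1 := (hΘ x.i).mul (hΘ x.j) (fun q hq => ht q hq _) fun q hq => ht q hq _
    have h2 := h1.mul (hΘ x.k).conj (fun q hq => ENNReal.mul_ne_top (ht q hq _) (ht q hq _))
      fun q hq => ht q hq _
    have h3 := h2.mul (hΘ x.l).conj (fun q hq => ENNReal.mul_ne_top (ENNReal.mul_ne_top
      (ht q hq _) (ht q hq _)) (ht q hq _)) fun q hq => ht q hq _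
    rwa [← hm'] at h3
  · obtain ⟨y, hy⟩ := exists_ell_enorm_eq (hY q hq)
    have h := tsum_enorm_ne_top_of_summable (summable_kernel_mul_mono hb.toIsKernel hg y)
    rw [ENNReal.tsum_mul_left]
    refine ENNReal.mul_ne_top enorm_ne_top ?_
    simpa only [Quad.mono, enorm_mul, RCLike.enorm_conj, hy] using h

lemma ennormSq_coe_ne_top (q : Ell a s) : ennormSq a s (fun n => ‖q n‖ₑ) ≠ ⊤ := by
  rw [ennormSq_coe]
  exact ENNReal.ofReal_ne_top

end Expansions

/-! ### The quartic Hamiltonian in Fourier coefficients -/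

section Fourier

open scoped ComplexConjugate ENNReal

variable {a p s : ℝ}

lemma summable_norm_coe (ha : 0 ≤ a) (hs : 1 / 2 < s) (q : Ell a s) :
    Summable fun n => ‖q n‖ := by
  have h1 := tsum_weight_zero_sq_le a s fun n => ‖q n‖ₑ
  have h2 : (∑' n, ENNReal.ofReal (weight a 0 n) * ‖q n‖ₑ) ^ 2 ≠ ⊤ :=
    ne_top_of_le_ne_top (ENNReal.mul_ne_top (embConst_ne_top hs) (ennormSq_coe_ne_top q)) h1
  have h3 : ∑' n, ENNReal.ofReal (weight a 0 n) * ‖q n‖ₑ ≠ ⊤ := fun h => h2 (by simp [h])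
  have h4 : ∑' n, ‖q n‖ₑ ≠ ⊤ := by
    refine ne_top_of_le_ne_top h3 (ENNReal.tsum_le_tsum fun n => ?_)
    refine le_mul_of_one_le_left' ?_
    rw [← ENNReal.ofReal_one]
    exact ENNReal.ofReal_le_ofReal (one_le_weight ha le_rfl n)
  exact NNReal.summable_coe.2 (tsum_enorm_ne_top_iff_summable_nnnorm.1 h4)

/-- The constant `(2π)^{-1/2}`. -/
abbrev fourierConst : ℝ := Real.sqrt (1 / (2 * Real.pi))

/-- The function `φ_j`. -/
def fourierMode (j : ZStar) (x : ℝ) : ℂ := (fourierConst : ℝ) * Complex.exp (Complex.I * j.1 * x)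

lemma fourierConst_pow_four : fourierConst ^ 4 * (2 * Real.pi) = 1 / (2 * Real.pi) := by
  have h : (0 : ℝ) ≤ 1 / (2 * Real.pi) := by positivity
  have h1 : fourierConst ^ 4 = (fourierConst ^ 2) ^ 2 := by ring
  rw [h1, fourierConst, Real.sq_sqrt h]
  have := Real.pi_ne_zero
  field_simp

lemma norm_exp_I_mul (n : ℤ) (x : ℝ) : ‖Complex.exp (Complex.I * n * x)‖ = 1 := by
  have : Complex.I * n * x = ((n * x : ℝ) : ℂ) * Complex.I := by
    push_cast
    ring
  rw [this, Complex.norm_exp_ofReal_mul_I]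

lemma norm_fourierMode (j : ZStar) (x : ℝ) : ‖fourierMode j x‖ = fourierConst := by
  rw [fourierMode, norm_mul, norm_exp_I_mul, mul_one, Complex.norm_real,
    Real.norm_of_nonneg (Real.sqrt_nonneg _)]

lemma hasDerivAt_fourierMode (j : ZStar) (x : ℝ) :
    HasDerivAt (fourierMode j) (Complex.I * j.1 * fourierMode j x) x := by
  have h1 : HasDerivAt (fun y : ℝ => Complex.I * j.1 * (y : ℂ)) (Complex.I * j.1) x := by
    simpa using ((hasDerivAt_id (x : ℂ)).comp_ofReal.const_mul (Complex.I * (j.1 : ℂ)))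
  have h2 := (h1.cexp).const_mul ((fourierConst : ℝ) : ℂ)
  refine h2.congr_deriv ?_
  rw [fourierMode]
  ring

lemma summable_norm_mul_fourierMode {c : ZStar → ℂ} (hc : Summable fun n => ‖c n‖) (x : ℝ) :
    Summable fun j => ‖c j * fourierMode j x‖ := by
  simp only [norm_mul, norm_fourierMode]
  exact hc.mul_right _

lemma hasSum_fourierSum (ha : 0 ≤ a) (hp : 1 / 2 < p) (q : Ell a p) (x : ℝ) :
    HasSum (fun j => q j * fourierMode j x) (fourierSum q x) :=
  (summable_norm_mul_fourierMode (summable_norm_coe ha hp q) x).of_norm.hasSum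

/-- The sequence `n q_n` lies in `ℓ^{a,p-1}`, which embeds into `ℓ¹` as `p - 1 > 1/2`. Hence `u` may
be differentiated termwise. -/
lemma summable_norm_deriv (ha : 0 ≤ a) (hp : 3 / 2 < p) (q : Ell a p) :
    Summable fun j : ZStar => ‖Complex.I * j.1 * q j‖ := by
  refine (summable_norm_coe ha (by linarith) (ellDeriv a p q)).congr fun j => ?_
  simp [ellDeriv_coe]

lemma hasSum_deriv_fourierSum (ha : 0 ≤ a) (hp : 3 / 2 < p) (q : Ell a p) (x : ℝ) :
    HasSum (fun j : ZStar => Complex.I * j.1 * q j * fourierMode j x) (deriv (fourierSum q) x) := by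
  have hs := summable_norm_deriv ha hp q
  have h1 : HasDerivAt (fourierSum q) (∑' j : ZStar, Complex.I * j.1 * q j * fourierMode j x) x := by
    refine hasDerivAt_tsum (u := fun j : ZStar => ‖Complex.I * j.1 * q j‖ * fourierConst)
      (g := fun j y => q j * fourierMode j y)
      (g' := fun j y => Complex.I * j.1 * q j * fourierMode j y) (hs.mul_right _) (fun j y => ?_)
      (fun j y => ?_) (y₀ := 0) ?_ x
    · exact ((hasDerivAt_fourierMode j y).const_mul (q j)).congr_deriv (by ring)
    · rw [norm_mul, norm_fourierMode]
    · exact (hasSum_fourierSum ha (by linarith) q 0).summable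
  rw [h1.deriv]
  exact (summable_norm_mul_fourierMode hs x).of_norm.hasSum

/-- Quadruples as pairs of pairs. -/
def pairsEquiv : (ZStar × ZStar) × (ZStar × ZStar) ≃ Quad where
  toFun t := ⟨t.1.1, t.1.2, t.2.1, t.2.2⟩
  invFun x := ((x.i, x.j), (x.k, x.l))
  left_inv _ := rfl
  right_inv _ := rfl

instance : Countable Quad := pairsEquiv.symm.injective.countable

lemma hasSum_mul_mul_mul {f g h k : ZStar → ℂ} {x y z w : ℂ} (hf : Summable fun n => ‖f n‖)
    (hg : Summable fun n => ‖g n‖) (hh : Summable fun n => ‖h n‖) (hk : Summable fun n => ‖k n‖)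
    (hx : HasSum f x) (hy : HasSum g y) (hz : HasSum h z) (hw : HasSum k w) :
    HasSum (fun t : Quad => f t.i * g t.j * (h t.k * k t.l)) (x * y * (z * w)) ∧
      Summable fun t : Quad => ‖f t.i * g t.j * (h t.k * k t.l)‖ := by
  have h1 := hasSum_bilinear (ContinuousLinearMap.mul ℝ ℂ) hf hg hx hy
  have h2 := hasSum_bilinear (ContinuousLinearMap.mul ℝ ℂ) hh hk hz hw
  have h3 := hasSum_bilinear (ContinuousLinearMap.mul ℝ ℂ) h1.2 h2.2 h1.1 h2.1
  rw [← pairsEquiv.hasSum_iff, ← pairsEquiv.summable_iff]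
  exact h3

lemma integral_exp_I_mul (n : ℤ) :
    ∫ x in (0 : ℝ)..(2 * Real.pi), Complex.exp (Complex.I * n * x) =
      if n = 0 then ((2 * Real.pi : ℝ) : ℂ) else 0 := by
  split_ifs with h
  · simp [h]
  · have hn : Complex.I * (n : ℂ) ≠ 0 := mul_ne_zero Complex.I_ne_zero (by exact_mod_cast h)
    rw [integral_exp_mul_complex hn]
    have : Complex.I * n * ((2 * Real.pi : ℝ) : ℂ) = n * (2 * Real.pi * Complex.I) := by
      push_cast
      ring
    rw [this, Complex.exp_int_mul_two_pi_mul_I]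
    simp

/-- The quartic Hamiltonian `G` in terms of the Fourier coefficients. -/
lemma G_eq_ham (ha : 0 < a) (hp : 3 / 2 < p) (hg : IsGood a p (p - 1)) (q : Ell a p) :
    G q = (ham (isHamKernel_kerG (p := p)) hg q : ℂ) := by
  have hq := summable_norm_coe ha.le (by linarith : 1 / 2 < p) q
  have hdq := summable_norm_deriv ha.le hp q
  have hcq : Summable fun n => ‖conj (q n)‖ := by simpa using hq
  set f : Quad → ℝ → ℂ := fun t x => q t.i * fourierMode t.i x *
    (Complex.I * t.j.1 * q t.j * fourierMode t.j x) *
    (conj (q t.k * fourierMode t.k x) * conj (q t.l * fourierMode t.l x)) with hf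
  have hsum : ∀ x, HasSum (fun t => f t x) ((‖fourierSum q x‖ ^ 2 : ℂ) *
      conj (fourierSum q x) * deriv (fourierSum q) x) := by
    intro x
    have h1 := hasSum_fourierSum ha.le (by linarith : 1 / 2 < p) q x
    have h2 := hasSum_deriv_fourierSum ha.le hp q x
    have h3 := Complex.hasSum_conj'.2 h1
    have n1 := summable_norm_mul_fourierMode hq x
    have n2 := summable_norm_mul_fourierMode hdq x
    have n3 : Summable fun j => ‖conj (q j * fourierMode j x)‖ := by
      simpa only [RCLike.norm_conj] using n1
    refine hasSum_of_eq (hasSum_mul_mul_mul n1 n2 n3 n3 h1 h2 h3 h3).1 (fun _ => rfl) ?_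
    rw [← Complex.mul_conj']
    ring
  -- A majorant independent of `x`, since every mode has constant modulus; it allows dominated
  -- convergence for the sum over quadruples.
  have hbound : Summable fun t : Quad => ‖q t.i * (Complex.I * t.j.1 * q t.j) *
      (conj (q t.k) * conj (q t.l))‖ * fourierConst ^ 4 :=
    (hasSum_mul_mul_mul hq hdq hcq hcq hq.of_norm.hasSum hdq.of_norm.hasSum hcq.of_norm.hasSum
      hcq.of_norm.hasSum).2.mul_right _
  have hcont : ∀ t, Continuous (f t) := by
    intro t
    have h1 : ∀ j, Continuous (fourierMode j) := fun j =>
      continuous_iff_continuousAt.2 fun x => (hasDerivAt_fourierMode j x).continuousAt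
    have := h1 t.i
    have := h1 t.j
    have h2 := Complex.continuous_conj.comp (h1 t.k)
    have h3 := Complex.continuous_conj.comp (h1 t.l)
    simp only [hf, map_mul]
    simp only [Function.comp_def] at h2 h3
    fun_prop
  have hint := intervalIntegral.hasSum_integral_of_dominated_convergence
    (μ := MeasureTheory.volume) (a := 0) (b := 2 * Real.pi) (F := f)
    (f := fun x => (‖fourierSum q x‖ ^ 2 : ℂ) * conj (fourierSum q x) * deriv (fourierSum q) x)
    (fun t _ => ‖q t.i * (Complex.I * t.j.1 * q t.j) *
      (conj (q t.k) * conj (q t.l))‖ * fourierConst ^ 4)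
    (fun t => (hcont t).aestronglyMeasurable)
    (fun t => Filter.Eventually.of_forall fun x _ => le_of_eq (by
      simp only [hf, norm_mul, norm_fourierMode, RCLike.norm_conj]
      ring))
    (Filter.Eventually.of_forall fun _ _ => hbound)
    (by simp)
    (Filter.Eventually.of_forall fun x _ => hsum x)
  -- Orthogonality of exponentials leaves `i + j = k + l`, and the constant is `-(i/2) · i j ·
  -- 1/(2π) = j / 4π`.
  have hterm : ∀ t : Quad, -(Complex.I / 2) * ∫ x in (0 : ℝ)..(2 * Real.pi), f t x =
      rawKernel Quad.Momentum t * t.mono q := by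
    intro t
    have h1 : ∀ x : ℝ, f t x = (Complex.I * t.j.1 * t.mono q * (fourierConst : ℂ) ^ 4) *
        Complex.exp (Complex.I * (t.i.1 + t.j.1 - t.k.1 - t.l.1 : ℤ) * x) := by
      intro x
      have h2 : ∀ j : ZStar, conj (Complex.exp (Complex.I * j.1 * x)) =
          Complex.exp (-(Complex.I * j.1 * x)) := fun j => by
        rw [← Complex.exp_conj]
        simp
      have h3 : Complex.exp (Complex.I * (t.i.1 + t.j.1 - t.k.1 - t.l.1 : ℤ) * x) =
          Complex.exp (Complex.I * t.i.1 * x) * Complex.exp (Complex.I * t.j.1 * x) *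
          Complex.exp (-(Complex.I * t.k.1 * x)) * Complex.exp (-(Complex.I * t.l.1 * x)) := by
        rw [← Complex.exp_add, ← Complex.exp_add, ← Complex.exp_add]
        congr 1
        push_cast
        ring
      simp only [hf, fourierMode, map_mul, h2, h3, Complex.conj_ofReal, Quad.mono]
      ring
    simp only [h1]
    rw [intervalIntegral.integral_const_mul, integral_exp_I_mul]
    have h4 : (t.i.1 + t.j.1 - t.k.1 - t.l.1 = 0) ↔ t.Momentum := by
      simp only [Quad.Momentum]
      omega
    by_cases hm : t.Momentum
    · rw [if_pos (h4.2 hm), rawKernel_of hm]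
      have h5 : (fourierConst : ℂ) ^ 4 * ((2 * Real.pi : ℝ) : ℂ) =
          ((1 / (2 * Real.pi) : ℝ) : ℂ) := by
        rw [← fourierConst_pow_four]
        push_cast
        ring
      calc _ = -(Complex.I * Complex.I) / 2 * t.j.1 * t.mono q *
            ((fourierConst : ℂ) ^ 4 * ((2 * Real.pi : ℝ) : ℂ)) := by ring
        _ = _ := by
          rw [h5, Complex.I_mul_I]
          have : (Real.pi : ℂ) ≠ 0 := by exact_mod_cast Real.pi_ne_zero
          push_cast
          field_simp
          ring
    · rw [if_neg (fun h => hm (h4.1 h)), rawKernel_of_not hm]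
      ring
  have h6 := hint.mul_left (-(Complex.I / 2))
  have h7 := hasSum_raw_of_ham hg (P := Quad.Momentum) (fun _ h => h) Quad.momentum_swapLeft
    isHamKernel_kerG q
  simp only [hterm] at h6
  exact h6.unique h7

end Fourier

/-! ### Transport of Hamiltonians along the flow -/

section Transport

variable {E E' : Type*} [NormedAddCommGroup E] [NormedSpace ℝ E] [CompleteSpace E]
  [NormedAddCommGroup E'] [NormedSpace ℝ E'] [CompleteSpace E']

/-- An analytic map that is tangent to the identity at a fixed point restricts to an analytic
diffeomorphism of small neighbourhoods. -/
lemma exists_chart {f : E → E} (hf : AnalyticAt ℝ f 0)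
    (hd : fderiv ℝ f 0 = ContinuousLinearMap.id ℝ E) {P : E → Prop} (hP : ∀ᶠ q in 𝓝 0, P q) :
    ∃ Γ : OpenPartialHomeomorph E E, 0 ∈ Γ.source ∧ ⇑Γ = f ∧ AnalyticOnNhd ℝ Γ Γ.source ∧
      AnalyticOnNhd ℝ Γ.symm Γ.target ∧ ∀ q ∈ Γ.source, P q := by
  have hs : HasStrictFDerivAt f ((ContinuousLinearEquiv.refl ℝ E : E ≃L[ℝ] E) : E →L[ℝ] E) 0 := by
    have := hf.hasStrictFDerivAt
    rwa [hd] at this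
  -- Analyticity of the inverse is wanted on the whole target, so the chart is restricted to points
  -- where the derivative is invertible.
  have hinv : ∀ᶠ q in 𝓝 (0 : E), ∃ i : E ≃L[ℝ] E, (i : E →L[ℝ] E) = fderiv ℝ f q := by
    have h1 : ContinuousAt (fderiv ℝ f) 0 := hf.fderiv.continuousAt
    have h2 := ContinuousLinearEquiv.nhds (ContinuousLinearEquiv.refl ℝ E)
    rw [ContinuousLinearEquiv.coe_refl, ← hd] at h2
    exact h1 h2
  obtain ⟨V, hV, hVo, h0V⟩ := eventually_nhds_iff.1 (hP.and (hf.eventually_analyticAt.and hinv))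
  refine ⟨(hs.toOpenPartialHomeomorph f).restrOpen V hVo,
    ⟨hs.mem_toOpenPartialHomeomorph_source, h0V⟩, rfl, fun q hq => (hV q hq.2).2.1, fun y hy => ?_,
    fun q hq => (hV q hq.2).1⟩
  set Γ := (hs.toOpenPartialHomeomorph f).restrOpen V hVo with hΓ
  have hm : Γ.symm y ∈ Γ.source := Γ.map_target hy
  obtain ⟨i, hi⟩ := (hV _ hm.2).2.2
  exact Γ.analyticAt_symm hy (hV _ hm.2).2.1 hi.symm

lemma curveMap_primitive (L : E →L[ℝ] E') (f : Curve E) :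
    curveMap L (primitive E f) = primitive E' (curveMap L f) := by
  ext t
  simp only [curveMap_apply, primitive_apply]
  rw [← L.intervalIntegral_comp_comm (f.intervalIntegrable 0 t)]
  refine intervalIntegral.integral_congr fun s hs => ?_
  rw [Set.uIcc_of_le t.2.1] at hs
  have h : s ∈ Set.Icc (0 : ℝ) 1 := ⟨hs.1, hs.2.trans t.2.2⟩
  rw [Curve.extend_of_mem _ h, Curve.extend_of_mem _ h]
  rfl

lemma primitive_curveConst_one (x : E) : primitive E (curveConst E x) 1 = x := by
  have h : ∀ s : ℝ, (curveConst E x).extend s = x := fun s => by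
    simp [Curve.extend, Set.IccExtend]
  simp [primitive_apply, h]

variable {T : E →L[ℝ] E →L[ℝ] E →L[ℝ] E} {T' : E' →L[ℝ] E' →L[ℝ] E' →L[ℝ] E'} {J : E →L[ℝ] E'}
  {Φ : E → Curve E} {q : E}

/-- The curve of operators of the linearised equation along the flow line of `q`. -/
def flowLin (T' : E' →L[ℝ] E' →L[ℝ] E' →L[ℝ] E') (J : E →L[ℝ] E') (Φ : E → Curve E) (q : E) :
    Curve (E' →L[ℝ] E') := curveCubicDeriv T' (curveMap J (Φ q))

/-- The linearised flow is given by the propagator. -/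
lemma map_fderiv_flow (hJ : ∀ u v w, J (T u v w) = T' (J u) (J v) (J w))
    (hA : ‖flowLin T' J Φ q‖ < 1) (h : DifferentiableAt ℝ Φ q)
    (he : ∀ᶠ r in 𝓝 q, IsIntegralCurve T r (Φ r)) (v : E) (t : unitInterval) :
    J (fderiv ℝ Φ q v t) = propagator (flowLin T' J Φ q) t (J v) := by
  have h1 := congrArg (curveMap J) (fderiv_flow h he v)
  rw [map_add, curveMap_primitive] at h1
  -- `J` intertwines the two fields, so the image of the linearised flow solves the linear equation
  -- in the larger space, whose solution is unique.
  have h2 : curveMap J (curveApp (curveCubicDeriv T (Φ q)) (fderiv ℝ Φ q v)) =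
      curveApp (flowLin T' J Φ q) (curveMap J (fderiv ℝ Φ q v)) := by
    ext s
    simp [flowLin, cubicDeriv_apply, hJ]
  rw [h2] at h1
  have h3 := linear_curve_unique hA (v := J v) h1 (propagator_apply_eq hA (J v))
  exact congrArg (fun γ : Curve E' => γ t) h3

lemma fderiv_eval (h : DifferentiableAt ℝ Φ q) (t : unitInterval) :
    HasFDerivAt (fun r => Φ r t) (curveEval t ∘L fderiv ℝ Φ q) q :=
  (curveEval (E := E) t).hasFDerivAt.comp q h.hasFDerivAt

/-- The change along the flow of the Hamiltonian `H(q) = B(q, X(q))`. -/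
def hamDiff (B : E →L[ℝ] E' →L[ℝ] ℝ) (X : E →L[ℝ] E →L[ℝ] E →L[ℝ] E') (Φ : E → Curve E) (q : E) :
    Curve ℝ :=
  curveApp (curveMap B (Φ q)) (curveCubic X (Φ q)) - curveConst ℝ (B q (cubic X q))

/-- The change along the flow of the vector field of a Hamiltonian. -/
def vfDiff (T' : E' →L[ℝ] E' →L[ℝ] E' →L[ℝ] E') (J : E →L[ℝ] E')
    (X : E →L[ℝ] E →L[ℝ] E →L[ℝ] E') (Φ : E → Curve E) (q : E) : Curve E' :=
  curveApp (propagatorInv (flowLin T' J Φ q)) (curveCubic X (Φ q)) - curveConst E' (cubic X q)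

lemma hamDiff_apply (B : E →L[ℝ] E' →L[ℝ] ℝ) (X : E →L[ℝ] E →L[ℝ] E →L[ℝ] E') (Φ : E → Curve E)
    (q : E) (t : unitInterval) :
    hamDiff B X Φ q t = B (Φ q t) (cubic X (Φ q t)) - B q (cubic X q) := rfl

lemma vfDiff_apply (X : E →L[ℝ] E →L[ℝ] E →L[ℝ] E') (t : unitInterval) :
    vfDiff T' J X Φ q t = propagatorInv (flowLin T' J Φ q) t (cubic X (Φ q t)) - cubic X q := rfl

lemma analyticAt_flowLin (h : AnalyticAt ℝ Φ q) : AnalyticAt ℝ (flowLin T' J Φ) q :=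
  AnalyticAt.comp (g := curveCubicDeriv T') (f := fun q => curveMap J (Φ q))
    (analyticAt_curveCubicDeriv T' _) (analyticAt_clm_comp (curveMap J) h)

lemma analyticAt_curveCubic_flow (X : E →L[ℝ] E →L[ℝ] E →L[ℝ] E') (h : AnalyticAt ℝ Φ q) :
    AnalyticAt ℝ (fun q => curveCubic X (Φ q)) q :=
  AnalyticAt.comp (g := curveCubic X) (analyticAt_curveCubic X _) h

lemma analyticAt_hamDiff (B : E →L[ℝ] E' →L[ℝ] ℝ) (X : E →L[ℝ] E →L[ℝ] E →L[ℝ] E')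
    (h : AnalyticAt ℝ Φ q) : AnalyticAt ℝ (hamDiff B X Φ) q := by
  refine AnalyticAt.sub ?_ ?_
  · exact analyticAt_clm_apply (f := fun q => curveApp (curveMap B (Φ q)))
      (analyticAt_clm_comp curveApp (analyticAt_clm_comp (curveMap B) h))
      (analyticAt_curveCubic_flow X h)
  · exact analyticAt_clm_comp (curveConst ℝ) (analyticAt_clm_apply (f := fun q => B q)
      (B.analyticAt q) (analyticAt_cubic X q))

lemma analyticAt_vfDiff (X : E →L[ℝ] E →L[ℝ] E →L[ℝ] E') (hA : ‖flowLin T' J Φ q‖ < 1 / 2)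
    (h : AnalyticAt ℝ Φ q) : AnalyticAt ℝ (vfDiff T' J X Φ) q := by
  refine AnalyticAt.sub ?_ ?_
  · exact analyticAt_clm_apply (f := fun q => curveApp (propagatorInv (flowLin T' J Φ q)))
      (analyticAt_clm_comp curveApp (AnalyticAt.comp (g := propagatorInv)
        (analyticAt_propagatorInv hA) (analyticAt_flowLin h))) (analyticAt_curveCubic_flow X h)
  · exact analyticAt_clm_comp (curveConst E') (analyticAt_cubic X q)

/-- The derivative of a transported Hamiltonian is given by the transported vector field. -/
lemma fderiv_hamDiff {ω : E' →L[ℝ] E' →L[ℝ] ℝ}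
    (hω : ∀ x y z, ω (cubicDeriv T' x y) z + ω y (cubicDeriv T' x z) = 0)
    (hJ : ∀ u v w, J (T u v w) = T' (J u) (J v) (J w))
    {B : E →L[ℝ] E' →L[ℝ] ℝ} {X : E →L[ℝ] E →L[ℝ] E →L[ℝ] E'}
    (hX : ∀ q v, fderiv ℝ (fun q => B q (cubic X q)) q v = ω (J v) (cubic X q))
    (hA : ‖flowLin T' J Φ q‖ < 1 / 2) (h : AnalyticAt ℝ Φ q)
    (he : ∀ᶠ r in 𝓝 q, IsIntegralCurve T r (Φ r)) (v : E) (t : unitInterval) :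
    fderiv ℝ (hamDiff B X Φ) q v t = ω (J v) (vfDiff T' J X Φ q t) := by
  have hA1 : ‖flowLin T' J Φ q‖ < 1 := hA.trans (by norm_num)
  have hH : ∀ x, HasFDerivAt (fun q => B q (cubic X q)) (ω.flip (cubic X x) ∘L J) x := fun x => by
    have h1 : AnalyticAt ℝ (fun q => B q (cubic X q)) x :=
      analyticAt_clm_apply (f := fun q => B q) (B.analyticAt x) (analyticAt_cubic X x)
    refine h1.differentiableAt.hasFDerivAt.congr_fderiv ?_
    ext v
    exact hX x v
  have h1 := (curveEval (E := ℝ) t).hasFDerivAt.comp q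
    (analyticAt_hamDiff B X h).differentiableAt.hasFDerivAt
  have h2 := ((hH (Φ q t)).comp q (fderiv_eval h.differentiableAt t)).sub (hH q)
  have h3 := congrArg (fun L => L v) (h1.unique h2)
  have h4 : fderiv ℝ (hamDiff B X Φ) q v t =
      ω (J (fderiv ℝ Φ q v t)) (cubic X (Φ q t)) - ω (J v) (cubic X q) := h3
  rw [h4, vfDiff_apply, map_sub, map_fderiv_flow hJ hA1 h.differentiableAt he]
  congr 1
  -- Writing `X(Φ_t) = S_t S_t⁻¹ X(Φ_t)` with the propagator `S_t`, invariance of the form removes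
  -- `S_t` from both arguments and leaves the transported field.
  nth_rewrite 1 [← propagator_mul_inv hA t (cubic X (Φ q t))]
  exact propagator_preserves hA1 ω (fun s y z => hω _ y z) t _ _

/-- The linearised flow preserves the symplectic form. -/
lemma flow_preserves {ω : E' →L[ℝ] E' →L[ℝ] ℝ}
    (hω : ∀ x y z, ω (cubicDeriv T' x y) z + ω y (cubicDeriv T' x z) = 0)
    (hJ : ∀ u v w, J (T u v w) = T' (J u) (J v) (J w))
    (hA : ‖flowLin T' J Φ q‖ < 1 / 2) (h : AnalyticAt ℝ Φ q)
    (he : ∀ᶠ r in 𝓝 q, IsIntegralCurve T r (Φ r)) (v w : E) (t : unitInterval) :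
    ω (J (fderiv ℝ Φ q v t)) (J (fderiv ℝ Φ q w t)) = ω (J v) (J w) := by
  have hA1 : ‖flowLin T' J Φ q‖ < 1 := hA.trans (by norm_num)
  rw [map_fderiv_flow hJ hA1 h.differentiableAt he, map_fderiv_flow hJ hA1 h.differentiableAt he]
  exact propagator_preserves hA1 ω (fun s y z => hω _ y z) t _ _

/-- The value at time one of a Hamiltonian minus the time average of another one. -/
def endMinusMean (F : Type*) [NormedAddCommGroup F] [NormedSpace ℝ F] :
    Curve F × Curve F →L[ℝ] F :=
  (curveEval (E := F) 1).coprod (-(curveEval (E := F) 1 ∘L primitive F))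

lemma endMinusMean_apply {F : Type*} [NormedAddCommGroup F] [NormedSpace ℝ F] (f g : Curve F) :
    endMinusMean F (f, g) = f 1 - primitive F g 1 := by
  simp [endMinusMean, sub_eq_add_neg]

/-- The pairing with a fixed vector is continuous and linear, so it commutes with the time integral;
the identity at each time then passes to the mean. -/
lemma fderiv_endMinusMean {ω : E' →L[ℝ] E' →L[ℝ] ℝ}
    (hω : ∀ x y z, ω (cubicDeriv T' x y) z + ω y (cubicDeriv T' x z) = 0)
    (hJ : ∀ u v w, J (T u v w) = T' (J u) (J v) (J w))
    {B : E →L[ℝ] E' →L[ℝ] ℝ} {X Y : E →L[ℝ] E →L[ℝ] E →L[ℝ] E'}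
    (hX : ∀ q v, fderiv ℝ (fun q => B q (cubic X q)) q v = ω (J v) (cubic X q))
    (hY : ∀ q v, fderiv ℝ (fun q => B q (cubic Y q)) q v = ω (J v) (cubic Y q))
    (hA : ‖flowLin T' J Φ q‖ < 1 / 2) (h : AnalyticAt ℝ Φ q)
    (he : ∀ᶠ r in 𝓝 q, IsIntegralCurve T r (Φ r)) (v : E) :
    fderiv ℝ (fun q => endMinusMean ℝ (hamDiff B X Φ q, hamDiff B Y Φ q)) q v =
      ω (J v) (endMinusMean E' (vfDiff T' J X Φ q, vfDiff T' J Y Φ q)) := by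
  have h1 := (endMinusMean ℝ).hasFDerivAt.comp q
    ((analyticAt_hamDiff B X h).differentiableAt.hasFDerivAt.prodMk
      (analyticAt_hamDiff B Y h).differentiableAt.hasFDerivAt)
  have h2 : fderiv ℝ (fun q => endMinusMean ℝ (hamDiff B X Φ q, hamDiff B Y Φ q)) q v =
      endMinusMean ℝ (fderiv ℝ (hamDiff B X Φ) q v, fderiv ℝ (hamDiff B Y Φ) q v) :=
    congrArg (fun L => L v) h1.fderiv
  have h3 : fderiv ℝ (hamDiff B Y Φ) q v = curveMap (ω (J v)) (vfDiff T' J Y Φ q) := by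
    ext t
    exact fderiv_hamDiff hω hJ hY hA h he v t
  rw [h2, endMinusMean_apply, endMinusMean_apply, map_sub, h3, ← curveMap_primitive,
    fderiv_hamDiff hω hJ hX hA h he v 1]
  rfl

/-! ### Orders of the transported Hamiltonians and vector fields. -/

lemma norm_curveCubic_le {F : Type*} [NormedAddCommGroup F] [NormedSpace ℝ F]
    (X : E →L[ℝ] E →L[ℝ] E →L[ℝ] F) (γ : Curve E) : ‖curveCubic X γ‖ ≤ ‖X‖ * ‖γ‖ ^ 3 := by
  rw [ContinuousMap.norm_le _ (by positivity)]
  intro t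
  rw [curveCubic_apply]
  refine (norm_cubic_le X _).trans ?_
  gcongr
  exact γ.norm_coe_le_norm t

/-- Near the origin, the flow lines are small and close to constant. -/
lemma eventually_norm_flow_le (h : AnalyticAt ℝ Φ 0) (h0 : Φ 0 = 0)
    (he : ∀ᶠ r in 𝓝 0, IsIntegralCurve T r (Φ r)) :
    ∃ C : ℝ, 1 ≤ C ∧ ∀ᶠ q in 𝓝 0, ‖Φ q‖ ≤ C * ‖q‖ ∧ ‖Φ q - curveConst E q‖ ≤ C * ‖q‖ ^ 3 := by
  have h1 := h.differentiableAt.isBigO_sub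
  simp only [h0, sub_zero] at h1
  obtain ⟨c, hc⟩ := h1.bound
  set c' := max c 1
  have hc1 : 1 ≤ c' := le_max_right _ _
  refine ⟨c' + ‖T‖ * c' ^ 3, le_add_of_le_of_nonneg hc1 (by positivity), ?_⟩
  filter_upwards [hc, he] with q hq hi
  have h2 : ‖Φ q‖ ≤ c' * ‖q‖ := hq.trans (by gcongr; exact le_max_left _ _)
  refine ⟨h2.trans (by gcongr; exact le_add_of_nonneg_right (by positivity)), ?_⟩
  have h3 : Φ q - curveConst E q = primitive E (curveCubic T (Φ q)) := sub_eq_iff_eq_add'.2 hi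
  rw [h3]
  calc _ ≤ ‖T‖ * ‖Φ q‖ ^ 3 := (norm_primitive_le _).trans (norm_curveCubic_le T _)
    _ ≤ ‖T‖ * (c' * ‖q‖) ^ 3 := by gcongr
    _ = ‖T‖ * c' ^ 3 * ‖q‖ ^ 3 := by ring
    _ ≤ _ := by gcongr; exact le_add_of_nonneg_left (by positivity)

/-- A Lipschitz constant of order `‖q‖³` multiplies a displacement of order `‖q‖³`. -/
lemma hamDiff_isBigO (h : AnalyticAt ℝ Φ 0) (h0 : Φ 0 = 0)
    (he : ∀ᶠ r in 𝓝 0, IsIntegralCurve T r (Φ r)) {B : E →L[ℝ] E' →L[ℝ] ℝ}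
    {X : E →L[ℝ] E →L[ℝ] E →L[ℝ] E'}
    (hX : ∃ C : ℝ, 0 ≤ C ∧ ∀ (x y : E) (M : ℝ), ‖x‖ ≤ M → ‖y‖ ≤ M →
      |B x (cubic X x) - B y (cubic X y)| ≤ C * M ^ 3 * ‖x - y‖) :
    hamDiff B X Φ =O[𝓝 0] fun q => ‖q‖ ^ 6 := by
  obtain ⟨C, hC, hb⟩ := eventually_norm_flow_le h h0 he
  obtain ⟨D, hD, hd⟩ := hX
  refine Asymptotics.IsBigO.of_bound (D * C ^ 4) ?_
  filter_upwards [hb] with q hq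
  have hC0 : 0 ≤ C := zero_le_one.trans hC
  rw [ContinuousMap.norm_le _ (by positivity)]
  intro t
  rw [hamDiff_apply, Real.norm_eq_abs]
  have h1 : ‖Φ q t - q‖ ≤ C * ‖q‖ ^ 3 :=
    ((Φ q - curveConst E q).norm_coe_le_norm t).trans hq.2
  calc _ ≤ D * (C * ‖q‖) ^ 3 * ‖Φ q t - q‖ :=
        hd _ _ _ (((Φ q).norm_coe_le_norm t).trans hq.1) (le_mul_of_one_le_left (norm_nonneg q) hC)
    _ ≤ D * (C * ‖q‖) ^ 3 * (C * ‖q‖ ^ 3) := by gcongr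
    _ = D * C ^ 4 * ‖q‖ ^ 6 := by ring
    _ = _ := by rw [norm_pow, norm_norm]

lemma norm_triDeriv_apply_le {F : Type*} [NormedAddCommGroup F] [NormedSpace ℝ F]
    (X : E →L[ℝ] E →L[ℝ] E →L[ℝ] F) (q : E) : ‖cubicDeriv X q‖ ≤ 3 * ‖X‖ * ‖q‖ ^ 2 := by
  refine ContinuousLinearMap.opNorm_le_bound _ (by positivity) fun v => ?_
  rw [cubicDeriv_apply]
  calc _ ≤ ‖X q q v‖ + ‖X q v q‖ + ‖X v q q‖ := norm_add₃_le
    _ ≤ ‖X‖ * ‖q‖ * ‖q‖ * ‖v‖ + ‖X‖ * ‖q‖ * ‖v‖ * ‖q‖ + ‖X‖ * ‖v‖ * ‖q‖ * ‖q‖ := by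
        gcongr <;> exact norm_trilinear_le _ _ _ _
    _ = _ := by ring

/-- The difference splits as `(S⁻¹ - 1) X(Φ)` plus `X(Φ) - X`. The first is of order `2 + 3`, since
the linearised field is quadratic in `q`; the second is a Lipschitz constant of order 2 times a
displacement of order 3. -/
lemma vfDiff_isBigO (h : AnalyticAt ℝ Φ 0) (h0 : Φ 0 = 0)
    (he : ∀ᶠ r in 𝓝 0, IsIntegralCurve T r (Φ r)) (X : E →L[ℝ] E →L[ℝ] E →L[ℝ] E') :
    vfDiff T' J X Φ =O[𝓝 0] fun q => ‖q‖ ^ 5 := by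
  obtain ⟨C, hC, hb⟩ := eventually_norm_flow_le h h0 he
  have hC0 : 0 ≤ C := zero_le_one.trans hC
  have hz : flowLin T' J Φ 0 = 0 := by rw [flowLin, h0, map_zero, curveCubicDeriv_zero]
  have hlin : flowLin T' J Φ =O[𝓝 0] fun q => ‖q‖ ^ 2 := by
    refine Asymptotics.IsBigO.of_bound (3 * ‖T'‖ * (‖J‖ * C) ^ 2) ?_
    filter_upwards [hb] with q hq
    rw [ContinuousMap.norm_le _ (by positivity)]
    intro t
    rw [flowLin, curveCubicDeriv_apply, curveMap_apply]
    refine (norm_triDeriv_apply_le T' _).trans ?_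
    have : ‖J (Φ q t)‖ ≤ ‖J‖ * C * ‖q‖ := by
      refine (J.le_opNorm _).trans ?_
      rw [mul_assoc]
      gcongr
      exact ((Φ q).norm_coe_le_norm t).trans hq.1
    calc _ ≤ 3 * ‖T'‖ * (‖J‖ * C * ‖q‖) ^ 2 := by gcongr
      _ = 3 * ‖T'‖ * (‖J‖ * C) ^ 2 * ‖q‖ ^ 2 := by ring
      _ = _ := by rw [norm_pow, norm_norm]
  have hinv : (fun q => propagatorInv (flowLin T' J Φ q) - 1) =O[𝓝 0] fun q => ‖q‖ ^ 2 := by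
    have hc : Filter.Tendsto (flowLin T' J Φ) (𝓝 0) (𝓝 0) := by
      have := (analyticAt_flowLin (T' := T') (J := J) h).continuousAt.tendsto
      rwa [hz] at this
    exact (propagatorInv_sub_one_isBigO.comp_tendsto hc).trans hlin
  have hcub : (fun q => curveCubic X (Φ q)) =O[𝓝 0] fun q => ‖q‖ ^ 3 := by
    refine Asymptotics.IsBigO.of_bound (‖X‖ * C ^ 3) ?_
    filter_upwards [hb] with q hq
    calc _ ≤ ‖X‖ * ‖Φ q‖ ^ 3 := norm_curveCubic_le X _
      _ ≤ ‖X‖ * (C * ‖q‖) ^ 3 := by gcongr; exact hq.1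
      _ = ‖X‖ * C ^ 3 * ‖q‖ ^ 3 := by ring
      _ = _ := by rw [norm_pow, norm_norm]
  have h1 : (fun q => curveApp (propagatorInv (flowLin T' J Φ q) - 1) (curveCubic X (Φ q)))
      =O[𝓝 0] fun q => ‖q‖ ^ 5 := by
    have h2 : (fun q => ‖propagatorInv (flowLin T' J Φ q) - 1‖ * ‖curveCubic X (Φ q)‖)
        =O[𝓝 0] fun q => ‖q‖ ^ 2 * ‖q‖ ^ 3 := hinv.norm_left.mul hcub.norm_left
    refine (Asymptotics.IsBigO.of_bound 1 (Filter.Eventually.of_forall fun q => ?_)).trans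
      (h2.congr_right fun q => by ring)
    rw [one_mul, norm_mul, norm_norm, norm_norm]
    exact norm_curveApp_le _ _
  have h3 : (fun q => curveCubic X (Φ q) - curveConst E' (cubic X q)) =O[𝓝 0]
      fun q => ‖q‖ ^ 5 := by
    refine Asymptotics.IsBigO.of_bound (3 * ‖X‖ * C ^ 3) ?_
    filter_upwards [hb] with q hq
    rw [ContinuousMap.norm_le _ (by positivity)]
    intro t
    have h4 : ‖Φ q t - q‖ ≤ C * ‖q‖ ^ 3 :=
      ((Φ q - curveConst E q).norm_coe_le_norm t).trans hq.2
    have h5 : (curveCubic X (Φ q) - curveConst E' (cubic X q)) t = cubic X (Φ q t) - cubic X q :=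
      rfl
    rw [h5]
    calc _ ≤ 3 * ‖X‖ * (C * ‖q‖) ^ 2 * ‖Φ q t - q‖ :=
          norm_cubic_sub_le X (((Φ q).norm_coe_le_norm t).trans hq.1)
            (le_mul_of_one_le_left (norm_nonneg q) hC)
      _ ≤ 3 * ‖X‖ * (C * ‖q‖) ^ 2 * (C * ‖q‖ ^ 3) := by gcongr
      _ = 3 * ‖X‖ * C ^ 3 * ‖q‖ ^ 5 := by ring
      _ = _ := by rw [norm_pow, norm_norm]
  refine (h1.add h3).congr_left fun q => ?_
  ext t
  simp [vfDiff_apply]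

lemma endMinusMean_isBigO {F : Type*} [NormedAddCommGroup F] [NormedSpace ℝ F]
    {f g : E → Curve F} {k : E → ℝ} (hf : f =O[𝓝 0] k) (hg : g =O[𝓝 0] k) :
    (fun q => endMinusMean F (f q, g q)) =O[𝓝 0] k :=
  ((endMinusMean F).isBigO_comp _ _).trans (hf.prod_left hg)

end Transport

/-! ### The normal form -/

section NormalForm

variable {a p : ℝ}

/-- The vector field of the generating Hamiltonian. -/
abbrev genField {s : ℝ} (n₁ n₂ : ℤ) (hs : IsGood a s s) :
    Ell a s →L[ℝ] Ell a s →L[ℝ] Ell a s →L[ℝ] Ell a s :=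
  vf (isHamKernel_kerF n₁ n₂) hs

/-- The same series defines `X_F` on every space of the scale. This is the intertwining relation
that lets the linearised flow act on `ℓ^{a,p-1}`. -/
lemma incl_genField {s s' : ℝ} (n₁ n₂ : ℤ) (hs : IsGood a s s) (hs' : IsGood a s' s') (h : s' ≤ s)
    (u v w : Ell a s) : incl a h (genField n₁ n₂ hs u v w) =
      genField n₁ n₂ hs' (incl a h u) (incl a h v) (incl a h w) := by
  refine Ell.ext' fun n => ?_
  rw [incl_coe, genField, genField, vf, vf, tri_coe, tri_coe]
  simp only [triSeq, incl_coe]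

/-- The bilinear form with `ham q = hamForm q (X q)`. -/
def hamForm (hg : IsGood a p (p - 1)) : Ell a p →L[ℝ] Ell a (p - 1) →L[ℝ] ℝ :=
  (1 / 4 : ℝ) • (om hg.a_nonneg hg.nonneg ∘L incl a hg.le)

lemma cubic_isBigO {E F : Type*} [NormedAddCommGroup E] [NormedSpace ℝ E]
    [NormedAddCommGroup F] [NormedSpace ℝ F] (X : E →L[ℝ] E →L[ℝ] E →L[ℝ] F) :
    cubic X =O[𝓝 0] fun q => ‖q‖ ^ 3 := by
  refine Asymptotics.IsBigO.of_bound ‖X‖ (Filter.Eventually.of_forall fun q => ?_)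
  rw [norm_pow, norm_norm]
  exact norm_cubic_le X q

/-- The properties of the points in the domain of the change of coordinates. -/
structure IsFlowPoint (n₁ n₂ : ℤ) (hs : IsGood a p p) (ht : IsGood a (p - 1) (p - 1))
    (hg : IsGood a p (p - 1)) (Φ : Ell a p → Curve (Ell a p)) (q : Ell a p) : Prop where
  analytic : AnalyticAt ℝ Φ q
  eventually : ∀ᶠ r in 𝓝 q, IsIntegralCurve (genField n₁ n₂ hs) r (Φ r)
  small : ‖flowLin (genField n₁ n₂ ht) (incl a hg.le) Φ q‖ < 1 / 2
  majorant : (∀ τ, ennormSq a p (treeMaj (fun x => -Complex.I * kerF n₁ n₂ x) q τ) ≠ ⊤) ∧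
    ennormSq a p (flowMaj (fun x => -Complex.I * kerF n₁ n₂ x) q) ≠ ⊤
  hasSum : HasSum (treeTerm (genField n₁ n₂ hs) q) (Φ q 1)

/-- The flow of the generating Hamiltonian near the origin. -/
lemma exists_flow_chart (n₁ n₂ : ℤ) (hs : IsGood a p p) (ht : IsGood a (p - 1) (p - 1))
    (hg : IsGood a p (p - 1)) :
    ∃ (Φ : Ell a p → Curve (Ell a p)) (Γ : OpenPartialHomeomorph (Ell a p) (Ell a p)),
      Φ 0 = 0 ∧ 0 ∈ Γ.source ∧ (∀ q, Γ q = Φ q 1) ∧ AnalyticOnNhd ℝ Γ Γ.source ∧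
      AnalyticOnNhd ℝ Γ.symm Γ.target ∧ ∀ q ∈ Γ.source, IsFlowPoint n₁ n₂ hs ht hg Φ q := by
  obtain ⟨Φ, h1, h2, h3, h4⟩ := exists_flow (genField n₁ n₂ hs)
  obtain ⟨r, hr, h5⟩ := exists_flowMaj_ne_top (a := a)
    ((isHamKernel_kerF (s := p) n₁ n₂).const_mul (-Complex.I)) hs
  have h6 := eventually_hasSum_flow h4
  have h7 : ∀ᶠ q in 𝓝 (0 : Ell a p),
      ‖flowLin (genField n₁ n₂ ht) (incl a hg.le) Φ q‖ < 1 / 2 := by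
    have hc := (analyticAt_flowLin (T' := genField n₁ n₂ ht) (J := incl a hg.le) h1).continuousAt
    have hz : flowLin (genField n₁ n₂ ht) (incl a hg.le) Φ 0 = 0 := by
      rw [flowLin, h2, map_zero, curveCubicDeriv_zero]
    refine hc.norm.eventually_lt continuousAt_const ?_
    rw [hz, norm_zero]
    norm_num
  have h8 : ∀ᶠ q in 𝓝 (0 : Ell a p), ‖q‖ ≤ r := by
    filter_upwards [Metric.closedBall_mem_nhds (0 : Ell a p) hr] with q hq
    simpa using hq
  have h9 : ∀ᶠ q in 𝓝 (0 : Ell a p), IsFlowPoint n₁ n₂ hs ht hg Φ q := by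
    filter_upwards [h1.eventually_analyticAt, h3.eventually_nhds, h7, h8, h6] with q g1 g2 g3 g4 g5
    exact ⟨g1, g2, g3, h5 q g4, g5⟩
  -- At the origin the linearised field vanishes, so the linearised flow is constant in time.
  have hd : fderiv ℝ (fun q => Φ q 1) 0 = ContinuousLinearMap.id ℝ (Ell a p) := by
    rw [(fderiv_eval h1.differentiableAt 1).fderiv]
    ext v
    have := fderiv_flow h1.differentiableAt h3 v
    rw [h2, curveCubicDeriv_zero, map_zero, _root_.zero_apply, map_zero, add_zero] at this
    change fderiv ℝ Φ 0 v 1 = v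
    rw [this]
    rfl
  obtain ⟨Γ, k1, k2, k3, k4, k5⟩ := exists_chart
    (analyticAt_clm_comp (curveEval (E := Ell a p) 1) h1) hd h9
  exact ⟨Φ, Γ, h2, k1, fun q => congrFun k2 q, k3, k4, k5⟩

/-- The change of `Λ` along the flow of the generating Hamiltonian. -/
lemma Lam_flow (ha : 0 < a) (hp : 3 / 2 < p) (n₁ n₂ : ℤ) (hg : IsGood a p (p - 1))
    {Φ : Ell a p → Curve (Ell a p)} {q : Ell a p}
    (h : IsIntegralCurve (genField n₁ n₂ (isGood_self ha (by linarith))) q (Φ q)) :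
    Lam (Φ q 1) = Lam q - ham (isHamKernel_kerN (p := p) n₁ n₂) hg q -
      primitive ℝ (hamDiff (hamForm hg) (vf (isHamKernel_kerN n₁ n₂) hg) Φ q) 1 := by
  set N := ham (isHamKernel_kerN (p := p) n₁ n₂) hg
  set g := hamDiff (hamForm hg) (vf (isHamKernel_kerN n₁ n₂) hg) Φ q
  -- `hamDiff` records `N(Φ_t) - N(q)`, so adding back the constant gives `N` along the flow line,
  -- and its negative is the derivative of `Λ` there.
  have hN : ∀ t : unitInterval, (-(g + curveConst ℝ (N q))) t = -N (Φ q t) := fun t => by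
    have : (-(g + curveConst ℝ (N q))) t = -((N (Φ q t) - N q) + N q) := rfl
    rw [this, sub_add_cancel]
  have hd : ∀ t ∈ Set.Icc (0 : ℝ) 1, HasDerivWithinAt (fun t => Lam ((Φ q).extend t))
      ((-(g + curveConst ℝ (N q)) : Curve ℝ).extend t) (Set.Icc 0 1) t := by
    intro t ht
    obtain ⟨L, hL, hLv⟩ := hasFDerivAt_Lam (a := a) (p := p) ha.le hg.nonneg ((Φ q).extend t)
    have h1 := hL.comp_hasDerivWithinAt t (h.hasDerivWithinAt ht)
    rw [hLv, pair_vf_kerF ha hp hg.nonneg n₁ n₂] at h1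
    rw [Curve.extend_of_mem _ ht, hN]
    rw [Curve.extend_of_mem _ ht] at h1
    exact h1
  have h1 := primitive_one_eq_sub hd
  have e1 : (Φ q).extend 1 = Φ q 1 := (Φ q).extend_coe 1
  have e0 : (Φ q).extend 0 = q := ((Φ q).extend_coe 0).trans h.apply_zero
  rw [map_neg, map_add] at h1
  simp only [e1, e0, ContinuousMap.neg_apply, ContinuousMap.add_apply,
    primitive_curveConst_one] at h1
  linarith

end NormalForm

end DNLS

end

/-! ### Assembly of the normal form. -/

theorem mainTheorem2 (a p : ℝ) (ha : 0 < a) (hp : 3 / 2 < p)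
    (n₁ n₂ : ℤ) (hJ : DNLS.Admissible n₁ n₂) :
    ∃ (F : DNLS.Ell a p → ℝ) (XF : DNLS.Ell a p → DNLS.Ell a p)
      (Γ : OpenPartialHomeomorph (DNLS.Ell a p) (DNLS.Ell a p))
      (Ghat K : DNLS.Ell a p → ℝ)
      (XGbar XGhat XK : DNLS.Ell a p → DNLS.Ell a (p - 1)),
      -- the change of coordinates is the time-1 map of a quartic Hamiltonian
      DNLS.IsQuartic F ∧ DNLS.HasAnalyticVF F XF Set.univ ∧
      DNLS.IsSymplecticChange Γ ∧ DNLS.IsTimeOneMap XF Γ Γ.source ∧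
      -- the transformed Hamiltonian
      (∀ q ∈ Γ.source, (DNLS.Lam (Γ q) : ℂ) + DNLS.G (Γ q) =
        ((DNLS.Lam q + DNLS.Gbar q + Ghat q + K q : ℝ) : ℂ)) ∧
      -- the quartic remainder
      (∀ q, HasSum (DNLS.deltaThreeTerm n₁ n₂ q) ((Ghat q - DNLS.offDiag q : ℝ) : ℂ)) ∧
      -- regularity of the vector fields
      DNLS.HasAnalyticVF DNLS.Gbar XGbar Γ.source ∧
      DNLS.HasAnalyticVF Ghat XGhat Γ.source ∧
      DNLS.HasAnalyticVF K XK Γ.source ∧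
      -- orders
      (Ghat =O[𝓝 0] fun q => ‖q‖ ^ 4) ∧ (XGhat =O[𝓝 0] fun q => ‖q‖ ^ 3) ∧
      (K =O[𝓝 0] fun q => ‖q‖ ^ 6) ∧ (XK =O[𝓝 0] fun q => ‖q‖ ^ 5) ∧
      -- compact form and gauge invariance of the remainder
      DNLS.InClassA K Γ.source := by
  have hg := DNLS.isGood_deriv (a := a) (p := p) ha hp
  have hs : DNLS.IsGood a p p := DNLS.isGood_self ha (by linarith)
  have ht : DNLS.IsGood a (p - 1) (p - 1) := DNLS.isGood_self ha (by linarith)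
  obtain ⟨Φ, Γ, hΦ0, h0, hΓ, hΓa, hΓs, hP⟩ := DNLS.exists_flow_chart n₁ n₂ hs ht hg
  have hF := DNLS.isHamKernel_kerF (s := p) n₁ n₂
  have hN := DNLS.isHamKernel_kerN (p := p) n₁ n₂
  have hG := DNLS.isHamKernel_kerG (p := p)
  have hH := DNLS.isHamKernel_kerHat (p := p) n₁ n₂
  have hB := DNLS.isHamKernel_kerBar (p := p)
  have hω := DNLS.om_cubicDeriv_vf_skew (DNLS.isHamKernel_kerF n₁ n₂) ht
  have hincl := DNLS.incl_genField n₁ n₂ hs ht hg.le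
  let dH (b) (hb : DNLS.IsHamKernel p (p - 1) b) :=
    DNLS.hamDiff (DNLS.hamForm hg) (DNLS.vf hb hg) Φ
  let dX (b) (hb : DNLS.IsHamKernel p (p - 1) b) :=
    DNLS.vfDiff (DNLS.genField n₁ n₂ ht) (DNLS.incl a hg.le) (DNLS.vf hb hg) Φ
  -- `K` is the change of `G` up to time 1 minus the time average of the change of the removed part
  -- `N`, and `XK` is the same combination of the transported vector fields.
  let K := fun q => DNLS.endMinusMean ℝ (dH _ hG q, dH _ hN q)
  let XK := fun q => DNLS.endMinusMean (DNLS.Ell a (p - 1)) (dX _ hG q, dX _ hN q)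
  have hint : ∀ q ∈ Γ.source, DNLS.IsIntegralCurve (DNLS.genField n₁ n₂ hs) q (Φ q) :=
    fun q hq => (hP q hq).eventually.self_of_nhds
  have hLam : ∀ q ∈ Γ.source, DNLS.Lam (Γ q) + DNLS.ham hG hg (Γ q) =
      DNLS.Lam q + DNLS.Gbar q + DNLS.ham hH hg q + K q := by
    intro q hq
    have h1 := DNLS.Lam_flow ha hp n₁ n₂ hg (hint q hq)
    have h2 := DNLS.ham_G_eq hg n₁ n₂ q
    have h3 : K q = (DNLS.ham hG hg (Φ q 1) - DNLS.ham hG hg q) -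
        DNLS.primitive ℝ (dH _ hN q) 1 := DNLS.endMinusMean_apply _ _
    rw [hΓ q, h3, h1, h2]
    simp only [dH]
    ring
  have hfd : ∀ (b) (hb : DNLS.IsHamKernel p (p - 1) b) (q v),
      fderiv ℝ (fun q => DNLS.hamForm hg q (DNLS.cubic (DNLS.vf hb hg) q)) q v =
        DNLS.om hg.a_nonneg hg.nonneg (DNLS.incl a hg.le v) (DNLS.cubic (DNLS.vf hb hg) q) :=
    fun b hb q v => DNLS.fderiv_ham hb hg q v
  have hΦa : AnalyticAt ℝ Φ 0 := (hP 0 h0).analytic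
  refine ⟨DNLS.ham hF hs, DNLS.cubic (DNLS.genField n₁ n₂ hs), Γ, DNLS.ham hH hg, K,
    DNLS.cubic (DNLS.vf hB hg), DNLS.cubic (DNLS.vf hH hg), XK,
    ⟨DNLS.kerF n₁ n₂, hF.momentum, DNLS.hasSum_ham hF hs⟩, DNLS.hasAnalyticVF_ham hF hs _,
    ⟨h0, ?_, hΓa, hΓs, ?_⟩, ?_, ?_, DNLS.hasSum_deltaThree hg n₁ n₂, ?_,
    DNLS.hasAnalyticVF_ham hH hg _, ?_, ?_, ?_, ?_, ?_, ?_⟩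
  · rw [hΓ, hΦ0]
    rfl
  · intro q hq v w
    have hd : ∀ v, fderiv ℝ Γ q v = fderiv ℝ Φ q v 1 := fun v => by
      rw [show ⇑Γ = fun q => Φ q 1 from funext hΓ,
        (DNLS.fderiv_eval (hP q hq).analytic.differentiableAt 1).fderiv]
      rfl
    rw [DNLS.symp_eq_om ha.le (hg.nonneg.trans hg.le), DNLS.symp_eq_om ha.le (hg.nonneg.trans hg.le),
      ← DNLS.om_incl ha.le hg.nonneg hg.le, ← DNLS.om_incl ha.le hg.nonneg hg.le, hd, hd]
    exact congrArg _ (DNLS.flow_preserves hω hincl (hP q hq).small (hP q hq).analytic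
      (hP q hq).eventually v w 1)
  · intro q hq
    refine ⟨(Φ q).extend, ((Φ q).extend_coe 0).trans (hint q hq).apply_zero,
      ((Φ q).extend_coe 1).trans (hΓ q).symm, fun t ht' => (hint q hq).hasDerivWithinAt ht'⟩
  · intro q hq
    rw [DNLS.G_eq_ham ha hp hg, ← hLam q hq]
    push_cast
    rfl
  · rw [DNLS.Gbar_eq_ham hg]
    exact DNLS.hasAnalyticVF_ham hB hg _
  · refine DNLS.HasAnalyticVF.of_fderiv hg.a_nonneg hg.nonneg hg.le (fun q hq => ?_)
      (fun q hq => ?_) fun q hq v => ?_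
    · exact DNLS.analyticAt_clm_comp (DNLS.endMinusMean ℝ)
        ((DNLS.analyticAt_hamDiff _ _ (hP q hq).analytic).prod
          (DNLS.analyticAt_hamDiff _ _ (hP q hq).analytic))
    · exact DNLS.analyticAt_clm_comp (DNLS.endMinusMean (DNLS.Ell a (p - 1)))
        ((DNLS.analyticAt_vfDiff _ (hP q hq).small (hP q hq).analytic).prod
          (DNLS.analyticAt_vfDiff _ (hP q hq).small (hP q hq).analytic))
    · exact DNLS.fderiv_endMinusMean hω hincl (hfd _ hG) (hfd _ hN) (hP q hq).small
        (hP q hq).analytic (hP q hq).eventually v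
  · obtain ⟨C, -, hC⟩ := DNLS.abs_ham_le hH hg
    refine Asymptotics.IsBigO.of_bound C (Filter.Eventually.of_forall fun q => ?_)
    rw [norm_pow, norm_norm]
    exact hC q
  · exact DNLS.cubic_isBigO _
  · exact DNLS.endMinusMean_isBigO
      (DNLS.hamDiff_isBigO hΦa hΦ0 (hP 0 h0).eventually (DNLS.abs_ham_sub_le hG hg))
      (DNLS.hamDiff_isBigO hΦa hΦ0 (hP 0 h0).eventually (DNLS.abs_ham_sub_le hN hg))
  · exact DNLS.endMinusMean_isBigO
      (DNLS.vfDiff_isBigO hΦa hΦ0 (hP 0 h0).eventually _)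
      (DNLS.vfDiff_isBigO hΦa hΦ0 (hP 0 h0).eventually _)
  · have hY : ∀ q ∈ Γ.source,
        DNLS.ennormSq a p (DNLS.flowMaj (fun x => -Complex.I * DNLS.kerF n₁ n₂ x) q) ≠ ⊤ :=
      fun q hq => (hP q hq).majorant.2
    have hexp := DNLS.expands_flow (U := Γ.source) (Θ := Γ) (hF.toIsKernel.const_mul (-Complex.I))
      hs (fun q hq => (hP q hq).majorant) fun q hq => by
        rw [hΓ q]
        exact (hP q hq).hasSum
    have hp1 : 1 ≤ p := by linarith
    have hid := DNLS.expands_coord (a := a) (s := p) Γ.source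
    have hidY : ∀ q ∈ Γ.source, DNLS.ennormSq a p (fun n => ‖q n‖ₑ) ≠ ⊤ :=
      fun q _ => DNLS.ennormSq_coe_ne_top q
    -- For the expansion `K` is written as `Λ ∘ Γ + G ∘ Γ - Λ - Ḡ - Ĝ`; each of the five functions
    -- expands on its own with momentum and charge zero.
    obtain ⟨M1, e1⟩ := DNLS.expands_Lam ha.le hp1 hY hexp
    obtain ⟨M2, e2⟩ := DNLS.expands_ham hG hg hY hexp
    obtain ⟨M3, e3⟩ := DNLS.expands_Lam (Θ := id) ha.le hp1 hidY hid
    obtain ⟨M4, e4⟩ := DNLS.expands_ham (Θ := id) hB hg hidY hid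
    obtain ⟨M5, e5⟩ := DNLS.expands_ham (Θ := id) hH hg hidY hid
    refine (((((e1.add e2).add e3.neg).add e4.neg).add e5.neg).congr fun q hq => ?_).inClassA
    have h1 : K q = DNLS.Lam (Γ q) + DNLS.ham hG hg (Γ q) + -DNLS.Lam q + -DNLS.ham hB hg q +
        -DNLS.ham hH hg q := by
      have h2 := hLam q hq
      rw [DNLS.Gbar_eq_ham hg] at h2
      linarith
    rw [h1]
    push_cast
    rfl
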